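/- **Theorem (NP-completeness of SAT).** An instance of SAT is a finite set $U=\{u_0,\dots,u_{m-1}\}$ of Boolean variables together with a finite set $C$ of clauses over $U$, each clause being a finite set (disjunction) of literals $u$ or $\overline u$; it is satisfiable if some $t:U\to\{T,F\}$ makes every clause true. Instances are written as words over a fixed finite alphabet, by listing $U$ and then the clauses, and $\mathrm{SAT}$ is the language of the words that encode satisfiable instances. A language $L\subseteq A^*$ over a finite alphabet is in $\mathrm{NP}$ if some nondeterministic one-tape Turing machine $M$ decides it in time $p(n)$ for some polynomial $p$, i.e. on every input $x$ every computation of $M$ has at most $p(|x|)$ steps, and $x\in L$ if and only if some computation of $M$ on $x$ reaches the accepting state. Then: 1. $\mathrm{SAT}\in\mathrm{NP}$. 2. For every $L\in\mathrm{NP}$ there is a function $f$ from words to words, computable by a deterministic Turing machine in polynomial time, with $x\in L\iff f(x)\in\mathrm{SAT}$ for all $x$. Thus $\mathrm{SAT}$ is NP-complete. 3. More precisely, let $M=(\Gamma,A,b,Q,q_0,q_Y,q_N,\delta)$ decide $L$ in time $p(n)$, $p$ a polynomial, where $\delta(k,l)$ is the set of triples $(k',l',\Delta)$ (new state, written symbol,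 head displacement $\Delta\in\{-1,0,1\}$) available in state $k$ on scanned symbol $l$, and computations end in $q_Y$ and $q_N$. On input $x=x_1\cdots x_n$ the tape initially carries $x_j$ in cell $j$ for $1\le j\le n$ and $b$ in all other cells, and the head is on cell $1$. Then there is a polynomial-time computable map $x\mapsto f_L(x)$ from words to SAT instances such that $x\in L$ if and only if $f_L(x)$ is satisfiable and such that, up to a numbering of the variables, with $P=p(|x|)$ and with the cells $-P\le j\le P+1$, the variables of $f_L(x)$ are exactly $$Q[i,k],\qquad H[i,j],\qquad S[i,j,l]\qquad(0\le i\le P,\ -P\le j\le P+1,\ k\in Q,\ l\in\Gamma)$$ and its set of clauses is $G_1\cup\dots\cup G_6$, where * $G_1$: $\{Q[i,k]:k\in Q\}$, and $\{\overline{Q[i,k]},\overline{Q[i,k']}\}$ for $k\ne k'$, for $0\le i\le P$; * $G_2$: $\{H[i,j]:-P\le j\le P+1\}$, and $\{\overline{H[i,j]},\overline{H[i,j']}\}$ for $j<j'$, for $0\le i\le P$; * $G_3$: $\{S[i,j,l]:l\in\Gamma\}$, and $\{\overline{S[i,j,l]},\overline{S[i,j,l']}\}$ for $l\ne l'$, for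 $0\le i\le P$ and all cells $j$; * $G_4$: $\{Q[0,q_0]\}$, $\{H[0,1]\}$, and $\{S[0,j,s_j]\}$ for all cells $j$, where $s_j=x_j$ if $1\le j\le n$ and $s_j=b$ otherwise; * $G_5$: $\{Q[P,q_Y]\}$; * $G_6$: for $0\le i<P$ and all cells $j$, states $k$ and symbols $l$, the clause $\{\overline{S[i,j,l]},H[i,j],S[i+1,j,l]\}$; and all clauses consisting of the literals $\overline{H[i,j]},\overline{Q[i,k]},\overline{S[i,j,l]}$ together with, for each $(k',l',\Delta)\in\delta(k,l)$, one chosen literal among $H[i+1,j+\Delta]$, $Q[i+1,k']$, $S[i+1,j,l']$. Here $\delta(k,l)$ is replaced by $\{(k,l,0)\}$ if $k\in\{q_Y,q_N\}$, and a literal $H[i+1,j+\Delta]$ for which $j+\Delta$ is not one of the cells is omitted. -/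

import Mathlib

/-! ### Nondeterministic one-tape Turing machines -/

/-- Head movement: one cell to the left, no movement, or one cell to the right. -/
inductive Move : Type
  | left
  | stay
  | right

/-- The displacement of the head belonging to a movement. -/
def Move.shift : Move → ℤ
  | .left => -1
  | .stay => 0
  | .right => 1

/-- A nondeterministic Turing machine `(Γ, A, b, Q, q₀, q_Y, q_N, δ)` with input alphabet `A` and
one two-way infinite tape. `δ q s` is the set of all actions (new state, symbol written, movement)
available in state `q` when the symbol `s` is scanned. -/
structure NDTM (A : Type) where
  /-- the finite set `Q` of states -/
  State : Type
  /-- the finite tape alphabet `Γ` -/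
  Sym : Type
  finite_state : Finite State
  finite_sym : Finite Sym
  /-- the inclusion of the input alphabet into the tape alphabet -/
  input : A → Sym
  input_injective : Function.Injective input
  /-- the blank symbol, which is not an input symbol -/
  blank : Sym
  input_ne_blank : ∀ a, input a ≠ blank
  /-- the initial state `q₀` -/
  start : State
  /-- the accepting state `q_Y` -/
  accept : State
  /-- the rejecting state `q_N` -/
  reject : State
  accept_ne_reject : accept ≠ reject
  /-- the transition function -/
  δ : State → Sym → Set (State × Sym × Move)

namespace NDTM

variable {A : Type} (M : NDTM A)

/-- A configuration: current state, position of the head, contents of the tape. -/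
structure Cfg where
  state : M.State
  head : ℤ
  tape : ℤ → M.Sym

/-- The initial contents of the tape: the input word `x` stands in the cells `1, …, |x|`, and all
other cells are blank. -/
def initTape (x : List A) (j : ℤ) : M.Sym :=
  if 1 ≤ j then (x.map M.input).getD (j - 1).toNat M.blank else M.blank

/-- The initial configuration on input `x`; the head scans cell `1`. -/
def init (x : List A) : M.Cfg where
  state := M.start
  head := 1
  tape := M.initTape x

/-- The halting states are the accepting and the rejecting state. -/
def Halting (q : M.State) : Prop := q = M.accept ∨ q = M.reject

/-- `M.Step c c'`: the machine can pass from `c` to `c'` in one step. -/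
def Step (c c' : M.Cfg) : Prop :=
  ¬ M.Halting c.state ∧ ∃ t ∈ M.δ c.state (c.tape c.head),
    c' = ⟨t.1, c.head + t.2.2.shift, Function.update c.tape c.head t.2.1⟩

/-- `M.Reaches x n c`: some computation of `M` on input `x` is in configuration `c` after exactly
`n` steps. -/
inductive Reaches (x : List A) : ℕ → M.Cfg → Prop
  | init : Reaches x 0 (M.init x)
  | step {n : ℕ} {c c' : M.Cfg} : Reaches x n c → M.Step c c' → Reaches x (n + 1) c'

/-- `M` accepts `x` if some computation of `M` on `x` arrives in the accepting state. -/
def Accepts (x : List A) : Prop := ∃ n c, M.Reaches x n c ∧ c.state = M.accept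

/-- `M` decides `L` in time `T`: on every input `x`, every computation consists of at most `T |x|`
steps, and `x ∈ L` if and only if `M` accepts `x`. -/
def DecidesInTime (L : Language A) (T : ℕ → ℕ) : Prop :=
  (∀ x n c, M.Reaches x n c → n ≤ T x.length) ∧ ∀ x, x ∈ L ↔ M.Accepts x

end NDTM

/-! ### NP, polynomial reducibility, NP-completeness -/

/-- The class NP. -/
def InNP {A : Type} (L : Language A) : Prop :=
  ∃ (M : NDTM A) (p : Polynomial ℕ), M.DecidesInTime L (fun n => p.eval n)

/-- `f` is computable in polynomial time by a deterministic Turing machine, where words of the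
source and of the target are given by `ea` and `eb`. -/
def PolyTimeComputable {α β A B : Type} (ea : α → List A) (eb : β → List B) (f : α → β) : Prop :=
  Nonempty (Turing.TM2ComputableInPolyTime ea eb f)

/-- Polynomial (many-one) reducibility of languages. -/
def PolyReducible {A B : Type} (L₁ : Language A) (L₂ : Language B) : Prop :=
  ∃ f : List A → List B, PolyTimeComputable id id f ∧ ∀ x, x ∈ L₁ ↔ f x ∈ L₂

/-- NP-completeness: membership in NP, and every language in NP (over any finite alphabet) is
polynomially reducible to `L`. -/
def NPComplete {B : Type} (L : Language B) : Prop :=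
  InNP L ∧ ∀ (A : Type) [Fintype A] (L' : Language A), InNP L' → PolyReducible L' L

/-! ### The satisfiability problem -/

/-- A literal over the variables `V`: the variable itself (`sign = true`) or its negation
(`sign = false`). -/
structure Literal (V : Type) where
  var : V
  sign : Bool

/-- The literal `v`. -/
def posLit {V : Type} (v : V) : Literal V := ⟨v, true⟩

/-- The literal `¬ v`. -/
def negLit {V : Type} (v : V) : Literal V := ⟨v, false⟩

/-- Renaming of the variable of a literal. -/
def Literal.rename {V W : Type} (g : V → W) (l : Literal V) : Literal W := ⟨g l.var, l.sign⟩

/-- An instance of SAT: a set `U` of `numVars` variables, and a finite collection of clauses over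
`U`, each clause being given by the list of its literals. -/
structure SATInstance where
  numVars : ℕ
  clauses : List (List (Literal (Fin numVars)))

namespace SATInstance

/-- Some truth assignment makes at least one literal in each clause true. -/
def Satisfiable (I : SATInstance) : Prop :=
  ∃ t : Fin I.numVars → Bool, ∀ c ∈ I.clauses, ∃ l ∈ c, t l.var = l.sign

/-- The set of clauses of an instance, each clause being regarded as a set of literals. -/
def clauseSet (I : SATInstance) : Set (Set (Literal (Fin I.numVars))) :=
  {K | ∃ c ∈ I.clauses, K = {l | l ∈ c}}

end SATInstance

/-- The alphabet in which instances of SAT are written. -/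
inductive SATSymbol : Type
  | tick
  | clause
  | pos
  | neg

/-- A literal is written as its sign followed by the number of its variable in unary. -/
def Literal.encode {m : ℕ} (l : Literal (Fin m)) : List SATSymbol :=
  (if l.sign then SATSymbol.pos else SATSymbol.neg) :: List.replicate l.var SATSymbol.tick

/-- An instance is written as a list of `numVars` ticks, one for each variable in `U`, followed by
the clauses, each of which is introduced by the symbol `clause`. (As the whole set `U` is listed,
numbering the variables in unary or in binary makes at most a quadratic difference in length.) -/
def SATInstance.encode (I : SATInstance) : List SATSymbol :=
  List.replicate I.numVars SATSymbol.tick ++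
    I.clauses.flatMap (fun c => SATSymbol.clause :: c.flatMap Literal.encode)

/-- The language SAT: the words that encode satisfiable instances. -/
def SAT : Language SATSymbol := {w | ∃ I : SATInstance, I.Satisfiable ∧ I.encode = w}

/-! ### The clauses describing an accepting computation

Throughout, `P` is the time bound for the input word `x`; the times are `0, …, P` and the cells are
`-P, …, P + 1`. -/

/-- `Q i k`: at time `i` the machine is in state `k`; `H i j`: at time `i` the head scans cell `j`;
`S i j l`: at time `i` cell `j` contains the symbol `l`. -/
inductive TableauVar {A : Type} (M : NDTM A) : Type
  | Q (i : ℕ) (k : M.State)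
  | H (i : ℕ) (j : ℤ)
  | S (i : ℕ) (j : ℤ) (l : M.Sym)

namespace NDTM

open TableauVar

variable {A : Type} (M : NDTM A)

/-- The cells `-P, …, P + 1`. -/
def cells (P : ℕ) : Set ℤ := Set.Icc (-(P : ℤ)) ((P : ℤ) + 1)

/-- The set of variables for the times `0, …, P` and the cells `-P, …, P + 1`. -/
def tableauVars (P : ℕ) : Set (TableauVar M) :=
  {v | (∃ i k, i ≤ P ∧ v = Q i k) ∨ (∃ i j, i ≤ P ∧ j ∈ cells P ∧ v = H i j) ∨
    ∃ i j l, i ≤ P ∧ j ∈ cells P ∧ v = S i j l}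

/-- The actions available in state `k` on symbol `l`, where a machine that has halted is regarded
as remaining in the same configuration. -/
def actions (k : M.State) (l : M.Sym) : Set (M.State × M.Sym × Move) :=
  {t | (M.Halting k ∧ t = (k, l, Move.stay)) ∨ (¬ M.Halting k ∧ t ∈ M.δ k l)}

/-- `G₁`: at each time the machine is in exactly one state. -/
def G₁ (P : ℕ) : Set (Set (Literal (TableauVar M))) :=
  {K | ∃ i ≤ P, K = {l | ∃ k, l = posLit (Q i k)}} ∪
  {K | ∃ i ≤ P, ∃ k k', k ≠ k' ∧ K = {negLit (Q i k), negLit (Q i k')}}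

/-- `G₂`: at each time the head scans exactly one cell. -/
def G₂ (P : ℕ) : Set (Set (Literal (TableauVar M))) :=
  {K | ∃ i ≤ P, K = {l | ∃ j ∈ cells P, l = posLit (H i j)}} ∪
  {K | ∃ i ≤ P, ∃ j ∈ cells P, ∃ j' ∈ cells P, j < j' ∧ K = {negLit (H i j), negLit (H i j')}}

/-- `G₃`: at each time each cell contains exactly one symbol. -/
def G₃ (P : ℕ) : Set (Set (Literal (TableauVar M))) :=
  {K | ∃ i ≤ P, ∃ j ∈ cells P, K = {l | ∃ s, l = posLit (S i j s)}} ∪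
  {K | ∃ i ≤ P, ∃ j ∈ cells P, ∃ s s', s ≠ s' ∧ K = {negLit (S i j s), negLit (S i j s')}}

/-- `G₄`: at time `0` the machine is in its initial configuration on input `x`. -/
def G₄ (P : ℕ) (x : List A) : Set (Set (Literal (TableauVar M))) :=
  {{posLit (Q 0 M.start)}, {posLit (H 0 1)}} ∪
  {K | ∃ j ∈ cells P, K = {posLit (S 0 j (M.initTape x j))}}

/-- `G₅`: at time `P` the machine is in the accepting state. -/
def G₅ (P : ℕ) : Set (Set (Literal (TableauVar M))) :=
  {{posLit (Q P M.accept)}}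

/-- The three kinds of information about the next configuration that an action determines. -/
inductive Aspect : Type
  | head
  | state
  | symbol

/-- The variable stating the given aspect of the outcome, at time `i + 1`, of performing the action
`t` at time `i` with the head on cell `j`. -/
def outcome (i : ℕ) (j : ℤ) (t : M.State × M.Sym × Move) : Aspect → TableauVar M
  | .head => H (i + 1) (j + t.2.2.shift)
  | .state => Q (i + 1) t.1
  | .symbol => S (i + 1) j t.2.1

/-- `G₆`: successive configurations follow the transition function. The first subgroup says that
cells not scanned keep their symbol. The second one says that, if at time `i` the head scans cell
`j`, the state is `k` and the symbol is `l`, then some action `t` available for `(k, l)` yields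
all of `H[i+1, j+Δ]`, `Q[i+1, k']`, `S[i+1, j, l']`; this disjunction of conjunctions is written as
clauses, one for each function `g` that selects an aspect of each action. If there is
just one action `(k', l', Δ)`, these are the three clauses with last literal `H[i+1, j+Δ]`,
`Q[i+1, k']`, and `S[i+1, j, l']`. A literal `H[i+1, j+Δ]` where `j+Δ` is not among the cells is
omitted. -/
def G₆ (P : ℕ) : Set (Set (Literal (TableauVar M))) :=
  {K | ∃ i < P, ∃ j ∈ cells P, ∃ l,
    K = {negLit (S i j l), posLit (H i j), posLit (S (i + 1) j l)}} ∪
  {K | ∃ i < P, ∃ j ∈ cells P, ∃ k l, ∃ g : M.State × M.Sym × Move → Aspect,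
    K = {negLit (H i j), negLit (Q i k), negLit (S i j l)} ∪
      {a | ∃ t ∈ M.actions k l, M.outcome i j t (g t) ∈ M.tableauVars P ∧
        a = posLit (M.outcome i j t (g t))}}

/-- The set of all clauses for input `x` and time bound `P`. -/
def tableauClauses (P : ℕ) (x : List A) : Set (Set (Literal (TableauVar M))) :=
  M.G₁ P ∪ M.G₂ P ∪ M.G₃ P ∪ M.G₄ P x ∪ M.G₅ P ∪ M.G₆ P

/-- `I` is, for a suitable numbering of the variables, the SAT instance consisting of the
variables `M.tableauVars P` and the clauses `M.tableauClauses P x`. -/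
def IsTableauInstance (P : ℕ) (x : List A) (I : SATInstance) : Prop :=
  ∃ g : Fin I.numVars → TableauVar M, Function.Injective g ∧ Set.range g = M.tableauVars P ∧
    (fun K => Literal.rename g '' K) '' I.clauseSet = M.tableauClauses P x

end NDTM

/-! Hardness is the tableau argument. A computation of at most `P` steps that starts on cell 1 stays
within distance `P` of that cell; padded with repetitions of its halting configuration, it fills a
table of `P + 1` rows that satisfies all clauses (`exists_path`, `head_bounds`,
`setSatisfiable_of_path`). Conversely, a satisfying assignment is read row by row as a genuine
computation (`accepts_of_setSatisfiable`). The delicate point is that "some available action has all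
three outcomes" is a disjunction of conjunctions, which `G₆` expands into one clause per choice
function: if every action failed in some aspect, choosing a failing aspect for each action would
single out a violated clause.

That the tableau can be written in polynomial time is shown with a small loop language compiled to
stack machines. `Runs` is a timed Hoare triple that holds wherever the code is placed, so programs
compose. Unary counters hold the length of the input, the value of the polynomial (by Horner's rule)
and a few derived numbers; nested loops over them emit the output. A clause group is given by a
template with two readings, as a list of clauses and as a program that writes them; `Tmpl.den_gen`
says that the readings agree, and `toSets_tmpl₁` to `toSets_tmpl₆` identify the templates with the
groups. Variables are numbered in mixed radix, so the unary code of a number is again the output of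
loops.

For membership in NP, a machine eliminates the variables one at a time: it deletes a tick of the
variable list, guesses the value of variable 0, and sweeps over the clauses, lowering the number of
every literal by one and replacing the literals of variable 0 by a mark for true or a deleted cell.
When no variable is left, every clause must contain a mark. The predicate `Good` translates
"satisfiable" to intermediate configurations. It holds exactly for accepting configurations and
those with a `Good` successor (`good_iff`), while `rank` drops at every step (`rank_succ`); together
these give correctness and the quadratic time bound. `Good` also forces the word to be a code
(`exists_of_goodU`, `exists_of_chk`), so malformed inputs are rejected. -/

/-! ### Structured programs for machines with stacks -/

namespace StackProg

open Turing

/-- Structured programs over a family of stacks with alphabets `Γ k`. `loop k body` pops symbols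
from stack `k` until it is empty and runs `body a` for each symbol `a`; `read k body` pops one
symbol, if there is any. -/
inductive Prog {K : Type} (Γ : K → Type) : Type
  | skip : Prog Γ
  | push (k : K) (a : Γ k) : Prog Γ
  | seq (p q : Prog Γ) : Prog Γ
  | loop (k : K) (body : Γ k → Prog Γ) : Prog Γ
  | read (k : K) (body : Option (Γ k) → Prog Γ) : Prog Γ

namespace Prog

variable {K : Type} {Γ : K → Type}

/-- The labels of the machine code of a program. -/
def Lab : Prog Γ → Type
  | skip => Unit
  | push _ _ => Unit
  | seq p q => p.Lab ⊕ q.Lab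
  | loop _ body => Option (Σ a, (body a).Lab)
  | read _ body => Option (Σ o, (body o).Lab)

theorem finite_lab [∀ k, Finite (Γ k)] : ∀ p : Prog Γ, Finite p.Lab
  | skip => inferInstanceAs (Finite Unit)
  | push _ _ => inferInstanceAs (Finite Unit)
  | seq p q => by
      have := finite_lab p
      have := finite_lab q
      exact inferInstanceAs (Finite (p.Lab ⊕ q.Lab))
  | loop k body => by
      have := fun a => finite_lab (body a)
      exact inferInstanceAs (Finite (Option (Σ a, (body a).Lab)))
  | read k body => by
      have := fun a => finite_lab (body a)
      exact inferInstanceAs (Finite (Option (Σ o, (body o).Lab)))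

/-- The label at which the code of a program starts. -/
def entry : (p : Prog Γ) → p.Lab
  | skip => ()
  | push _ _ => ()
  | seq p _ => Sum.inl p.entry
  | loop _ _ => (none : Option _)
  | read _ _ => (none : Option _)

variable [DecidableEq K]

/-- Machine code: the labels of `p` are embedded into `Λ` by `emb`, and the code jumps to `exit`
at the end. The internal state stores the last symbol popped from each stack. -/
def code {Λ : Type} : (p : Prog Γ) → (p.Lab → Λ) → Λ → p.Lab →
    TM2.Stmt Γ Λ (∀ k, Option (Γ k))
  | skip, _, exit, _ => .goto fun _ => exit
  | push k a, _, exit, _ => .push k (fun _ => a) (.goto fun _ => exit)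
  | seq p q, emb, exit, l => match l with
    | Sum.inl l => p.code (fun l => emb (Sum.inl l)) (emb (Sum.inr q.entry)) l
    | Sum.inr l => q.code (fun l => emb (Sum.inr l)) exit l
  | loop k body, emb, exit, l => match l with
    | none => .pop k (fun v o => Function.update v k o) (.goto fun v => match v k with
      | none => exit
      | some a => emb (some ⟨a, (body a).entry⟩))
    | some ⟨a, l⟩ => (body a).code (fun l => emb (some ⟨a, l⟩)) (emb none) l
  | read k body, emb, exit, l => match l with
    | none => .pop k (fun v o => Function.update v k o)
        (.goto fun v => emb (some ⟨v k, (body (v k)).entry⟩))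
    | some ⟨o, l⟩ => (body o).code (fun l => emb (some ⟨o, l⟩)) exit l

end Prog

/-- The machine passes from `c` to `c'` in at most `t` steps. -/
def StepsTo {σ : Type} (f : σ → Option σ) (c c' : σ) (t : ℕ) : Prop :=
  ∃ k ≤ t, (flip bind f)^[k] (some c) = some c'

theorem StepsTo.trans {σ : Type} {f : σ → Option σ} {c c' c'' : σ} {t t' : ℕ}
    (h : StepsTo f c c' t) (h' : StepsTo f c' c'' t') : StepsTo f c c'' (t + t') := by
  obtain ⟨k, hk, e⟩ := h
  obtain ⟨k', hk', e'⟩ := h'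
  exact ⟨k' + k, by omega, by rw [Function.iterate_add_apply, e, e']⟩

theorem StepsTo.single {σ : Type} {f : σ → Option σ} {c c' : σ} (h : f c = some c') :
    StepsTo f c c' 1 := ⟨1, le_rfl, h⟩

theorem StepsTo.mono {σ : Type} {f : σ → Option σ} {c c' : σ} {t t' : ℕ}
    (h : StepsTo f c c' t) (ht : t ≤ t') : StepsTo f c c' t' := by
  obtain ⟨k, hk, e⟩ := h
  exact ⟨k, hk.trans ht, e⟩

variable {K : Type} {Γ : K → Type} [DecidableEq K]

/-- The code of `p`, wherever it is placed, transforms the stacks `S` into `S'` in at most `t`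
steps. -/
def Runs (p : Prog Γ) (S S' : ∀ k, List (Γ k)) (t : ℕ) : Prop :=
  ∀ (Λ : Type) (m : Λ → TM2.Stmt Γ Λ (∀ k, Option (Γ k))) (emb : p.Lab → Λ) (exit : Λ),
    (∀ l, m (emb l) = p.code emb exit l) → ∀ v, ∃ v',
      StepsTo (TM2.step m) ⟨some (emb p.entry), v, S⟩ ⟨some exit, v', S'⟩ t

namespace Runs

theorem mono {p : Prog Γ} {S S' : ∀ k, List (Γ k)} {t t' : ℕ} (h : Runs p S S' t) (ht : t ≤ t') :
    Runs p S S' t' := by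
  intro Λ m emb exit hm v
  obtain ⟨v', h'⟩ := h Λ m emb exit hm v
  exact ⟨v', h'.mono ht⟩

theorem skip (S : ∀ k, List (Γ k)) : Runs .skip S S 1 := by
  intro Λ m emb exit hm v
  refine ⟨v, StepsTo.single ?_⟩
  rw [TM2.step, hm]
  rfl

theorem push (k : K) (a : Γ k) (S : ∀ k, List (Γ k)) :
    Runs (.push k a) S (Function.update S k (a :: S k)) 1 := by
  intro Λ m emb exit hm v
  refine ⟨v, StepsTo.single ?_⟩
  rw [TM2.step, hm]
  rfl

/-- Since `Runs` quantifies over the embedding and the exit label, the first program may be run with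
the entry of the second as its exit. -/
theorem seq {p q : Prog Γ} {S S' S'' : ∀ k, List (Γ k)} {t t' : ℕ}
    (h : Runs p S S' t) (h' : Runs q S' S'' t') : Runs (.seq p q) S S'' (t + t') := by
  intro Λ m emb exit hm v
  obtain ⟨v', h1⟩ := h Λ m (fun l => emb (Sum.inl l)) (emb (Sum.inr q.entry))
    (fun l => hm (Sum.inl l)) v
  obtain ⟨v'', h2⟩ := h' Λ m (fun l => emb (Sum.inr l)) exit (fun l => hm (Sum.inr l)) v'
  exact ⟨v'', h1.trans h2⟩

theorem loop_nil {k : K} {body : Γ k → Prog Γ} {S : ∀ k, List (Γ k)} (h : S k = []) :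
    Runs (.loop k body) S S 1 := by
  intro Λ m emb exit hm v
  refine ⟨Function.update v k none, StepsTo.single ?_⟩
  have : m (emb (Prog.loop k body).entry) = _ := hm _
  rw [TM2.step, this]
  simp only [Prog.entry, Prog.code, TM2.stepAux, h, List.head?_nil, Function.update_self,
    List.tail_nil]
  rw [← h, Function.update_eq_self]

theorem loop_cons {k : K} {body : Γ k → Prog Γ} {S S' S'' : ∀ k, List (Γ k)} {a : Γ k}
    {r : List (Γ k)} {t t' : ℕ} (h : S k = a :: r)
    (hb : Runs (body a) (Function.update S k r) S' t) (hl : Runs (.loop k body) S' S'' t') :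
    Runs (.loop k body) S S'' (1 + t + t') := by
  intro Λ m emb exit hm v
  obtain ⟨v', h1⟩ := hb Λ m (fun l => emb (some ⟨a, l⟩)) (emb none) (fun l => hm (some ⟨a, l⟩))
    (Function.update v k (some a))
  obtain ⟨v'', h2⟩ := hl Λ m emb exit hm v'
  refine ⟨v'', (StepsTo.trans (StepsTo.single ?_) h1).trans h2⟩
  have : m (emb (Prog.loop k body).entry) = _ := hm _
  rw [TM2.step, this]
  simp only [Prog.entry, Prog.code, TM2.stepAux, h, List.head?_cons, Function.update_self,
    List.tail_cons]

theorem read {k : K} {body : Option (Γ k) → Prog Γ} {S S' : ∀ k, List (Γ k)} {t : ℕ}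
    (h : Runs (body (S k).head?) (Function.update S k (S k).tail) S' t) :
    Runs (.read k body) S S' (1 + t) := by
  intro Λ m emb exit hm v
  obtain ⟨v', h1⟩ := h Λ m (fun l => emb (some ⟨_, l⟩)) exit (fun l => hm (some ⟨_, l⟩))
    (Function.update v k (S k).head?)
  refine ⟨v', StepsTo.trans (StepsTo.single ?_) h1⟩
  have : m (emb (Prog.read k body).entry) = _ := hm _
  rw [TM2.step, this]
  simp only [Prog.entry, Prog.code, TM2.stepAux]
  rw [Function.update_self]

end Runs

/-- The machine that executes a program. -/
noncomputable def machine [Fintype K] [∀ k, Fintype (Γ k)] (p : Prog Γ) (k₀ k₁ : K) : FinTM2 :=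
  letI := p.finite_lab
  letI := Fintype.ofFinite p.Lab
  { K := K
    k₀ := k₀
    k₁ := k₁
    Γ := Γ
    Λ := Option p.Lab
    main := some p.entry
    σ := ∀ k, Option (Γ k)
    initialState := fun _ => none
    m := fun l => match l with
      -- `haltList` demands the initial internal state, so the record of popped symbols is erased
      -- before halting. This one extra step is the `+ 1` in the running time `T + 1`.
      | none => .load (fun _ _ => none) .halt
      | some l => p.code some none l }

/-- A program all of whose runs take polynomial time yields a function computable in polynomial
time. -/
theorem polyTimeComputable_of_runs [Fintype K] [∀ k, Fintype (Γ k)] {α β A B : Type}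
    {ea : α → List A} {eb : β → List B} {f : α → β} (p : Prog Γ) (k₀ k₁ : K) (e₀ : Γ k₀ ≃ A)
    (e₁ : Γ k₁ ≃ B) (T : Polynomial ℕ) (S S' : α → ∀ k, List (Γ k))
    (hS₀ : ∀ a, S a k₀ = (ea a).map e₀.symm) (hS : ∀ a k, k ≠ k₀ → S a k = [])
    (hS₁ : ∀ a, S' a k₁ = (eb (f a)).map e₁.symm) (hS' : ∀ a k, k ≠ k₁ → S' a k = [])
    (h : ∀ a, Runs p (S a) (S' a) (T.eval (ea a).length)) : PolyTimeComputable ea eb f := by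
  refine ⟨{ tm := machine p k₀ k₁, inputAlphabet := e₀, outputAlphabet := e₁, time := T + 1,
            outputsFun := fun a => ?_ }⟩
  have hi : initList (machine p k₀ k₁) ((ea a).map e₀.symm) =
      (⟨some (some p.entry), fun _ => none, S a⟩ : (machine p k₀ k₁).Cfg) := by
    refine congrArg (TM2.Cfg.mk _ _) (funext fun k => ?_)
    by_cases hk : k = k₀
    · subst k
      exact (dif_pos rfl).trans (hS₀ a).symm
    · exact (dif_neg hk).trans (hS a k hk).symm
  have hh : haltList (machine p k₀ k₁) ((eb (f a)).map e₁.symm) =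
      (⟨none, fun _ => none, S' a⟩ : (machine p k₀ k₁).Cfg) := by
    refine congrArg (TM2.Cfg.mk _ _) (funext fun k => ?_)
    by_cases hk : k = k₁
    · subst k
      exact (dif_pos rfl).trans (hS₁ a).symm
    · exact (dif_neg hk).trans (hS' a k hk).symm
  have key : StepsTo (machine p k₀ k₁).step
      (initList (machine p k₀ k₁) ((ea a).map e₀.symm))
      (haltList (machine p k₀ k₁) ((eb (f a)).map e₁.symm)) ((T + 1).eval (ea a).length) := by
    obtain ⟨v', h1⟩ := h a (Option p.Lab) (machine p k₀ k₁).m some none (fun l => rfl)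
      (fun _ => none)
    rw [Polynomial.eval_add, Polynomial.eval_one, hi, hh]
    exact h1.trans (StepsTo.single rfl)
  have : Nonempty (TM2OutputsInTime (machine p k₀ k₁) ((ea a).map e₀.symm)
      (some ((eb (f a)).map e₁.symm)) ((T + 1).eval (ea a).length)) := by
    obtain ⟨k, hk, e⟩ := key
    exact ⟨⟨⟨k, e⟩, hk⟩⟩
  exact this.some

end StackProg

/-! ### Programs with counters, an input and an output -/

namespace StackProg

/-- Two stacks for the input, one for the output, and stacks that serve as counters. -/
inductive Stk (V : Type) : Type
  | inp
  | aux
  | out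
  | cnt (v : V)
  deriving DecidableEq

/-- The alphabets of the stacks. -/
def Stk.Sym {V : Type} (A B : Type) : Stk V → Type
  | inp => A
  | aux => A
  | out => B
  | cnt _ => Unit

theorem Stk.finite {V : Type} [Finite V] : Finite (Stk V) := by
  refine Finite.of_surjective (fun o : Fin 3 ⊕ V => match o with
    | .inl 0 => Stk.inp
    | .inl 1 => Stk.aux
    | .inl 2 => Stk.out
    | .inr v => Stk.cnt v) ?_
  rintro (_ | _ | _ | v)
  exacts [⟨.inl 0, rfl⟩, ⟨.inl 1, rfl⟩, ⟨.inl 2, rfl⟩, ⟨.inr v, rfl⟩]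

theorem Stk.finite_sym {V A B : Type} [Finite A] [Finite B] : ∀ k : Stk V, Finite (k.Sym A B)
  | inp => inferInstanceAs (Finite A)
  | aux => inferInstanceAs (Finite A)
  | out => inferInstanceAs (Finite B)
  | cnt _ => inferInstanceAs (Finite Unit)

/-- The contents of the stacks; a counter is given by its value. The counter `none` is reserved
for copying. -/
@[ext]
structure Store (W A B : Type) where
  inp : List A
  aux : List A
  out : List B
  cnt : Option W → ℕ

variable {W A B : Type} [DecidableEq W]

namespace Store

/-- The stacks described by a store. -/
def toStk (s : Store W A B) : ∀ k : Stk (Option W), List (k.Sym A B)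
  | .inp => s.inp
  | .aux => s.aux
  | .out => s.out
  | .cnt v => List.replicate (s.cnt v) ()

/-- Changing the value of a counter. -/
def set (s : Store W A B) (v : Option W) (n : ℕ) : Store W A B :=
  { s with cnt := Function.update s.cnt v n }

theorem update_cnt (s : Store W A B) (v : Option W) (n : ℕ) :
    Function.update s.toStk (.cnt v) (List.replicate n ()) = (s.set v n).toStk := by
  funext k
  rcases k with _ | _ | _ | w
  · rfl
  · rfl
  · rfl
  · by_cases h : w = v
    · subst h
      rw [Function.update_self]
      simp [toStk, set]
    · rw [Function.update_of_ne (by simpa using h)]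
      simp [toStk, set, Function.update_of_ne h]

theorem update_inp (s : Store W A B) (l : List A) :
    Function.update s.toStk .inp l = ({ s with inp := l } : Store W A B).toStk := by
  funext k
  rcases k with _ | _ | _ | w <;> rfl

theorem update_aux (s : Store W A B) (l : List A) :
    Function.update s.toStk .aux l = ({ s with aux := l } : Store W A B).toStk := by
  funext k
  rcases k with _ | _ | _ | w <;> rfl

theorem update_out (s : Store W A B) (l : List B) :
    Function.update s.toStk .out l = ({ s with out := l } : Store W A B).toStk := by
  funext k
  rcases k with _ | _ | _ | w <;> rfl

end Store

/-- Programs over a store. -/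
abbrev SProg (W A B : Type) := Prog (fun k : Stk (Option W) => k.Sym A B)

/-- The program `p` transforms the store `s` into `s'` in at most `t` steps. -/
def Exec (p : SProg W A B) (s s' : Store W A B) (t : ℕ) : Prop := Runs p s.toStk s'.toStk t

/-- Incrementing a counter. -/
def inc (v : Option W) : SProg W A B := .push (.cnt v) ()

/-- Repeating a program while a counter can be decreased. -/
def whilePos (v : Option W) (body : SProg W A B) : SProg W A B := .loop (.cnt v) fun _ => body

/-- Adding a constant to a counter. -/
def addConst (v : Option W) : ℕ → SProg W A B
  | 0 => .skip
  | k + 1 => .seq (addConst v k) (inc v)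

/-- Adding `k` times the counter `c` to the counter `v`. -/
def addMul (v : Option W) (k : ℕ) (c : Option W) : SProg W A B :=
  .seq (whilePos c (.seq (addConst v k) (inc none))) (whilePos none (inc c))

namespace Exec

theorem conseq {p : SProg W A B} {s s' s'' : Store W A B} {t t' : ℕ} (h : Exec p s s' t)
    (hs : s' = s'') (ht : t ≤ t') : Exec p s s'' t' := hs ▸ Runs.mono h ht

theorem skip (s : Store W A B) : Exec .skip s s 1 := Runs.skip _

theorem seq {p q : SProg W A B} {s s' s'' : Store W A B} {t t' : ℕ}
    (h : Exec p s s' t) (h' : Exec q s' s'' t') : Exec (.seq p q) s s'' (t + t') := Runs.seq h h'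

theorem inc (s : Store W A B) (v : Option W) : Exec (inc v) s (s.set v (s.cnt v + 1)) 1 := by
  unfold Exec
  rw [← s.update_cnt]
  exact Runs.push (Γ := fun k : Stk (Option W) => k.Sym A B) (.cnt v) () s.toStk

theorem emit (s : Store W A B) (b : B) :
    Exec (.push .out b) s { s with out := b :: s.out } 1 := by
  unfold Exec
  rw [← s.update_out (b :: s.out)]
  exact Runs.push (Γ := fun k : Stk (Option W) => k.Sym A B) .out b s.toStk

/-- Loop rule with invariant `c`: `c i` is the store at the test when the counter is `i`. The test
itself decrements, so the body starts from `(c (i + 1)).set v i`. Each round costs one test besides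
the body, and the failing test adds one more. -/
theorem whilePos {v : Option W} {body : SProg W A B} {T : ℕ} (c : ℕ → Store W A B)
    (hc : ∀ i, (c i).cnt v = i) (n : ℕ) (h : ∀ i < n, Exec body ((c (i + 1)).set v i) (c i) T) :
    Exec (whilePos v body) (c n) (c 0) (n * (T + 1) + 1) := by
  induction n with
  | zero =>
    refine conseq (Runs.loop_nil ?_) rfl (by omega)
    simp only [Store.toStk, hc]
    rfl
  | succ n ih =>
    have h1 := h n (by omega)
    unfold Exec at h1
    rw [← Store.update_cnt] at h1
    refine conseq (Runs.loop_cons (a := ()) (r := List.replicate n ()) ?_ h1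
      (ih fun i hi => h i (by omega))) rfl (by rw [Nat.succ_mul]; omega)
    simp only [Store.toStk, hc]
    rfl

theorem addConst (s : Store W A B) (v : Option W) (k : ℕ) :
    Exec (addConst v k) s (s.set v (s.cnt v + k)) (k + 1) := by
  induction k with
  | zero => exact (skip s).conseq (by simp [Store.set]) (by omega)
  | succ k ih =>
    refine (ih.seq (Exec.inc _ v)).conseq ?_ (by omega)
    simp [Store.set, add_assoc]

/-- A unary counter can only be read by emptying it. The first loop drains `c` into `v` (with factor
`k`) and into the scratch counter `none`; the second restores `c` from the scratch counter. The
costs are `n * (k + 3) + 1` and `n * 2 + 1`. -/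
theorem addMul (s : Store W A B) {v c : Option W} (k : ℕ) (hvc : v ≠ c) (hv : v ≠ none)
    (hc : c ≠ none) (h0 : s.cnt none = 0) :
    Exec (addMul v k c) s (s.set v (s.cnt v + k * s.cnt c)) (s.cnt c * (k + 5) + 2) := by
  obtain ⟨n, hn⟩ : ∃ n, n = s.cnt c := ⟨_, rfl⟩
  have h1 := whilePos (v := c) (body := .seq (StackProg.addConst v k) (StackProg.inc none))
    (T := k + 2) (fun i => ((s.set v (s.cnt v + k * (n - i))).set none (n - i)).set c i)
    (fun i => by simp [Store.set]) n ?_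
  · have h2 := whilePos (v := none) (body := (StackProg.inc c : SProg W A B))
      (T := 1) (fun i => ((s.set v (s.cnt v + k * n)).set c (n - i)).set none i)
      (fun i => by simp [Store.set]) n ?_
    · have e1 : ((s.set v (s.cnt v + k * (n - n))).set none (n - n)).set c n = s := by
        ext : 1 <;> try rfl
        funext w
        simp only [Store.set, Function.update_apply]
        split_ifs <;> simp_all
      have e2 : ((s.set v (s.cnt v + k * (n - 0))).set none (n - 0)).set c 0 =
          ((s.set v (s.cnt v + k * n)).set c (n - n)).set none n := by
        ext : 1 <;> try rfl
        funext w
        simp only [Store.set, Function.update_apply]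
        split_ifs <;> simp_all
      beta_reduce at h1 h2
      rw [e1, e2] at h1
      refine (h1.seq h2).conseq ?_ ?_
      · rw [← hn]
        ext : 1 <;> try rfl
        funext w
        simp only [Store.set, Function.update_apply]
        split_ifs <;> simp_all
      · rw [← hn]
        linarith [Nat.zero_le n]
    · intro i hi
      refine (Exec.inc _ c).conseq ?_ le_rfl
      ext : 1 <;> try rfl
      funext w
      simp only [Store.set, Function.update_apply]
      split_ifs <;> simp_all <;> omega
  · intro i hi
    -- Naming the number `d` of completed rounds removes the truncated subtractions.
    obtain ⟨d, rfl⟩ : ∃ d, n = i + 1 + d := ⟨n - (i + 1), by omega⟩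
    refine ((Exec.addConst _ v k).seq (Exec.inc _ none)).conseq ?_ (by omega)
    have e1 : i + 1 + d - i = d + 1 := by omega
    have e2 : i + 1 + d - (i + 1) = d := by omega
    ext : 1 <;> try rfl
    funext w
    simp only [Store.set, Function.update_apply, e1, e2]
    split_ifs <;> simp_all <;> ring

theorem clear (s : Store W A B) (v : Option W) :
    Exec (StackProg.whilePos v .skip) s (s.set v 0) (s.cnt v * 2 + 1) := by
  have := whilePos (v := v) (body := (Prog.skip : SProg W A B)) (T := 1) (fun i => s.set v i)
    (fun i => by simp [Store.set]) (s.cnt v) (fun i _ => by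
      refine (Exec.skip _).conseq ?_ le_rfl
      simp [Store.set])
  simpa [Store.set] using this

end Exec

/-! ### Generating output by nested loops -/

/-- Programs that produce output by loops over counters; `forBelow i c g` runs `g` for all values
of the counter `i` that are smaller than the value of `c`. -/
inductive Gen (W B : Type) : Type
  | nil : Gen W B
  | emit (b : B) : Gen W B
  | append (g h : Gen W B) : Gen W B
  | forBelow (i c : W) (g : Gen W B) : Gen W B

namespace Gen

/-- The output, given the values of the counters. -/
def den : Gen W B → (W → ℕ) → List B
  | nil, _ => []
  | emit b, _ => [b]
  | append g h, env => g.den env ++ h.den env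
  | forBelow i c g, env => (List.range (env c)).flatMap fun j => g.den (Function.update env i j)

/-- `i` is the counter of some loop. -/
def Binds (i : W) : Gen W B → Prop
  | nil => False
  | emit _ => False
  | append g h => g.Binds i ∨ h.Binds i
  | forBelow i' _ g => i = i' ∨ g.Binds i

/-- The counter of a loop is not used by another loop inside. -/
def WF : Gen W B → Prop
  | nil => True
  | emit _ => True
  | append g h => g.WF ∧ h.WF
  | forBelow i c g => i ≠ c ∧ ¬ g.Binds i ∧ g.WF

/-- The program that puts the output in front of what has been written before. -/
def prog : Gen W B → SProg W A B
  | nil => .skip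
  | emit b => .push .out b
  | append g h => .seq h.prog g.prog
  | forBelow i c g => .seq (addMul (some i) 1 (some c)) (whilePos (some i) g.prog)

/-- A bound for the running time in terms of a bound for the counters. -/
noncomputable def bound : Gen W B → Polynomial ℕ
  | nil => 1
  | emit _ => 1
  | append g h => g.bound + h.bound
  | forBelow _ _ g => Polynomial.X * (g.bound + 7) + 3

/-- The store with given inputs, output and counters. -/
def store (inp aux : List A) (out : List B) (env : W → ℕ) : Store W A B :=
  ⟨inp, aux, out, fun o => o.elim 0 env⟩

theorem store_set (inp aux : List A) (out : List B) (env : W → ℕ) (i : W) (n : ℕ) :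
    (store inp aux out env).set (some i) n = store inp aux out (Function.update env i n) := by
  ext : 1 <;> try rfl
  funext o
  cases o with
  | none => simp [store, Store.set]
  | some o =>
    by_cases h : o = i
    · subst h; simp [store, Store.set]
    · simp [store, Store.set, h]

/-- The output is a stack, so it is produced from back to front: the second half of `append` runs
first, and a loop counts down from `env c - 1` to `0`. A loop counter starts at 0, receives a copy
of its bound, and is 0 again at the end, which is why the environment is unchanged. -/
theorem exec (g : Gen W B) (hg : g.WF) (N : ℕ) (inp aux : List A) (out : List B) (env : W → ℕ)
    (h0 : ∀ i, g.Binds i → env i = 0) (hN : ∀ w, env w ≤ N) :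
    Exec g.prog (store inp aux out env) (store inp aux (g.den env ++ out) env)
      (g.bound.eval N) := by
  induction g generalizing out env with
  | nil => exact (Exec.skip _).conseq rfl (by simp [bound])
  | emit b => exact (Exec.emit _ b).conseq rfl (by simp [bound])
  | append g h ihg ihh =>
    refine ((ihh hg.2 out env (fun i hi => h0 i (Or.inr hi)) hN).seq
      (ihg hg.1 _ env (fun i hi => h0 i (Or.inl hi)) hN)).conseq ?_ ?_
    · simp [den]
    · simp [bound, add_comm]
  | forBelow i c g ih =>
    obtain ⟨hic, hb, hg⟩ := hg
    have hi0 : env i = 0 := h0 i (Or.inl rfl)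
    have h1 := Exec.addMul (store (A := A) inp aux out env) (v := some i) (c := some c) 1
      (by simpa using hic) (by simp) (by simp) rfl
    -- Invariant: with `r` rounds left, the outputs for the indices `r, …, env c - 1` have been
    -- written.
    have h2 := Exec.whilePos (v := some i) (body := (g.prog : SProg W A B)) (T := g.bound.eval N)
      (fun r => store inp aux (((List.range' r (env c - r)).flatMap
        fun j => g.den (Function.update env i j)) ++ out) (Function.update env i r))
      (fun r => by simp [store]) (env c) (fun r hr => by
        have e : env c - r = (env c - (r + 1)) + 1 := by omega
        have := ih hg (((List.range' (r + 1) (env c - (r + 1))).flatMap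
          fun j => g.den (Function.update env i j)) ++ out) (Function.update env i r)
          (fun j hj => by
            have hji : j ≠ i := fun h => hb (h ▸ hj)
            rw [Function.update_of_ne hji]
            exact h0 j (Or.inr hj))
          (fun w => by
            rw [Function.update_apply]
            split_ifs
            · exact hr.le.trans (hN c)
            · exact hN w)
        rw [store_set, Function.update_idem, e, List.range'_succ]
        simpa using this)
    refine (h1.seq (s'' := store inp aux ((forBelow i c g).den env ++ out) env)
      (t' := env c * (g.bound.eval N + 1) + 1) ?_).conseq rfl ?_
    · have e1 : (store (A := A) inp aux out env).set (some i)
          ((store (A := A) inp aux out env).cnt (some i) +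
            1 * (store (A := A) inp aux out env).cnt (some c)) =
          store inp aux out (Function.update env i (env c)) := by
        rw [store_set]
        simp [store, hi0]
      have e2 : Function.update env i 0 = env := by rw [← hi0, Function.update_eq_self]
      rw [e1]
      simpa [den, e2, List.range_eq_range'] using h2
    · have h3 : env c ≤ N := hN c
      have h4 : env c * (g.bound.eval N + 7) ≤ N * (g.bound.eval N + 7) :=
        Nat.mul_le_mul_right _ h3
      simp only [store, Option.elim, bound, Polynomial.eval_add, Polynomial.eval_mul,
        Polynomial.eval_X, Polynomial.eval_ofNat]
      linarith

end Gen

end StackProg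

/-! ### Polynomial running times -/

namespace StackProg

/-- A function of words that is bounded by a polynomial in the length. -/
def PolyBdd {A : Type} (f : List A → ℕ) : Prop := ∃ T : Polynomial ℕ, ∀ x, f x ≤ T.eval x.length

namespace PolyBdd

variable {A : Type} {f g : List A → ℕ}

theorem const (c : ℕ) : PolyBdd (fun _ : List A => c) := ⟨Polynomial.C c, by simp⟩

theorem length : PolyBdd (fun x : List A => x.length) := ⟨Polynomial.X, by simp⟩

theorem add (hf : PolyBdd f) (hg : PolyBdd g) : PolyBdd fun x => f x + g x := by
  obtain ⟨S, hS⟩ := hf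
  obtain ⟨T, hT⟩ := hg
  exact ⟨S + T, fun x => by rw [Polynomial.eval_add]; exact Nat.add_le_add (hS x) (hT x)⟩

theorem mul (hf : PolyBdd f) (hg : PolyBdd g) : PolyBdd fun x => f x * g x := by
  obtain ⟨S, hS⟩ := hf
  obtain ⟨T, hT⟩ := hg
  exact ⟨S * T, fun x => by rw [Polynomial.eval_mul]; exact Nat.mul_le_mul (hS x) (hT x)⟩

/-- The coefficients are natural numbers, so every monomial is monotone. Hence polynomial bounds may
be substituted into one another. -/
theorem eval_mono (T : Polynomial ℕ) {m n : ℕ} (h : m ≤ n) : T.eval m ≤ T.eval n := by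
  induction T using Polynomial.induction_on' with
  | add p q hp hq => simpa using Nat.add_le_add hp hq
  | monomial k a => simpa using Nat.mul_le_mul_left a (Nat.pow_le_pow_left h k)

theorem eval (T : Polynomial ℕ) (hf : PolyBdd f) : PolyBdd fun x => T.eval (f x) := by
  obtain ⟨S, hS⟩ := hf
  exact ⟨T.comp S, fun x => by rw [Polynomial.eval_comp]; exact eval_mono T (hS x)⟩

end PolyBdd

/-- The program `p` transforms `S x` into `S' x` in time polynomial in the length of `x`. -/
def PolyExec {W A B : Type} [DecidableEq W] (p : SProg W A B) (S S' : List A → Store W A B) :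
    Prop :=
  ∃ t, PolyBdd t ∧ ∀ x, Exec p (S x) (S' x) (t x)

theorem PolyExec.seq {W A B : Type} [DecidableEq W] {p q : SProg W A B}
    {S S' S'' : List A → Store W A B} (hp : PolyExec p S S') (hq : PolyExec q S' S'') :
    PolyExec (.seq p q) S S'' := by
  obtain ⟨t, ht, h⟩ := hp
  obtain ⟨t', ht', h'⟩ := hq
  exact ⟨_, ht.add ht', fun x => (h x).seq (h' x)⟩

/-! ### Input -/

namespace Exec

variable {W A B : Type} [DecidableEq W]

theorem loopInp_nil {body : A → SProg W A B} {s : Store W A B} (h : s.inp = []) :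
    Exec (.loop .inp body) s s 1 := Runs.loop_nil h

theorem loopInp_cons {body : A → SProg W A B} {s s' s'' : Store W A B} {a : A} {r : List A}
    {t t' : ℕ} (h : s.inp = a :: r) (hb : Exec (body a) { s with inp := r } s' t)
    (hl : Exec (.loop .inp body) s' s'' t') : Exec (.loop .inp body) s s'' (1 + t + t') := by
  unfold Exec at hb
  rw [← Store.update_inp] at hb
  exact Runs.loop_cons h hb hl

theorem loopAux_nil {body : A → SProg W A B} {s : Store W A B} (h : s.aux = []) :
    Exec (.loop .aux body) s s 1 := Runs.loop_nil h

theorem loopAux_cons {body : A → SProg W A B} {s s' s'' : Store W A B} {a : A} {r : List A}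
    {t t' : ℕ} (h : s.aux = a :: r) (hb : Exec (body a) { s with aux := r } s' t)
    (hl : Exec (.loop .aux body) s' s'' t') : Exec (.loop .aux body) s s'' (1 + t + t') := by
  unfold Exec at hb
  rw [← Store.update_aux] at hb
  exact Runs.loop_cons h hb hl

theorem readInp {body : Option A → SProg W A B} {s s' : Store W A B} {t : ℕ}
    (h : Exec (body s.inp.head?) { s with inp := s.inp.tail } s' t) :
    Exec (.read .inp body) s s' (1 + t) := by
  unfold Exec at h
  rw [← Store.update_inp] at h
  exact Runs.read h

theorem pushInp (s : Store W A B) (a : A) :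
    Exec (.push .inp a) s { s with inp := a :: s.inp } 1 := by
  unfold Exec
  rw [← s.update_inp (a :: s.inp)]
  exact Runs.push (Γ := fun k : Stk (Option W) => k.Sym A B) .inp a s.toStk

theorem pushAux (s : Store W A B) (a : A) :
    Exec (.push .aux a) s { s with aux := a :: s.aux } 1 := by
  unfold Exec
  rw [← s.update_aux (a :: s.aux)]
  exact Runs.push (Γ := fun k : Stk (Option W) => k.Sym A B) .aux a s.toStk

open Gen

theorem inc_store (inp aux : List A) (out : List B) (env : W → ℕ) (v : W) :
    Exec (StackProg.inc (some v)) (store inp aux out env)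
      (store inp aux out (Function.update env v (env v + 1))) 1 :=
  (Exec.inc _ _).conseq (store_set ..) le_rfl

theorem addConst_store (inp aux : List A) (out : List B) (env : W → ℕ) (v : W) (k : ℕ) :
    Exec (StackProg.addConst (some v) k) (store inp aux out env)
      (store inp aux out (Function.update env v (env v + k))) (k + 1) :=
  (Exec.addConst _ _ _).conseq (store_set ..) le_rfl

theorem addMul_store (inp aux : List A) (out : List B) (env : W → ℕ) {v c : W} (k : ℕ)
    (h : v ≠ c) : Exec (StackProg.addMul (some v) k (some c)) (store inp aux out env)
      (store inp aux out (Function.update env v (env v + k * env c))) (env c * (k + 5) + 2) :=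
  (Exec.addMul _ k (by simpa using h) (by simp) (by simp) rfl).conseq (store_set ..) le_rfl

theorem clear_store (inp aux : List A) (out : List B) (env : W → ℕ) (v : W) :
    Exec (StackProg.whilePos (some v) .skip) (store inp aux out env)
      (store inp aux out (Function.update env v 0)) (env v * 2 + 1) :=
  (Exec.clear _ _).conseq (store_set ..) le_rfl

theorem clearInp (x aux : List A) (out : List B) (env : W → ℕ) :
    Exec (.loop .inp fun _ => .skip) (store x aux out env) (store [] aux out env)
      (2 * x.length + 1) := by
  induction x with
  | nil => exact loopInp_nil rfl
  | cons a x ih =>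
    refine (loopInp_cons rfl (Exec.skip _) ih).conseq rfl ?_
    simp only [List.length_cons]
    omega

end Exec

/-- Determining the length of the input. -/
def countInput {W A B : Type} (v : W) : SProg W A B :=
  .seq (.loop .inp fun a => .seq (.push .aux a) (inc (some v)))
    (.loop .aux fun a => .push .inp a)

open Gen in
-- Counting moves the input to the second stack and thereby reverses it; moving it back restores the
-- order.
theorem exec_countInput {W A B : Type} [DecidableEq W] (v : W) (x : List A) (out : List B)
    (env : W → ℕ) (h0 : env v = 0) :
    Exec (countInput v) (store x [] out env)
      (store x [] out (Function.update env v x.length)) (5 * x.length + 2) := by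
  have h1 : ∀ (x y : List A) (env : W → ℕ),
      Exec (.loop .inp fun a => .seq (.push .aux a) (inc (some v))) (store x y out env)
      (store [] (x.reverse ++ y) out (Function.update env v (env v + x.length)))
      (3 * x.length + 1) := by
    intro x
    induction x with
    | nil => exact fun y env => (Exec.loopInp_nil rfl).conseq (by simp) (by simp)
    | cons a x ih =>
      intro y env
      refine (Exec.loopInp_cons rfl ((Exec.pushAux _ a).seq (Exec.inc_store x (a :: y) out env v))
        (ih _ _)).conseq ?_ ?_
      · simp [add_comm, add_left_comm]
      · simp only [List.length_cons]
        omega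
  have h2 : ∀ (x y : List A) (env : W → ℕ),
      Exec (.loop .aux fun a => .push .inp a) (store x y out env)
      (store (y.reverse ++ x) [] out env) (2 * y.length + 1) := by
    intro x y env
    induction y generalizing x with
    | nil => exact Exec.loopAux_nil rfl
    | cons a y ih =>
      refine (Exec.loopAux_cons rfl (Exec.pushInp _ a) (ih (a :: x))).conseq ?_ ?_
      · simp
      · simp only [List.length_cons]
        omega
  refine ((h1 x [] env).seq (h2 _ _ _)).conseq (by simp [h0]) ?_
  simp
  omega

/-! ### Evaluating a polynomial -/

/-- The value of the polynomial with a given list of coefficients. -/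
def evalCoeffs : List ℕ → ℕ → ℕ
  | [], _ => 0
  | a :: l, n => evalCoeffs l n * n + a

/-- Horner form: multiplication by `X` prepends a zero coefficient, and a constant is added to the
head of the list. -/
theorem exists_evalCoeffs (p : Polynomial ℕ) : ∃ l, ∀ n, evalCoeffs l n = p.eval n := by
  induction p using Polynomial.recOnHorner with
  | M0 => exact ⟨[], by simp [evalCoeffs]⟩
  | MC p a _ _ ih =>
    obtain ⟨l, hl⟩ := ih
    cases l with
    | nil => exact ⟨[a], fun n => by simp [evalCoeffs, ← hl n]⟩
    | cons b l => exact ⟨(b + a) :: l, fun n => by simp [evalCoeffs, ← hl n, add_assoc]⟩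
  | MX p _ ih =>
    obtain ⟨l, hl⟩ := ih
    exact ⟨0 :: l, fun n => by simp [evalCoeffs, ← hl n]⟩

theorem polyBdd_evalCoeffs {A : Type} {f : List A → ℕ} (hf : PolyBdd f) :
    ∀ l, PolyBdd fun x => evalCoeffs l (f x)
  | [] => PolyBdd.const 0
  | a :: l => ((polyBdd_evalCoeffs hf l).mul hf).add (PolyBdd.const a)

/-- Multiplying the counter `r` by `n`, where `u` is an auxiliary counter. -/
def mulBy {W A B : Type} (r n u : W) : SProg W A B :=
  .seq (whilePos (some r) (addMul (some u) 1 (some n))) (whilePos (some u) (inc (some r)))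

/-- Horner's rule. -/
def horner {W A B : Type} (r n u : W) : List ℕ → SProg W A B
  | [] => .skip
  | a :: l => .seq (horner r n u l) (.seq (mulBy r n u) (addConst (some r) a))

open Gen in
-- Each unit removed from `r` adds `n` to `u`; afterwards `u` is poured back into `r`, so it is
-- again available as an auxiliary counter.
theorem exec_mulBy {W A B : Type} [DecidableEq W] {r n u : W} (hrn : r ≠ n) (hru : r ≠ u)
    (hun : u ≠ n) (x y : List A) (out : List B) (env : W → ℕ) (h0 : env u = 0) :
    Exec (mulBy r n u) (store x y out env)
      (store x y out (Function.update env r (env r * env n)))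
      ((env r * (env n * 6 + 3) + 1) + (env r * env n * 2 + 1)) := by
  have h1 := Exec.whilePos (v := some r) (body := (addMul (some u) 1 (some n) : SProg W A B))
    (T := env n * 6 + 2)
    (fun i => store x y out (Function.update (Function.update env u ((env r - i) * env n)) r i))
    (fun i => by simp [store]) (env r) (fun i hi => by
      rw [store_set, Function.update_idem]
      refine (Exec.addMul_store _ _ _ _ 1 hun).conseq ?_ ?_
      · obtain ⟨d, hd⟩ : ∃ d, env r = i + 1 + d := ⟨env r - (i + 1), by omega⟩
        have e1 : i + 1 + d - i = d + 1 := by omega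
        have e2 : i + 1 + d - (i + 1) = d := by omega
        rw [hd, e1, e2]
        congr 1
        funext w
        simp only [Function.update_apply]
        split_ifs <;> simp_all
        ring
      · simp [Function.update_of_ne hrn.symm, Function.update_of_ne hun.symm])
  have h2 := Exec.whilePos (v := some u) (body := (inc (some r) : SProg W A B)) (T := 1)
    (fun i => store x y out (Function.update (Function.update env r (env r * env n - i)) u i))
    (fun i => by simp [store]) (env r * env n) (fun i hi => by
      rw [store_set, Function.update_idem]
      refine (Exec.inc_store _ _ _ _ _).conseq ?_ le_rfl
      congr 1
      funext w
      simp only [Function.update_apply]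
      split_ifs <;> simp_all
      omega)
  have e1 : Function.update (Function.update env u 0) r (env r) = env := by
    funext w
    simp only [Function.update_apply]
    split_ifs <;> simp_all
  have e2 : Function.update (Function.update env u (env r * env n)) r 0 =
      Function.update (Function.update env r 0) u (env r * env n) :=
    Function.update_comm hru.symm _ _ _
  have e3 : Function.update (Function.update env r (env r * env n)) u 0 =
      Function.update env r (env r * env n) := by
    funext w
    simp only [Function.update_apply]
    split_ifs <;> simp_all
  simp only [Nat.sub_self, Nat.zero_mul, Nat.sub_zero, e1, e2] at h1
  simp only [Nat.sub_self, Nat.sub_zero, e3] at h2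
  exact h1.seq h2

/-- The running time of Horner's rule. -/
def hornerTime : List ℕ → ℕ → ℕ
  | [], _ => 1
  | a :: l, n => hornerTime l n + (((evalCoeffs l n * (n * 6 + 3) + 1) +
      (evalCoeffs l n * n * 2 + 1)) + (a + 1))

open Gen in
theorem exec_horner {W A B : Type} [DecidableEq W] {r n u : W} (hrn : r ≠ n) (hru : r ≠ u)
    (hun : u ≠ n) (x y : List A) (out : List B) (env : W → ℕ) (h0 : env u = 0) (hr : env r = 0) :
    ∀ l, Exec (horner r n u l) (store x y out env)
      (store x y out (Function.update env r (evalCoeffs l (env n)))) (hornerTime l (env n))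
  | [] => (Exec.skip _).conseq (by simp [evalCoeffs, ← hr]) le_rfl
  | a :: l => by
    refine ((exec_horner hrn hru hun x y out env h0 hr l).seq
      ((exec_mulBy hrn hru hun x y out _ ?_).seq (Exec.addConst_store _ _ _ _ _ _))).conseq ?_ ?_
    · simp [Function.update_of_ne hru.symm, h0]
    · simp [Function.update_of_ne hrn.symm, evalCoeffs]
    · simp [Function.update_of_ne hrn.symm, hornerTime]

theorem polyBdd_hornerTime {A : Type} {f : List A → ℕ} (hf : PolyBdd f) :
    ∀ l, PolyBdd fun x => hornerTime l (f x)
  | [] => PolyBdd.const 1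
  | a :: l => by
    have h := polyBdd_evalCoeffs hf l
    exact (polyBdd_hornerTime hf l).add ((((h.mul ((hf.mul (.const 6)).add (.const 3))).add
      (.const 1)).add (((h.mul hf).mul (.const 2)).add (.const 1))).add (.const (a + 1)))

end StackProg

/-! ### Functions computed by a polynomial-size loop program -/

namespace StackProg

open Gen

/-- The counters: the length `n` of the input, the number `0`, the value `P` of a polynomial at
`n`, the numbers `P + 1`, `2 * P`, `N = 2 * P + 2`, a number `W`, and counters for loops. -/
inductive Var : Type
  | n
  | zero
  | P
  | P1
  | P2
  | N
  | W
  | u1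
  | u2
  | i
  | j
  | j2
  deriving DecidableEq

theorem Var.finite : Finite Var := by
  refine Finite.of_surjective (fun k : Fin 12 => match k with
    | 0 => Var.n
    | 1 => .zero
    | 2 => .P
    | 3 => .P1
    | 4 => .P2
    | 5 => .N
    | 6 => .W
    | 7 => .u1
    | 8 => .u2
    | 9 => .i
    | 10 => .j
    | 11 => .j2) ?_
  rintro (_ | _ | _ | _ | _ | _ | _ | _ | _ | _ | _ | _)
  exacts [⟨0, rfl⟩, ⟨1, rfl⟩, ⟨2, rfl⟩, ⟨3, rfl⟩, ⟨4, rfl⟩, ⟨5, rfl⟩, ⟨6, rfl⟩, ⟨7, rfl⟩, ⟨8, rfl⟩,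
    ⟨9, rfl⟩, ⟨10, rfl⟩, ⟨11, rfl⟩]

/-- The counters of loops. -/
def Var.IsLoop : Var → Prop
  | .u1 | .u2 | .i | .j | .j2 => True
  | _ => False

/-- The values of the counters outside loops, for `W = a + N * (s + 1)`. -/
def statics (a s n P : ℕ) : Var → ℕ
  | .n => n
  | .P => P
  | .P1 => P + 1
  | .P2 => 2 * P
  | .N => 2 * P + 2
  | .W => a + (2 * P + 2) * (s + 1)
  | _ => 0

theorem statics_of_isLoop {a s n P : ℕ} {v : Var} (h : v.IsLoop) : statics a s n P v = 0 := by
  cases v <;> simp_all [Var.IsLoop, statics]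

/-- Apart from `n`, every counter is dominated by `W`, so one number bounds all counters in the time
estimates. -/
theorem statics_le (a s n P : ℕ) (v : Var) :
    statics a s n P v ≤ n + (a + (2 * P + 2) * (s + 1)) := by
  have : 2 * P + 2 ≤ (2 * P + 2) * (s + 1) := Nat.le_mul_of_pos_right _ (by omega)
  cases v <;> simp only [statics] <;> omega

variable {A B : Type}

/-- Computing the initial values of the counters. -/
def setup (a s : ℕ) (coeffs : List ℕ) : SProg Var A B :=
  .seq (countInput .n) <| .seq (horner .P .n .u1 coeffs) <|
  .seq (addMul (some .P1) 1 (some .P)) <| .seq (addConst (some .P1) 1) <|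
  .seq (addMul (some .P2) 2 (some .P)) <| .seq (addMul (some .N) 2 (some .P)) <|
  .seq (addConst (some .N) 2) <| .seq (addMul (some .W) (s + 1) (some .N)) <|
  addConst (some .W) a

theorem polyExec_setup (a s : ℕ) (p : Polynomial ℕ) (coeffs : List ℕ)
    (hp : ∀ n, evalCoeffs coeffs n = p.eval n) :
    PolyExec (A := A) (B := B) (setup a s coeffs) (fun x => store x [] [] fun _ => 0)
      (fun x => store x [] [] (statics a s x.length (p.eval x.length))) := by
  have hP : PolyBdd fun x : List A => p.eval x.length := PolyBdd.length.eval p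
  have hH := polyBdd_hornerTime (PolyBdd.length (A := A)) coeffs
  refine ⟨fun x => (5 * x.length + 2) + (hornerTime coeffs x.length +
    ((p.eval x.length * (1 + 5) + 2) + ((1 + 1) + ((p.eval x.length * (2 + 5) + 2) +
    ((p.eval x.length * (2 + 5) + 2) + ((2 + 1) + (((2 * p.eval x.length + 2) * (s + 1 + 5) + 2)
    + (a + 1)))))))), ?_, fun x => ?_⟩
  · repeat' first
      | exact PolyBdd.const _
      | exact PolyBdd.length
      | exact hP
      | exact hH
      | apply PolyBdd.add
      | apply PolyBdd.mul
  · refine Exec.conseq ((exec_countInput _ _ _ _ (by rfl)).seq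
      ((exec_horner (by decide) (by decide) (by decide) _ _ _ _ (by rfl) (by rfl) _).seq
      ((Exec.addMul_store _ _ _ _ _ (by decide)).seq ((Exec.addConst_store _ _ _ _ _ _).seq
      ((Exec.addMul_store _ _ _ _ _ (by decide)).seq
      ((Exec.addMul_store _ _ _ _ _ (by decide)).seq
      ((Exec.addConst_store _ _ _ _ _ _).seq
      ((Exec.addMul_store _ _ _ _ _ (by decide)).seq
      (Exec.addConst_store _ _ _ _ _ _))))))))) ?_ ?_
    · congr 1
      funext v
      cases v <;> simp [statics, hp, add_comm, mul_comm]
    · simp [hp, mul_comm]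

/-- For the cells `P + 1, …, 2 * P + 1`, run `h` on the corresponding input symbol. -/
def symLoop (h : Option A → Gen Var B) : SProg Var A B :=
  .seq (addMul (some .j) 1 (some .P1)) <| .seq (addMul (some .j2) 1 (some .P1)) <|
  .seq (whilePos (some .j2) (.read .inp fun o => .seq (h o).prog (inc (some .j)))) <|
  whilePos (some .j) .skip

/-- The output of `symLoop`. -/
def symOut (h : Option A → Gen Var B) (env : Var → ℕ) (x : List A) (k : ℕ) : List B :=
  (List.range k).reverse.flatMap fun d => (h x[d]?).den
    (Function.update (Function.update env .j (env .P1 + d)) .j2 (env .P1 - (d + 1)))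

/-- The only part of the output that depends on the letters of the input. Round `d` pops `x[d]?` (so
`none` beyond the end of the word) while `j` is `P1 + d`, which is cell `d + 1` counted from `-P`.
As the output grows at the front, the rounds appear in reverse order. The bound `2 * env .P1 ≤ N` is
needed because `j` climbs from `P1` to `2 * P1`. -/
theorem exec_symLoop (h : Option A → Gen Var B) (hh : ∀ o, (h o).WF)
    (hb : ∀ o v, (h o).Binds v → v = .u1 ∨ v = .u2) (x : List A) (out : List B) (env : Var → ℕ)
    (h0 : ∀ v : Var, v.IsLoop → env v = 0) (T : Polynomial ℕ) (N : ℕ) (hN : ∀ v, env v ≤ N)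
    (hN' : 2 * env .P1 ≤ N) (hT : ∀ o, (h o).bound.eval N ≤ T.eval N) :
    Exec (symLoop h) (store x [] out env)
      (store (x.drop (env .P1)) [] (symOut h env x (env .P1) ++ out) env)
      ((N * 6 + 2) + ((N * 6 + 2) + ((N * (T.eval N + 3) + 1) + (N * 2 + 1)))) := by
  obtain ⟨k, hk⟩ : ∃ k, k = env .P1 := ⟨_, rfl⟩
  have hj : env .j = 0 := h0 _ trivial
  have hj2 : env .j2 = 0 := h0 _ trivial
  -- With `r` rounds left, `k - r` letters have been consumed and `j` has advanced by the same
  -- amount.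
  have h1 := Exec.whilePos (v := some .j2)
    (body := (.read .inp fun o => .seq (h o).prog (inc (some .j)) : SProg Var A B))
    (T := T.eval N + 2)
    (fun r => store (x.drop (k - r)) [] (symOut h env x (k - r) ++ out)
      (Function.update (Function.update env .j (k + (k - r))) .j2 r))
    (fun r => by simp [store]) k (fun r hr => by
      obtain ⟨d, hd⟩ : ∃ d, k = r + 1 + d := ⟨k - (r + 1), by omega⟩
      have e1 : k - (r + 1) = d := by omega
      have e2 : k - r = d + 1 := by omega
      rw [store_set, Function.update_idem, e1, e2]
      refine (Exec.readInp (t := T.eval N + 1) (Exec.seq (t := T.eval N) (t' := 1)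
        (s' := store (x.drop (d + 1)) [] (symOut h env x (d + 1) ++ out)
          (Function.update (Function.update env .j (k + d)) .j2 r)) ?_ ?_)).conseq rfl (by omega)
      · have hx : (x.drop d).head? = x[d]? := by simp
        have ht : (x.drop d).tail = x.drop (d + 1) := by simp
        have := (h x[d]?).exec (hh _) N (x.drop (d + 1)) [] (symOut h env x d ++ out)
          (Function.update (Function.update env .j (k + d)) .j2 r) (fun v hv => by
            rcases hb _ _ hv with rfl | rfl
            · simpa using h0 .u1 trivial
            · simpa using h0 .u2 trivial) (fun v => by
            simp only [Function.update_apply]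
            split_ifs
            · omega
            · omega
            · exact hN v)
        have e3 : k - (d + 1) = r := by omega
        have h5 := this.conseq rfl (hT _)
        simp only [store, hx, ht] at h5 ⊢
        convert! h5 using 2
        simp [symOut, List.range_succ, ← hk, e3]
      · refine (Exec.inc_store _ _ _ _ _).conseq ?_ le_rfl
        congr 1
        funext w
        simp only [Function.update_apply]
        split_ifs <;> simp_all
        omega)
  refine Exec.conseq ((Exec.addMul_store _ _ _ _ _ (by decide)).seq
    ((Exec.addMul_store _ _ _ _ _ (by decide)).seq (Exec.seq
    (s' := store (x.drop k) [] (symOut h env x k ++ out) (Function.update env .j (k + k)))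
    (t := k * (T.eval N + 3) + 1) ?_ (Exec.clear_store _ _ _ _ _)))) ?_ ?_
  · have e1 : Function.update (Function.update env .j (env .j + 1 * env .P1)) .j2
        (Function.update env .j (env .j + 1 * env .P1) .j2 +
          1 * Function.update env .j (env .j + 1 * env .P1) .P1) =
        Function.update (Function.update env .j (k + 0)) .j2 k := by
      simp [hj, hj2, hk]
    have e2 : Function.update (Function.update env .j (k + k)) .j2 0 =
        Function.update env .j (k + k) := by
      rw [Function.update_eq_self_iff]
      simp [hj2]
    rw [e1]
    simp only [Nat.sub_self, Nat.sub_zero, e2] at h1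
    simpa [symOut] using h1
  · rw [hk]
    congr 1
    rw [Function.update_idem, Function.update_eq_self_iff, hj]
  · have h3 : env .P1 ≤ N := hN _
    have h4 : k * (T.eval N + 3) ≤ N * (T.eval N + 3) := Nat.mul_le_mul_right _ (hk ▸ h3)
    simp
    omega

/-- Setting counters to zero. -/
def clearAll : List Var → SProg Var A B
  | [] => .skip
  | v :: l => .seq (clearAll l) (whilePos (some v) .skip)

theorem exec_clearAll (x y : List A) (out : List B) (env : Var → ℕ) (N : ℕ) (hN : ∀ v, env v ≤ N) :
    ∀ l, Exec (clearAll l) (store x y out env)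
      (store x y out fun v => if v ∈ l then 0 else env v) (l.length * (N * 2 + 1) + 1)
  | [] => (Exec.skip _).conseq (by simp) (by simp)
  | v :: l => by
    refine ((exec_clearAll x y out env N hN l).seq (Exec.clear_store _ _ _ _ v)).conseq ?_ ?_
    · congr 1
      funext w
      by_cases h : w = v <;> simp [h]
    · have := hN v
      simp only [List.length_cons]
      split_ifs
      · linarith
      · linarith

/-- The complete program. -/
def fullProg (a s : ℕ) (coeffs : List ℕ) (g : Gen Var B) (h : Option A → Gen Var B) :
    SProg Var A B :=
  .seq (setup a s coeffs) <| .seq (symLoop h) <| .seq g.prog <|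
  .seq (clearAll [.n, .P, .P1, .P2, .N, .W]) <| .loop .inp fun _ => .skip

/-- `symLoop` runs before `g`, so its output stands last. The final clearing is forced by the
convention that only the output stack may be nonempty at the end; `symLoop` may leave an unread rest
of the input. -/
theorem polyExec_fullProg [Finite A] (a s : ℕ) (p : Polynomial ℕ) (coeffs : List ℕ)
    (hp : ∀ n, evalCoeffs coeffs n = p.eval n) (g : Gen Var B) (h : Option A → Gen Var B)
    (hg : g.WF) (hgb : ∀ v, g.Binds v → v.IsLoop) (hh : ∀ o, (h o).WF)
    (hb : ∀ o v, (h o).Binds v → v = .u1 ∨ v = .u2) :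
    PolyExec (fullProg a s coeffs g h) (fun x => store x [] [] fun _ => 0)
      (fun x => store [] [] (g.den (statics a s x.length (p.eval x.length)) ++
        symOut h (statics a s x.length (p.eval x.length)) x (p.eval x.length + 1))
        fun _ => 0) := by
  have := Fintype.ofFinite (Option A)
  have hP : PolyBdd fun x : List A => p.eval x.length := PolyBdd.length.eval p
  -- The input alphabet is finite, so the sum of the bounds over all letters bounds every body
  -- uniformly.
  obtain ⟨T, hT⟩ : ∃ T : Polynomial ℕ, ∀ o N, (h o).bound.eval N ≤ T.eval N := by
    refine ⟨∑ o, (h o).bound, fun o N => ?_⟩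
    rw [Polynomial.eval_finsetSum]
    exact Finset.single_le_sum (f := fun o => (h o).bound.eval N) (fun _ _ => Nat.zero_le _)
      (Finset.mem_univ o)
  obtain ⟨N, hN⟩ : ∃ N : List A → ℕ, N = fun x => x.length +
    (a + (2 * p.eval x.length + 2) * (s + 1)) := ⟨_, rfl⟩
  have hNP : PolyBdd N := by
    rw [hN]
    repeat' first
      | exact PolyBdd.const _
      | exact PolyBdd.length
      | exact hP
      | apply PolyBdd.add
      | apply PolyBdd.mul
  have hN1 : ∀ x v, statics a s x.length (p.eval x.length) v ≤ N x := fun x v => by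
    rw [hN]
    exact statics_le ..
  refine (polyExec_setup a s p coeffs hp).seq ⟨fun x => (((N x * 6 + 2) + ((N x * 6 + 2) +
    ((N x * (T.eval (N x) + 3) + 1) + (N x * 2 + 1))))) + (g.bound.eval (N x) +
    ((6 * (N x * 2 + 1) + 1) + (2 * x.length + 1))), ?_, fun x => ?_⟩
  · have h1 := hNP.eval T
    have h2 := hNP.eval g.bound
    repeat' first
      | exact PolyBdd.const _
      | exact PolyBdd.length
      | exact hNP
      | exact h1
      | exact h2
      | apply PolyBdd.add
      | apply PolyBdd.mul
  · refine ((exec_symLoop h hh hb x [] _ (fun v hv => statics_of_isLoop hv) T (N x) (hN1 x) ?_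
      (fun o => hT o _)).seq ((g.exec hg (N x) _ _ _ _
        (fun v hv => statics_of_isLoop (hgb v hv)) (hN1 x)).seq
      ((exec_clearAll _ _ _ _ (N x) (hN1 x) _).seq (Exec.clearInp _ _ _ _)))).conseq ?_ ?_
    · have := hN1 x .N
      simp only [statics] at this ⊢
      omega
    · simp only [List.append_nil]
      congr 1
      funext v
      cases v <;> simp [statics]
    · have : (x.drop (statics a s x.length (p.eval x.length) .P1)).length ≤ x.length := by simp
      simp only [List.length_cons, List.length_nil]
      omega

/-- The interface to the machine model: from here on it suffices to exhibit an encoded value as the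
output of a loop program `g` followed by that of `symLoop`. -/
theorem polyTimeComputable_of_gen [Finite A] [Finite B] {β : Type} {eb : β → List B}
    {f : List A → β} (a s : ℕ) (p : Polynomial ℕ) (g : Gen Var B) (h : Option A → Gen Var B)
    (hg : g.WF) (hgb : ∀ v, g.Binds v → v.IsLoop) (hh : ∀ o, (h o).WF)
    (hb : ∀ o v, (h o).Binds v → v = .u1 ∨ v = .u2)
    (hf : ∀ x, eb (f x) = g.den (statics a s x.length (p.eval x.length)) ++
        symOut h (statics a s x.length (p.eval x.length)) x (p.eval x.length + 1)) :
    PolyTimeComputable id eb f := by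
  obtain ⟨coeffs, hp⟩ := exists_evalCoeffs p
  obtain ⟨t, ⟨T, hT⟩, ht⟩ := polyExec_fullProg a s p coeffs hp g h hg hgb hh hb
  have := Var.finite
  have : Finite (Stk (Option Var)) := Stk.finite
  have := fun k : Stk (Option Var) => Stk.finite_sym (A := A) (B := B) k
  have := Fintype.ofFinite (Stk (Option Var))
  have := fun k : Stk (Option Var) => Fintype.ofFinite (k.Sym A B)
  refine polyTimeComputable_of_runs (fullProg a s coeffs g h) .inp .out (Equiv.refl A)
    (Equiv.refl B) T (fun x => (store x [] [] fun _ => 0 : Store Var A B).toStk)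
    (fun x => (store [] [] (eb (f x)) fun _ => 0 : Store Var A B).toStk) ?_ ?_ ?_ ?_ ?_
  · exact fun x => (List.map_id x).symm
  · rintro x (_ | _ | _ | _ | _) hk
    · exact absurd rfl hk
    all_goals rfl
  · exact fun x => (List.map_id (eb (f x))).symm
  · rintro x (_ | _ | _ | _ | _) hk
    on_goal 3 => exact absurd rfl hk
    all_goals rfl
  · intro x
    rw [hf]
    exact Runs.mono (ht x) (hT x)

end StackProg

/-! ### Templates of clauses -/

namespace StackProg.Gen

variable {W B : Type}

/-- Repeating a program a fixed number of times. -/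
def times (g : Gen W B) : ℕ → Gen W B
  | 0 => nil
  | n + 1 => append g (g.times n)

theorem flatMap_replicate {α β : Type} (l : List α) (m : ℕ) (b : β) :
    l.flatMap (fun _ => List.replicate m b) = List.replicate (l.length * m) b := by
  induction l with
  | nil => simp
  | cons x l ih =>
    rw [List.flatMap_cons, ih, ← List.replicate_add, List.length_cons]
    congr 1
    ring

theorem den_times [DecidableEq W] {g : Gen W B} {env : W → ℕ} {m : ℕ} {b : B}
    (h : g.den env = List.replicate m b) : ∀ n, (g.times n).den env = List.replicate (n * m) b
  | 0 => by simp [times, den]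
  | n + 1 => by
    rw [times, den, h, den_times h n, ← List.replicate_add]
    congr 1
    ring

theorem binds_times {g : Gen W B} {v : W} : ∀ {n : ℕ}, (g.times n).Binds v → g.Binds v
  | 0, h => h.elim
  | _ + 1, h => h.elim id binds_times

theorem wf_times {g : Gen W B} (h : g.WF) : ∀ n : ℕ, (g.times n).WF
  | 0 => trivial
  | n + 1 => ⟨h, wf_times h n⟩

end StackProg.Gen

namespace CookLevin

open StackProg TableauVar

attribute [instance] NDTM.finite_state NDTM.finite_sym

/-- The counters that occur in the parameters of variables. -/
inductive Idx : Type
  | zero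
  | P
  | P2
  | i
  | j
  | j2
  deriving DecidableEq

/-- The counter itself. -/
def Idx.var : Idx → Var
  | zero => .zero
  | P => .P
  | P2 => .P2
  | i => .i
  | j => .j
  | j2 => .j2

/-- A number given as the sum of a counter and a constant. -/
abbrev Pos := Idx × ℕ

/-- The value of a position. -/
def Pos.val (r : Pos) (env : Var → ℕ) : ℕ := env r.1.var + r.2

section

variable {A : Type} (M : NDTM A)

/-- A variable of the tableau, with symbolic parameters; cells are counted from `-P`. -/
inductive SVar : Type
  | Q (t : Pos) (k : M.State)
  | H (t r : Pos)
  | S (t r : Pos) (l : M.Sym)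

variable {M}

/-- The variable, for given values of the counters. -/
def SVar.den (env : Var → ℕ) : SVar M → TableauVar M
  | Q t k => .Q (t.val env) k
  | H t r => .H (t.val env) ((r.val env : ℤ) - env .P)
  | S t r l => .S (t.val env) ((r.val env : ℤ) - env .P) l

/-- A literal, for given values of the counters. -/
def litDen (env : Var → ℕ) (l : Bool × SVar M) : Literal (TableauVar M) := ⟨l.2.den env, l.1⟩

variable (M)

/-- Templates of sets of clauses. -/
inductive Tmpl : Type
  | nil : Tmpl
  | clause (c : List (Bool × SVar M)) : Tmpl
  | bigClause (w c : Var) (l : Bool × SVar M) : Tmpl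
  | append (T U : Tmpl) : Tmpl
  | forBelow (w c : Var) (T : Tmpl) : Tmpl

variable {M}

namespace Tmpl

/-- The clauses described by a template. -/
def den : Tmpl M → (Var → ℕ) → List (List (Literal (TableauVar M)))
  | nil, _ => []
  | clause c, env => [c.map (litDen env)]
  | bigClause w c l, env =>
    [(List.range (env c)).map fun n => litDen (Function.update env w n) l]
  | append T U, env => T.den env ++ U.den env
  | forBelow w c T, env => (List.range (env c)).flatMap fun n => T.den (Function.update env w n)

/-- A finite family of templates. -/
def family {α : Type} (l : List α) (f : α → Tmpl M) : Tmpl M :=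
  l.foldr (fun x => append (f x)) nil

/-- `v` is the counter of a loop of the template. -/
def Binds (v : Var) : Tmpl M → Prop
  | nil => False
  | clause _ => False
  | bigClause w _ _ => v = w
  | append T U => T.Binds v ∨ U.Binds v
  | forBelow w _ T => v = w ∨ T.Binds v

/-- Loops use the counters reserved for loops, and nested loops use different ones. -/
def WF : Tmpl M → Prop
  | nil => True
  | clause _ => True
  | bigClause w c _ => (w = .i ∨ w = .j ∨ w = .j2) ∧ w ≠ c
  | append T U => T.WF ∧ U.WF
  | forBelow w c T => (w = .i ∨ w = .j ∨ w = .j2) ∧ w ≠ c ∧ ¬ T.Binds w ∧ T.WF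

@[simp]
theorem binds_family {α : Type} {v : Var} {l : List α} {f : α → Tmpl M} :
    (family l f).Binds v ↔ ∃ x ∈ l, (f x).Binds v := by
  induction l with
  | nil => simp [family, Binds]
  | cons x l ih =>
    have : (family (x :: l) f).Binds v ↔ (f x).Binds v ∨ (family l f).Binds v := Iff.rfl
    rw [this, ih]
    simp

@[simp]
theorem wf_family {α : Type} {l : List α} {f : α → Tmpl M} :
    (family l f).WF ↔ ∀ x ∈ l, (f x).WF := by
  induction l with
  | nil => simp [family, WF]
  | cons x l ih =>
    have : (family (x :: l) f).WF ↔ (f x).WF ∧ (family l f).WF := Iff.rfl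
    rw [this, ih]
    simp

end Tmpl

/-! ### Numbering of the variables -/

variable (M)

/-- The number of variables for each time. -/
noncomputable def width (P : ℕ) : ℕ := Nat.card M.State + (2 * P + 2) * (Nat.card M.Sym + 1)

/-- Numbering of the states. -/
noncomputable def stateNum (k : M.State) : ℕ := Finite.equivFin M.State k

/-- Numbering of the symbols. -/
noncomputable def symNum (l : M.Sym) : ℕ := Finite.equivFin M.Sym l

/-- Numbering of the variables. -/
noncomputable def index (P : ℕ) : TableauVar M → ℕ
  | Q i k => i * width M P + stateNum M k
  | H i j => i * width M P + (Nat.card M.State + (j + P).toNat * (Nat.card M.Sym + 1))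
  | S i j l => i * width M P +
      (Nat.card M.State + (j + P).toNat * (Nat.card M.Sym + 1) + (symNum M l + 1))

/-- The word for a literal. -/
noncomputable def encLit (P : ℕ) (l : Literal (TableauVar M)) : List SATSymbol :=
  (if l.sign then SATSymbol.pos else SATSymbol.neg) ::
    List.replicate (index M P l.var) SATSymbol.tick

/-- The word for a list of clauses. -/
noncomputable def encCnf (P : ℕ) (cs : List (List (Literal (TableauVar M)))) : List SATSymbol :=
  cs.flatMap fun c => SATSymbol.clause :: c.flatMap (encLit M P)

variable {M}

/-! ### Programs that write the clauses of a template -/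

/-- Program for as many ticks as there are variables for times before `t`. -/
def timeGen (t : Pos) : Gen Var SATSymbol :=
  .append (.forBelow .u1 t.1.var (.forBelow .u2 .W (.emit .tick)))
    (Gen.times (.forBelow .u2 .W (.emit .tick)) t.2)

/-- Program for `s + 1` ticks for each cell before `r`. -/
def cellGen (s : ℕ) (r : Pos) : Gen Var SATSymbol :=
  .append (.forBelow .u1 r.1.var (Gen.times (.emit .tick) (s + 1)))
    (Gen.times (.emit .tick) (r.2 * (s + 1)))

/-- With `W` equal to `width`, this is the summand of `index` that belongs to the time. -/
theorem den_timeGen (t : Pos) (env : Var → ℕ) :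
    (timeGen t).den env = List.replicate (t.val env * env .W) .tick := by
  have h : ∀ env : Var → ℕ, (Gen.forBelow .u2 .W (.emit .tick) : Gen Var SATSymbol).den env =
      List.replicate (env .W) .tick := fun env => by
    simpa [Gen.den] using Gen.flatMap_replicate (List.range (env .W)) 1 SATSymbol.tick
  have h1 : (Gen.forBelow .u1 t.1.var (.forBelow .u2 .W (.emit .tick)) :
      Gen Var SATSymbol).den env = List.replicate (env t.1.var * env .W) .tick := by
    rw [Gen.den]
    simp only [h]
    simpa using Gen.flatMap_replicate (List.range (env t.1.var)) (env .W) SATSymbol.tick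
  rw [timeGen, Gen.den, h1, Gen.den_times (h env), ← List.replicate_add, Pos.val, add_mul]

theorem den_cellGen (s : ℕ) (r : Pos) (env : Var → ℕ) :
    (cellGen s r).den env = List.replicate (r.val env * (s + 1)) .tick := by
  have h : ∀ (env : Var → ℕ) (n : ℕ), (Gen.times (.emit .tick) n : Gen Var SATSymbol).den env =
      List.replicate n .tick := fun env n => by
    simpa using Gen.den_times (g := (.emit .tick : Gen Var SATSymbol)) (env := env) (m := 1) rfl n
  have h1 : (Gen.forBelow .u1 r.1.var (Gen.times (.emit .tick) (s + 1)) :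
      Gen Var SATSymbol).den env = List.replicate (env r.1.var * (s + 1)) .tick := by
    rw [Gen.den]
    simp only [h]
    simpa using Gen.flatMap_replicate (List.range (env r.1.var)) (s + 1) SATSymbol.tick
  rw [cellGen, Gen.den, h1, h, ← List.replicate_add, Pos.val, add_mul]

/-- The counters `u1` and `u2` are the only loop counters, and they are used correctly. -/
def Gen.Inner (g : Gen Var SATSymbol) : Prop := g.WF ∧ ∀ v, g.Binds v → v = .u1 ∨ v = .u2

theorem Gen.Inner.append {g h : Gen Var SATSymbol} (hg : Inner g) (hh : Inner h) :
    Inner (.append g h) :=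
  ⟨⟨hg.1, hh.1⟩, fun v hv => hv.elim (hg.2 v) (hh.2 v)⟩

theorem inner_emit (b : SATSymbol) : Gen.Inner (.emit b) := ⟨trivial, fun _ h => h.elim⟩

theorem inner_times {g : Gen Var SATSymbol} (h : Gen.Inner g) (n : ℕ) : Gen.Inner (g.times n) :=
  ⟨Gen.wf_times h.1 n, fun v hv => h.2 v (Gen.binds_times hv)⟩

theorem inner_timeGen (t : Pos) : Gen.Inner (timeGen t) := by
  have h : Gen.Inner (.forBelow .u2 .W (.emit .tick)) :=
    ⟨⟨by decide, id, trivial⟩, fun v hv => Or.inr (hv.resolve_right id)⟩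
  refine Gen.Inner.append ⟨⟨?_, ?_, h.1⟩, ?_⟩ (inner_times h _)
  · rcases t with ⟨_ | _, _⟩ <;> simp [Idx.var]
  · simp [Gen.Binds]
  · exact fun v hv => hv.elim Or.inl (h.2 v)

theorem inner_cellGen (s : ℕ) (r : Pos) : Gen.Inner (cellGen s r) := by
  have h := inner_times (inner_emit .tick) (s + 1)
  refine Gen.Inner.append ⟨⟨?_, ?_, h.1⟩, ?_⟩ (inner_times (inner_emit _) _)
  · rcases r with ⟨_ | _, _⟩ <;> simp [Idx.var]
  · exact fun hv => Gen.binds_times hv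
  · exact fun v hv => hv.elim Or.inl (h.2 v)

/-- Program for the number of a variable. -/
noncomputable def SVar.gen : SVar M → Gen Var SATSymbol
  | Q t k => .append (timeGen t) (Gen.times (.emit .tick) (stateNum M k))
  | H t r => .append (timeGen t) (.append (Gen.times (.emit .tick) (Nat.card M.State))
      (cellGen (Nat.card M.Sym) r))
  | S t r l => .append (timeGen t) (.append (.append (Gen.times (.emit .tick) (Nat.card M.State))
      (cellGen (Nat.card M.Sym) r)) (Gen.times (.emit .tick) (symNum M l + 1)))

theorem SVar.inner_gen : ∀ v : SVar M, Gen.Inner v.gen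
  | Q t _ => (inner_timeGen t).append (inner_times (inner_emit _) _)
  | H t r => (inner_timeGen t).append ((inner_times (inner_emit _) _).append (inner_cellGen _ r))
  | S t r _ => (inner_timeGen t).append (((inner_times (inner_emit _) _).append
      (inner_cellGen _ r)).append (inner_times (inner_emit _) _))

/-- `index` is a sum of products of counters and constants, each written by nested loops. Symbolic
cells are counted from `-P`, so the shift by `P` in `index` cancels. -/
theorem SVar.den_gen (v : SVar M) (env : Var → ℕ) (hW : env .W = width M (env .P)) :
    v.gen.den env = List.replicate (index M (env .P) (v.den env)) .tick := by
  have h : ∀ n : ℕ, (Gen.times (.emit .tick) n : Gen Var SATSymbol).den env =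
      List.replicate n .tick := fun n => by
    simpa using Gen.den_times (g := (.emit .tick : Gen Var SATSymbol)) (env := env) (m := 1) rfl n
  cases v <;>
  simp only [gen, Gen.den, den_timeGen, den_cellGen, h, hW, ← List.replicate_add, SVar.den,
    index, sub_add_cancel, Int.toNat_natCast]

/-- Program for a literal. -/
noncomputable def litGen (l : Bool × SVar M) : Gen Var SATSymbol :=
  .append (.emit (if l.1 then .pos else .neg)) l.2.gen

theorem inner_litGen (l : Bool × SVar M) : Gen.Inner (litGen l) :=
  (inner_emit _).append l.2.inner_gen

theorem den_litGen (l : Bool × SVar M) (env : Var → ℕ) (hW : env .W = width M (env .P)) :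
    (litGen l).den env = encLit M (env .P) (litDen env l) := by
  obtain ⟨b, v⟩ := l
  cases b <;> simp [litGen, Gen.den, SVar.den_gen _ _ hW, encLit, litDen]

/-- Program for a list of literals. -/
noncomputable def litsGen : List (Bool × SVar M) → Gen Var SATSymbol
  | [] => .nil
  | l :: c => .append (litGen l) (litsGen c)

theorem inner_litsGen : ∀ c : List (Bool × SVar M), Gen.Inner (litsGen c)
  | [] => ⟨trivial, fun _ h => h.elim⟩
  | l :: c => (inner_litGen l).append (inner_litsGen c)

theorem den_litsGen (env : Var → ℕ) (hW : env .W = width M (env .P)) :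
    ∀ c : List (Bool × SVar M),
      (litsGen c).den env = (c.map (litDen env)).flatMap (encLit M (env .P))
  | [] => rfl
  | l :: c => by
    rw [litsGen, Gen.den, den_litGen _ _ hW, den_litsGen env hW c]
    rfl

namespace Tmpl

/-- Program for the clauses of a template. -/
noncomputable def gen : Tmpl M → Gen Var SATSymbol
  | nil => .nil
  | clause c => .append (.emit .clause) (litsGen c)
  | bigClause w c l => .append (.emit .clause) (.forBelow w c (litGen l))
  | append T U => .append T.gen U.gen
  | forBelow w c T => .forBelow w c T.gen

theorem binds_gen {v : Var} : ∀ {T : Tmpl M}, T.gen.Binds v → T.Binds v ∨ v = .u1 ∨ v = .u2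
  | nil, h => h.elim
  | clause c, h => Or.inr (((inner_emit _).append (inner_litsGen c)).2 v h)
  | bigClause _ _ l, h => by
    rcases h with h | h | h
    · exact h.elim
    · exact Or.inl h
    · exact Or.inr ((inner_litGen l).2 v h)
  | append _ _, h => h.elim (fun h => (binds_gen h).imp_left Or.inl)
      (fun h => (binds_gen h).imp_left Or.inr)
  | forBelow _ _ _, h => h.elim (fun h => Or.inl (Or.inl h))
      (fun h => (binds_gen h).imp_left Or.inr)

/-- The counters `u1`, `u2` that write numbers are disjoint from the counters `i`, `j`, `j2` of
template loops. -/
theorem wf_gen : ∀ {T : Tmpl M}, T.WF → T.gen.WF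
  | nil, _ => trivial
  | clause c, _ => ((inner_emit _).append (inner_litsGen c)).1
  | bigClause w c l, h => by
    refine ⟨trivial, h.2, fun hb => ?_, (inner_litGen l).1⟩
    rcases (inner_litGen l).2 _ hb with rfl | rfl <;> simp [WF] at h
  | append _ _, h => ⟨wf_gen h.1, wf_gen h.2⟩
  | forBelow w c T, h => by
    refine ⟨h.2.1, fun hb => ?_, wf_gen h.2.2.2⟩
    rcases binds_gen hb with hb | rfl | rfl
    · exact h.2.2.1 hb
    all_goals simpa using h.1

theorem isLoop_of_binds {v : Var} : ∀ {T : Tmpl M}, T.WF → T.Binds v → v.IsLoop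
  | nil, _, h => h.elim
  | clause _, _, h => h.elim
  | bigClause _ _ _, hw, h => by
    have h : v = _ := h
    subst h
    rcases hw.1 with rfl | rfl | rfl <;> trivial
  | append _ _, hw, h => h.elim (isLoop_of_binds hw.1) (isLoop_of_binds hw.2)
  | forBelow _ _ _, hw, h => by
    rcases h with rfl | h
    · rcases hw.1 with rfl | rfl | rfl <;> trivial
    · exact isLoop_of_binds hw.2.2.2 h

/-- The two readings of a template agree. Template loops change only `i`, `j` and `j2`, so the
numbering, which depends on `P` and `W`, is the same in all rounds. -/
theorem den_gen (T : Tmpl M) (hT : T.WF) (env : Var → ℕ) (hW : env .W = width M (env .P)) :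
    T.gen.den env = encCnf M (env .P) (T.den env) := by
  have hu : ∀ {w : Var} (n : ℕ), (w = .i ∨ w = .j ∨ w = .j2) →
      Function.update env w n .P = env .P ∧ Function.update env w n .W = env .W := by
    rintro w n (rfl | rfl | rfl) <;> simp
  induction T generalizing env with
  | nil => rfl
  | clause c => simp [gen, Gen.den, den_litsGen env hW, encCnf, den]
  | bigClause w c l =>
    have : ∀ n, (litGen l).den (Function.update env w n) =
        encLit M (env .P) (litDen (Function.update env w n) l) := fun n => by
      have h := hu n hT.1
      rw [den_litGen _ _ (by rw [h.1, h.2, hW]), h.1]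
    simp [gen, Gen.den, encCnf, den, this, List.flatMap_map]
  | append T U ihT ihU =>
    rw [gen, Gen.den, ihT hT.1 env hW hu, ihU hT.2 env hW hu, den, encCnf, encCnf, encCnf,
      List.flatMap_append]
  | forBelow w c T ih =>
    have : ∀ n, T.gen.den (Function.update env w n) =
        encCnf M (env .P) (T.den (Function.update env w n)) := fun n => by
      have h := hu n hT.1
      rw [ih hT.2.2.2 _ (by rw [h.1, h.2, hW]) ?_, h.1]
      rintro w n (rfl | rfl | rfl) <;> simp
    simp only [gen, Gen.den, den, this]
    simp [encCnf, List.flatMap_assoc]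

end Tmpl

end

end CookLevin

/-! ### The template of the tableau -/

namespace CookLevin

open StackProg TableauVar NDTM

/-- The elements of a finite type. -/
noncomputable def elems (α : Type) [Finite α] : List α :=
  letI := Fintype.ofFinite α
  Finset.univ.toList

@[simp]
theorem mem_elems {α : Type} [Finite α] (x : α) : x ∈ elems α := by
  simp [elems]

theorem finite_move : Finite Move := by
  refine Finite.of_surjective (fun k : Fin 3 => match k with
    | 0 => Move.left
    | 1 => .stay
    | 2 => .right) ?_
  rintro (_ | _ | _)
  exacts [⟨0, rfl⟩, ⟨1, rfl⟩, ⟨2, rfl⟩]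

theorem finite_aspect : Finite Aspect := by
  refine Finite.of_surjective (fun k : Fin 3 => match k with
    | 0 => Aspect.head
    | 1 => .state
    | 2 => .symbol) ?_
  rintro (_ | _ | _)
  exacts [⟨0, rfl⟩, ⟨1, rfl⟩, ⟨2, rfl⟩]

attribute [instance] finite_move finite_aspect

/-- A list of lists as a set of sets. -/
def toSets {α : Type} (L : List (List α)) : Set (Set α) := {K | ∃ c ∈ L, K = {l | l ∈ c}}

theorem toSets_append {α : Type} (L L' : List (List α)) :
    toSets (L ++ L') = toSets L ∪ toSets L' := by
  ext K
  simp [toSets, or_and_right, exists_or]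

section

variable {A : Type} {M : NDTM A}

/-! ### Clauses of a template as a set of sets of literals -/

section mem

variable {K : Set (Literal (TableauVar M))} {env : Var → ℕ}

theorem mem_toSets_nil : K ∈ toSets (Tmpl.nil.den env : List (List (Literal (TableauVar M)))) ↔
    False := by
  simp [Tmpl.den, toSets]

theorem mem_toSets_clause {c : List (Bool × SVar M)} :
    K ∈ toSets ((Tmpl.clause c).den env) ↔ K = {l | l ∈ c.map (litDen env)} := by
  simp [Tmpl.den, toSets]

theorem mem_toSets_bigClause {v c : Var} {l : Bool × SVar M} :
    K ∈ toSets ((Tmpl.bigClause v c l).den env) ↔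
      K = {l' | ∃ n < env c, l' = litDen (Function.update env v n) l} := by
  simp [Tmpl.den, toSets, eq_comm]

theorem mem_toSets_append {T U : Tmpl M} :
    K ∈ toSets ((T.append U).den env) ↔ K ∈ toSets (T.den env) ∨ K ∈ toSets (U.den env) := by
  rw [Tmpl.den, toSets_append, Set.mem_union]

theorem mem_toSets_forBelow {v c : Var} {T : Tmpl M} :
    K ∈ toSets ((Tmpl.forBelow v c T).den env) ↔
      ∃ n < env c, K ∈ toSets (T.den (Function.update env v n)) := by
  simp only [Tmpl.den, toSets, Set.mem_ofPred_eq, List.mem_flatMap, List.mem_range]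
  constructor
  · rintro ⟨c, ⟨n, hn, hc⟩, h⟩
    exact ⟨n, hn, c, hc, h⟩
  · rintro ⟨n, hn, c, hc, h⟩
    exact ⟨c, ⟨n, hn, hc⟩, h⟩

theorem mem_toSets_family {α : Type} {l : List α} {f : α → Tmpl M} :
    K ∈ toSets ((Tmpl.family l f).den env) ↔ ∃ x ∈ l, K ∈ toSets ((f x).den env) := by
  induction l with
  | nil => simp [Tmpl.family, mem_toSets_nil]
  | cons x l ih =>
    have : K ∈ toSets ((Tmpl.family (x :: l) f).den env) ↔ _ :=
      mem_toSets_append (T := f x) (U := Tmpl.family l f)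
    rw [this, ih]
    simp

end mem

/-! ### Templates for the six groups -/

variable (M)

/-- Template for `G₁`. -/
noncomputable def tmpl₁ : Tmpl M :=
  .forBelow .i .P1 <| .append
    (.clause ((elems M.State).map fun k => (true, .Q (.i, 0) k)))
    (.family (elems {q : M.State × M.State // q.1 ≠ q.2}) fun q =>
      .clause [(false, .Q (.i, 0) q.1.1), (false, .Q (.i, 0) q.1.2)])

/-- Template for `G₂`. -/
def tmpl₂ : Tmpl M :=
  .forBelow .i .P1 <| .append (.bigClause .j .N (true, .H (.i, 0) (.j, 0)))
    (.forBelow .j .N <| .forBelow .j2 .j <|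
      .clause [(false, .H (.i, 0) (.j2, 0)), (false, .H (.i, 0) (.j, 0))])

/-- Template for `G₃`. -/
noncomputable def tmpl₃ : Tmpl M :=
  .forBelow .i .P1 <| .forBelow .j .N <| .append
    (.clause ((elems M.Sym).map fun l => (true, .S (.i, 0) (.j, 0) l)))
    (.family (elems {q : M.Sym × M.Sym // q.1 ≠ q.2}) fun q =>
      .clause [(false, .S (.i, 0) (.j, 0) q.1.1), (false, .S (.i, 0) (.j, 0) q.1.2)])

/-- Template for `G₄`, except for the cells `1, …, P + 1`. -/
def tmpl₄ : Tmpl M :=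
  .append (.clause [(true, .Q (.zero, 0) M.start)]) <|
  .append (.clause [(true, .H (.zero, 0) (.P, 1))]) <|
  .forBelow .j .P1 <| .clause [(true, .S (.zero, 0) (.j, 0) M.blank)]

/-- Template for `G₅`. -/
def tmpl₅ : Tmpl M := .clause [(true, .Q (.P, 0) M.accept)]

/-- Template for the first part of `G₆`. -/
noncomputable def tmpl₆ : Tmpl M :=
  .forBelow .i .P <| .forBelow .j .N <| .family (elems M.Sym) fun l =>
    .clause [(false, .S (.i, 0) (.j, 0) l), (true, .H (.i, 0) (.j, 0)),
      (true, .S (.i, 1) (.j, 0) l)]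

/-- The position of the head after a movement, if it is one of the cells; `(zero, 0)` is the
first cell, and `(P2, 1)` is the last one. -/
def shiftPos (r : Pos) : Move → Option Pos
  | .left => if r.2 = 0 then none else some (r.1, r.2 - 1)
  | .stay => some r
  | .right => if r.1 = .P2 then none else some (r.1, r.2 + 1)

variable {M} in
/-- The literal for an aspect of the outcome of an action. -/
def outcomeLit (r : Pos) (t : M.State × M.Sym × Move) : Aspect → Option (Bool × SVar M)
  | .head => (shiftPos r t.2.2).map fun r' => (true, .H (.i, 1) r')
  | .state => some (true, .Q (.i, 1) t.1)
  | .symbol => some (true, .S (.i, 1) r t.2.1)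

/-- Template for the second part of `G₆`, for one time and cell. -/
noncomputable def tmplStep (r : Pos) : Tmpl M :=
  .family (elems (M.State × M.Sym)) fun q =>
    .family (elems (M.State × M.Sym × Move → Aspect)) fun g =>
      .clause ([(false, .H (.i, 0) r), (false, .Q (.i, 0) q.1), (false, .S (.i, 0) r q.2)] ++
        ((elems {t // t ∈ M.actions q.1 q.2}).filterMap fun t => outcomeLit r t.1 (g t.1)))

/-- Template for the second part of `G₆`. -/
noncomputable def tmpl₆' : Tmpl M :=
  .forBelow .i .P <| .append (tmplStep M (.zero, 0)) <| .append (tmplStep M (.P2, 1)) <|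
    .forBelow .j .P2 (tmplStep M (.j, 1))

/-- Template for the tableau, except for the symbols in the cells `1, …, P + 1` at time `0`. -/
noncomputable def tableauTmpl : Tmpl M :=
  .append (tmpl₁ M) <| .append (tmpl₂ M) <| .append (tmpl₃ M) <| .append (tmpl₄ M) <|
  .append (tmpl₅ M) <| .append (tmpl₆ M) (tmpl₆' M)

theorem wf_tableauTmpl : (tableauTmpl M).WF := by
  simp [tableauTmpl, tmpl₁, tmpl₂, tmpl₃, tmpl₄, tmpl₅, tmpl₆, tmpl₆', tmplStep, Tmpl.WF,
    Tmpl.Binds]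

/-- Template for the symbol in a cell at time `0`. -/
def symTmpl (o : Option A) : Tmpl M :=
  .clause [(true, .S (.zero, 0) (.j, 0) (o.elim M.blank M.input))]

/-- The clauses for the symbols in the cells `1, …, P + 1` at time `0`. -/
def symClauses (P : ℕ) (x : List A) : List (List (Literal (TableauVar M))) :=
  (List.range (P + 1)).reverse.map fun d : ℕ =>
    [posLit (S 0 ((d : ℤ) + 1) (x[d]?.elim M.blank M.input))]

variable {M}

theorem setOf_mem_cons {α : Type} (a : α) (l : List α) : {x | x ∈ a :: l} = insert a {x | x ∈ l} := by
  ext x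
  simp

theorem setOf_mem_nil {α : Type} : {x : α | x ∈ ([] : List α)} = ∅ := by
  ext x
  simp

/-- Loops count cells from the left end: `m = j + P` runs through `0, …, 2 * P + 1`. -/
theorem exists_mem_cells {P : ℕ} {φ : ℤ → Prop} :
    (∃ j ∈ cells P, φ j) ↔ ∃ m ≤ 2 * P + 1, φ ((m : ℤ) - P) := by
  constructor
  · rintro ⟨j, ⟨h1, h2⟩, h⟩
    exact ⟨(j + P).toNat, by omega, by rwa [Int.toNat_of_nonneg (by omega), add_sub_cancel_right]⟩
  · rintro ⟨m, hm, h⟩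
    exact ⟨_, ⟨by omega, by omega⟩, h⟩

/-- Whether a displaced head is still on a cell has to be decided from the symbolic position `r`,
since templates cannot compare counters. The hypotheses `hs` and `hn` say that `shiftPos` decides
this correctly; then exactly the literals on existing cells are kept. -/
theorem mem_toSets_tmplStep {K : Set (Literal (TableauVar M))} {env : Var → ℕ} {P i : ℕ} {j : ℤ}
    {r : Pos} (hP : env .P = P) (hi : env .i = i) (hiP : i < P) (hj : (r.val env : ℤ) - P = j)
    (hjc : j ∈ cells P)
    (hs : ∀ m r', shiftPos r m = some r' → (r'.val env : ℤ) - P = j + m.shift ∧ j + m.shift ∈ cells P)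
    (hn : ∀ m, shiftPos r m = none → j + m.shift ∉ cells P) :
    K ∈ toSets ((tmplStep M r).den env) ↔ ∃ k l, ∃ g : M.State × M.Sym × Move → Aspect,
      K = {negLit (H i j), negLit (Q i k), negLit (S i j l)} ∪
        {a | ∃ t ∈ M.actions k l, M.outcome i j t (g t) ∈ M.tableauVars P ∧
          a = posLit (M.outcome i j t (g t))} := by
  have hv : ∀ c, Pos.val (Idx.i, c) env = i + c := fun c => by rw [Pos.val, Idx.var, hi]
  have key : ∀ (t : M.State × M.Sym × Move) (s : Aspect) (a : Literal (TableauVar M)),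
      (∃ l, outcomeLit r t s = some l ∧ litDen env l = a) ↔
        M.outcome i j t s ∈ M.tableauVars P ∧ a = posLit (M.outcome i j t s) := by
    intro t s a
    have hi' : i + 1 ≤ P := hiP
    cases s with
    | head =>
      rcases h : shiftPos r t.2.2 with _ | r'
      · have := hn _ h
        simp [outcomeLit, h, outcome, tableauVars, this]
      · have := hs _ _ h
        simp [outcomeLit, h, outcome, tableauVars, this.2, hi', litDen, SVar.den, hP, this.1,
          posLit, hv, eq_comm]
    | state =>
      simp [outcomeLit, outcome, tableauVars, hi', litDen, SVar.den,
          posLit, hv, eq_comm]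
    | symbol =>
      simp [outcomeLit, outcome, tableauVars, hi', litDen, SVar.den, hP, hj, hjc,
          posLit, hv, eq_comm]
  simp only [tmplStep, mem_toSets_family, mem_toSets_clause, mem_elems, true_and]
  refine Prod.exists.trans <| exists_congr fun k => exists_congr fun l => exists_congr fun g => ?_
  have : {x | x ∈ List.map (litDen env) ([(false, SVar.H (Idx.i, 0) r), (false, .Q (.i, 0) k),
      (false, .S (.i, 0) r l)] ++ ((elems {t // t ∈ M.actions k l}).filterMap fun t =>
        outcomeLit r t.1 (g t.1)))} =
      {negLit (H i j), negLit (Q i k), negLit (S i j l)} ∪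
        {a | ∃ t ∈ M.actions k l, M.outcome i j t (g t) ∈ M.tableauVars P ∧
          a = posLit (M.outcome i j t (g t))} := by
    ext a
    simp only [List.map_append, List.mem_append, Set.mem_union, Set.mem_ofPred_eq]
    refine or_congr ?_ ?_
    · simp [litDen, SVar.den, hP, hj, hv, negLit]
    · simp only [List.mem_map, List.mem_filterMap, mem_elems, true_and]
      constructor
      · rintro ⟨l', ⟨⟨t, ht⟩, h1⟩, h2⟩
        exact ⟨t, ht, (key _ _ _).1 ⟨l', h1, h2⟩⟩
      · rintro ⟨t, ht, h⟩
        obtain ⟨l', h1, h2⟩ := (key _ _ _).2 h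
        exact ⟨l', ⟨⟨t, ht⟩, h1⟩, h2⟩
  rw [this]

theorem initTape_succ (x : List A) (m : ℕ) :
    M.initTape x ((m : ℤ) + 1) = x[m]?.elim M.blank M.input := by
  rw [initTape, if_pos (by omega)]
  have : ((m : ℤ) + 1 - 1).toNat = m := by omega
  rw [this, List.getD_eq_getElem?_getD, List.getElem?_map]
  cases x[m]? <;> rfl

/-! ### The templates describe the groups of clauses -/

section groups

variable (M) (a s n P : ℕ)

theorem toSets_tmpl₁ : toSets ((tmpl₁ M).den (statics a s n P)) = M.G₁ P := by
  ext K
  simp only [tmpl₁, mem_toSets_forBelow, mem_toSets_append, mem_toSets_family, mem_toSets_clause,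
    G₁, Set.mem_union, Set.mem_ofPred_eq, List.map_cons, List.map_nil, setOf_mem_cons,
    setOf_mem_nil, insert_empty_eq]
  simp [statics, litDen, SVar.den, Pos.val, Idx.var, Function.update, posLit,
    negLit, and_or_left, exists_or, eq_comm]

theorem toSets_tmpl₂ : toSets ((tmpl₂ M).den (statics a s n P)) = M.G₂ P := by
  ext K
  simp only [tmpl₂, mem_toSets_forBelow, mem_toSets_append, mem_toSets_bigClause,
    mem_toSets_clause, G₂, Set.mem_union, Set.mem_ofPred_eq, List.map_cons, List.map_nil,
    setOf_mem_cons, setOf_mem_nil, insert_empty_eq]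
  simp [statics, litDen, SVar.den, Pos.val, Idx.var, Function.update, posLit,
    negLit, Nat.lt_succ_iff, and_or_left, exists_or, exists_mem_cells]
  -- The outer loop of the template runs over the larger cell, because a loop bound must be a
  -- counter; the roles of the two cells are exchanged here.
  refine or_congr Iff.rfl (exists_congr fun i => and_congr_right fun _ => ?_)
  constructor
  · rintro ⟨m, hm, m', hm', rfl⟩
    exact ⟨m', by omega, m, hm, hm', rfl⟩
  · rintro ⟨m, hm, m', hm', h, rfl⟩
    exact ⟨m', hm', m, h, rfl⟩

theorem toSets_tmpl₃ : toSets ((tmpl₃ M).den (statics a s n P)) = M.G₃ P := by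
  ext K
  simp only [tmpl₃, mem_toSets_forBelow, mem_toSets_append, mem_toSets_family, mem_toSets_clause,
    G₃, Set.mem_union, Set.mem_ofPred_eq, List.map_cons, List.map_nil, setOf_mem_cons,
    setOf_mem_nil, insert_empty_eq]
  simp [statics, litDen, SVar.den, Pos.val, Idx.var, Function.update, posLit,
    negLit, Nat.lt_succ_iff, and_or_left, exists_or, eq_comm, exists_mem_cells]

/-- The cells split at the head start: `-P, …, 0` are blank for every input and come from the
template, while `1, …, P + 1` depend on `x` and come from `symClauses`. -/
theorem toSets_tmpl₄ (x : List A) :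
    toSets ((tmpl₄ M).den (statics a s n P)) ∪ toSets (symClauses M P x) = M.G₄ P x := by
  ext K
  simp only [tmpl₄, mem_toSets_forBelow, mem_toSets_append, mem_toSets_clause,
    G₄, Set.mem_union, Set.mem_ofPred_eq, Set.mem_insert_iff, Set.mem_singleton_iff, List.map_cons,
    List.map_nil, setOf_mem_cons, setOf_mem_nil, insert_empty_eq]
  simp [statics, litDen, SVar.den, Pos.val, Idx.var, Function.update, posLit,
    symClauses, toSets, exists_mem_cells]
  rw [or_assoc, or_assoc, or_assoc]
  refine or_congr Iff.rfl (or_congr Iff.rfl ?_)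
  constructor
  · rintro (⟨m, hm, rfl⟩ | ⟨m, hm, rfl⟩)
    · refine ⟨m, by omega, ?_⟩
      rw [initTape, if_neg (by omega)]
    · refine ⟨P + 1 + m, by omega, ?_⟩
      have e : ((P + 1 + m : ℕ) : ℤ) - P = m + 1 := by push_cast; ring
      rw [e, initTape_succ]
  · rintro ⟨m, hm, rfl⟩
    rcases le_or_gt m P with h | h
    · refine Or.inl ⟨m, h, ?_⟩
      rw [initTape, if_neg (by omega)]
    · obtain ⟨d, rfl⟩ : ∃ d, m = P + 1 + d := ⟨m - (P + 1), by omega⟩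
      refine Or.inr ⟨d, by omega, ?_⟩
      have e : ((P + 1 + d : ℕ) : ℤ) - P = d + 1 := by push_cast; ring
      rw [e, initTape_succ]

theorem toSets_tmpl₅ : toSets ((tmpl₅ M).den (statics a s n P)) = M.G₅ P := by
  ext K
  simp only [tmpl₅, mem_toSets_clause, G₅, Set.mem_singleton_iff, List.map_cons, List.map_nil,
    setOf_mem_cons, setOf_mem_nil, insert_empty_eq]
  simp [statics, litDen, SVar.den, Pos.val, Idx.var, posLit]

/-- In the second subgroup the first and the last cell are separate cases, since one displacement
leaves the table there. -/
theorem toSets_tmpl₆ : toSets ((tmpl₆ M).den (statics a s n P)) ∪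
    toSets ((tmpl₆' M).den (statics a s n P)) = M.G₆ P := by
  ext K
  rw [G₆, Set.mem_union, Set.mem_union]
  refine or_congr ?_ ?_
  · simp only [tmpl₆, mem_toSets_forBelow, mem_toSets_family, mem_toSets_clause,
      Set.mem_ofPred_eq, List.map_cons, List.map_nil, setOf_mem_cons, setOf_mem_nil,
      insert_empty_eq]
    simp [statics, litDen, SVar.den, Pos.val, Idx.var, Function.update, posLit, negLit,
      exists_mem_cells, Nat.lt_succ_iff]
  · simp only [tmpl₆', mem_toSets_forBelow, mem_toSets_append]
    simp only [Set.mem_ofPred_eq]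
    refine exists_congr fun i => and_congr_right fun hi => ?_
    have h1 := mem_toSets_tmplStep (K := K) (env := Function.update (statics a s n P) .i i) (P := P)
      (i := i) (j := -(P : ℤ)) (r := (.zero, 0)) (by simp [statics]) (by simp) hi
      (by simp [Pos.val, Idx.var, statics]) ⟨by omega, by omega⟩ (by
        rintro (_ | _ | _) r' h
        · simp [shiftPos] at h
        all_goals
          obtain rfl := by simpa [shiftPos] using h
          simp [Pos.val, Idx.var, statics, Move.shift, cells, Set.mem_Icc]
          omega) (by
        rintro (_ | _ | _) h
        · simp [Move.shift, cells, Set.mem_Icc]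
        all_goals simp [shiftPos] at h)
    have h2 := mem_toSets_tmplStep (K := K) (env := Function.update (statics a s n P) .i i) (P := P)
      (i := i) (j := (P : ℤ) + 1) (r := (.P2, 1)) (by simp [statics]) (by simp) hi
      (by simp [Pos.val, Idx.var, statics]; omega) ⟨by omega, by omega⟩ (by
        rintro (_ | _ | _) r' h
        on_goal 3 => simp [shiftPos] at h
        all_goals
          obtain rfl := by simpa [shiftPos] using h
          simp [Pos.val, Idx.var, statics, Move.shift, cells, Set.mem_Icc]
          omega) (by
        rintro (_ | _ | _) h
        on_goal 3 => simp [Move.shift, cells, Set.mem_Icc]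
        all_goals simp [shiftPos] at h)
    -- Interior cells are written as `j + 1` with `j < 2 * P`, so that the left neighbour is again a
    -- counter plus a natural number.
    have h3 : ∀ m < 2 * P, _ := fun m hm => mem_toSets_tmplStep (K := K)
      (env := Function.update (Function.update (statics a s n P) .i i) .j m) (P := P)
      (i := i) (j := (m : ℤ) + 1 - P) (r := (.j, 1)) (by simp [statics]) (by simp) hi
      (by simp [Pos.val, Idx.var]) ⟨by omega, by omega⟩ (by
        rintro (_ | _ | _) r' h
        all_goals
          obtain rfl := by simpa [shiftPos] using h
          simp [Pos.val, Idx.var, Move.shift, cells, Set.mem_Icc]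
          omega) (by
        rintro (_ | _ | _) h
        all_goals simp [shiftPos] at h)
    rw [h1, h2]
    constructor
    · rintro (h | h | ⟨m, hm, h⟩)
      · exact ⟨_, ⟨by omega, by omega⟩, h⟩
      · exact ⟨_, ⟨by omega, by omega⟩, h⟩
      · have hm' : m < 2 * P := by simpa [statics] using hm
        exact ⟨_, ⟨by omega, by omega⟩, (h3 m hm').1 h⟩
    · rintro ⟨j, ⟨hj1, hj2⟩, h⟩
      rcases eq_or_ne j (-(P : ℤ)) with rfl | hl
      · exact Or.inl h
      rcases eq_or_ne j ((P : ℤ) + 1) with rfl | hr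
      · exact Or.inr (Or.inl h)
      refine Or.inr (Or.inr ⟨(j + P - 1).toNat, by simp [statics]; omega, ?_⟩)
      refine (h3 _ (by omega)).2 ?_
      have : (((j + P - 1).toNat : ℕ) : ℤ) + 1 - P = j := by omega
      rwa [this]

end groups

end

end CookLevin

/-! ### The instance describing the tableau -/

namespace CookLevin

open StackProg TableauVar NDTM

variable {A : Type} (M : NDTM A)

/-- The clauses of the tableau. -/
noncomputable def tableauList (P : ℕ) (x : List A) : List (List (Literal (TableauVar M))) :=
  (tableauTmpl M).den (statics (Nat.card M.State) (Nat.card M.Sym) x.length P) ++ symClauses M P x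

theorem toSets_tableauList (P : ℕ) (x : List A) :
    toSets (tableauList M P x) = M.tableauClauses P x := by
  rw [tableauClauses, ← toSets_tmpl₁ M (Nat.card M.State) (Nat.card M.Sym) x.length,
    ← toSets_tmpl₂ M (Nat.card M.State) (Nat.card M.Sym) x.length,
    ← toSets_tmpl₃ M (Nat.card M.State) (Nat.card M.Sym) x.length,
    ← toSets_tmpl₄ M (Nat.card M.State) (Nat.card M.Sym) x.length,
    ← toSets_tmpl₅ M (Nat.card M.State) (Nat.card M.Sym) x.length,
    ← toSets_tmpl₆ M (Nat.card M.State) (Nat.card M.Sym) x.length]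
  simp only [tableauList, tableauTmpl, Tmpl.den, toSets_append]
  ext K
  simp only [Set.mem_union]
  tauto

/-- Needed because the numbering is shown to be injective only on `tableauVars`. In the second part
of `G₆` the claim rests on the omission of head literals outside the cells. -/
theorem var_mem_tableauVars {P : ℕ} {x : List A} {K : Set (Literal (TableauVar M))}
    (hK : K ∈ M.tableauClauses P x) {l : Literal (TableauVar M)} (hl : l ∈ K) :
    l.var ∈ M.tableauVars P := by
  have hQ : ∀ {i : ℕ} (k : M.State), i ≤ P → Q i k ∈ M.tableauVars P :=
    fun k hi => Or.inl ⟨_, k, hi, rfl⟩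
  have hH : ∀ {i : ℕ} {j : ℤ}, i ≤ P → j ∈ cells P → H i j ∈ M.tableauVars P :=
    fun hi hj => Or.inr (Or.inl ⟨_, _, hi, hj, rfl⟩)
  have hS : ∀ {i : ℕ} {j : ℤ} (s : M.Sym), i ≤ P → j ∈ cells P → S i j s ∈ M.tableauVars P :=
    fun s hi hj => Or.inr (Or.inr ⟨_, _, s, hi, hj, rfl⟩)
  rcases hK with ((((hK | hK) | hK) | hK) | hK) | hK
  · rcases hK with ⟨i, hi, rfl⟩ | ⟨i, hi, k, k', -, rfl⟩
    · obtain ⟨k, rfl⟩ := hl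
      exact hQ k hi
    · rcases hl with rfl | rfl
      exacts [hQ _ hi, hQ _ hi]
  · rcases hK with ⟨i, hi, rfl⟩ | ⟨i, hi, j, hj, j', hj', -, rfl⟩
    · obtain ⟨j, hj, rfl⟩ := hl
      exact hH hi hj
    · rcases hl with rfl | rfl
      exacts [hH hi hj, hH hi hj']
  · rcases hK with ⟨i, hi, j, hj, rfl⟩ | ⟨i, hi, j, hj, k, k', -, rfl⟩
    · obtain ⟨k, rfl⟩ := hl
      exact hS k hi hj
    · rcases hl with rfl | rfl
      exacts [hS _ hi hj, hS _ hi hj]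
  · rcases hK with (rfl | rfl) | ⟨j, hj, rfl⟩
    · obtain rfl := hl
      exact hQ _ (Nat.zero_le _)
    · obtain rfl := hl
      exact hH (Nat.zero_le _) ⟨by omega, by omega⟩
    · obtain rfl := hl
      exact hS _ (Nat.zero_le _) hj
  · obtain rfl := hK
    obtain rfl := hl
    exact hQ _ le_rfl
  · rcases hK with ⟨i, hi, j, hj, s, rfl⟩ | ⟨i, hi, j, hj, k, s, g, rfl⟩
    · rcases hl with rfl | rfl | rfl
      exacts [hS _ hi.le hj, hH hi.le hj, hS _ hi hj]
    · rcases hl with (rfl | rfl | rfl) | ⟨t, -, ht, rfl⟩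
      exacts [hH hi.le hj, hQ _ hi.le, hS _ hi.le hj, ht]

/-! ### The numbering is a bijection -/

/-- The number of variables. -/
noncomputable def numTableauVars (P : ℕ) : ℕ := (P + 1) * width M P

theorem mul_add_inj {w i i' r r' : ℕ} (hr : r < w) (hr' : r' < w)
    (h : i * w + r = i' * w + r') : i = i' ∧ r = r' := by
  have h1 : (i * w + r) / w = i := by
    rw [mul_comm, Nat.mul_add_div (by omega), Nat.div_eq_of_lt hr, add_zero]
  have h2 : (i' * w + r') / w = i' := by
    rw [mul_comm, Nat.mul_add_div (by omega), Nat.div_eq_of_lt hr', add_zero]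
  have h3 : i = i' := by rw [← h1, ← h2, h]
  subst h3
  exact ⟨rfl, by omega⟩

theorem mul_add_lt {w i n r : ℕ} (hi : i < n) (hr : r < w) : i * w + r < n * w := by
  calc i * w + r < i * w + w := by omega
    _ = (i + 1) * w := by ring
    _ ≤ n * w := Nat.mul_le_mul_right _ hi

variable {M}

theorem stateNum_lt (k : M.State) : stateNum M k < Nat.card M.State := Fin.is_lt _

theorem symNum_lt (l : M.Sym) : symNum M l < Nat.card M.Sym := Fin.is_lt _

theorem stateNum_injective : Function.Injective (stateNum M) :=
  fun _ _ h => (Finite.equivFin M.State).injective (Fin.ext h)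

theorem symNum_injective : Function.Injective (symNum M) :=
  fun _ _ h => (Finite.equivFin M.Sym).injective (Fin.ext h)

theorem exists_stateNum {n : ℕ} (h : n < Nat.card M.State) : ∃ k, stateNum M k = n :=
  ⟨(Finite.equivFin M.State).symm ⟨n, h⟩, by simp [stateNum]⟩

theorem exists_symNum {n : ℕ} (h : n < Nat.card M.Sym) : ∃ k, symNum M k = n :=
  ⟨(Finite.equivFin M.Sym).symm ⟨n, h⟩, by simp [symNum]⟩

/-- Layout of the block of one time: first the states, then for each cell one head variable (`c =
0`) followed by the symbol variables (`c = symNum + 1`). -/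
theorem cell_lt {P : ℕ} {j : ℤ} (hj : j ∈ cells P) {c : ℕ} (hc : c < Nat.card M.Sym + 1) :
    Nat.card M.State + (j + P).toNat * (Nat.card M.Sym + 1) + c < width M P := by
  have : (j + P).toNat < 2 * P + 2 := by
    obtain ⟨h1, h2⟩ := hj
    omega
  have := mul_add_lt this hc
  rw [width]
  omega

theorem cell_inj {P : ℕ} {j j' : ℤ} (hj : j ∈ cells P) (hj' : j' ∈ cells P) {c c' : ℕ}
    (hc : c < Nat.card M.Sym + 1) (hc' : c' < Nat.card M.Sym + 1)
    (h : Nat.card M.State + (j + P).toNat * (Nat.card M.Sym + 1) + c =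
      Nat.card M.State + (j' + P).toNat * (Nat.card M.Sym + 1) + c') : j = j' ∧ c = c' := by
  obtain ⟨h1, h2⟩ := mul_add_inj hc hc' (by omega : (j + P).toNat * (Nat.card M.Sym + 1) + c =
    (j' + P).toNat * (Nat.card M.Sym + 1) + c')
  obtain ⟨_, _⟩ := hj
  obtain ⟨_, _⟩ := hj'
  exact ⟨by omega, h2⟩

variable (M)

theorem mapsTo_index (P : ℕ) : Set.MapsTo (index M P) (M.tableauVars P)
    (Set.Iio (numTableauVars M P)) := by
  rintro v (⟨i, k, hi, rfl⟩ | ⟨i, j, hi, hj, rfl⟩ | ⟨i, j, l, hi, hj, rfl⟩)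
  · refine mul_add_lt (Nat.lt_succ_of_le hi) ?_
    have := stateNum_lt k
    rw [width]
    omega
  · exact mul_add_lt (Nat.lt_succ_of_le hi) (cell_lt (c := 0) hj (by omega))
  · exact mul_add_lt (Nat.lt_succ_of_le hi)
      (cell_lt (c := symNum M l + 1) hj (by have := symNum_lt l; omega))

/-- Uniqueness of mixed-radix digits recovers the time, then the place in the block. Of the nine
cases, the six mixed ones contradict the ranges of the digits. -/
theorem injOn_index (P : ℕ) : Set.InjOn (index M P) (M.tableauVars P) := by
  have hQ : ∀ k : M.State, stateNum M k < width M P := fun k => by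
    have := stateNum_lt k
    rw [width]
    omega
  have hc : ∀ l : M.Sym, symNum M l + 1 < Nat.card M.Sym + 1 := fun l => by
    have := symNum_lt l
    omega
  rintro v (⟨i, k, hi, rfl⟩ | ⟨i, j, hi, hj, rfl⟩ | ⟨i, j, l, hi, hj, rfl⟩) v'
    (⟨i', k', hi', rfl⟩ | ⟨i', j', hi', hj', rfl⟩ | ⟨i', j', l', hi', hj', rfl⟩) h
  · obtain ⟨rfl, h'⟩ := mul_add_inj (hQ k) (hQ k') h
    rw [stateNum_injective h']
  · obtain ⟨rfl, h'⟩ := mul_add_inj (hQ k) (cell_lt (c := 0) hj' (by omega)) h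
    have := stateNum_lt k
    omega
  · obtain ⟨rfl, h'⟩ := mul_add_inj (hQ k) (cell_lt hj' (hc l')) h
    have := stateNum_lt k
    omega
  · obtain ⟨rfl, h'⟩ := mul_add_inj (cell_lt (c := 0) hj (by omega)) (hQ k') h
    have := stateNum_lt k'
    omega
  · obtain ⟨rfl, h'⟩ := mul_add_inj (cell_lt (c := 0) hj (by omega))
      (cell_lt (c := 0) hj' (by omega)) h
    rw [(cell_inj (c := 0) (c' := 0) hj hj' (by omega) (by omega) h').1]
  · obtain ⟨rfl, h'⟩ := mul_add_inj (cell_lt (c := 0) hj (by omega)) (cell_lt hj' (hc l')) h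
    have := (cell_inj (c := 0) hj hj' (by omega) (hc l') h').2
    omega
  · obtain ⟨rfl, h'⟩ := mul_add_inj (cell_lt hj (hc l)) (hQ k') h
    have := stateNum_lt k'
    omega
  · obtain ⟨rfl, h'⟩ := mul_add_inj (cell_lt hj (hc l)) (cell_lt (c := 0) hj' (by omega)) h
    have := (cell_inj (c' := 0) hj hj' (hc l) (by omega) h').2
    omega
  · obtain ⟨rfl, h'⟩ := mul_add_inj (cell_lt hj (hc l)) (cell_lt hj' (hc l')) h
    obtain ⟨rfl, h''⟩ := cell_inj hj hj' (hc l) (hc l') h'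
    rw [symNum_injective (by omega : symNum M l = symNum M l')]

theorem width_pos (P : ℕ) : 0 < width M P := by
  rw [width]
  positivity

theorem surjOn_index (P : ℕ) : Set.SurjOn (index M P) (M.tableauVars P)
    (Set.Iio (numTableauVars M P)) := by
  intro n hn
  have hn : n < (P + 1) * width M P := hn
  have hi : n / width M P ≤ P := Nat.lt_succ_iff.1 (Nat.div_lt_of_lt_mul (by rwa [mul_comm]))
  have hr : n % width M P < width M P := Nat.mod_lt _ (width_pos M P)
  have e : n / width M P * width M P + n % width M P = n := by
    rw [mul_comm]
    exact Nat.div_add_mod _ _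
  rcases lt_or_ge (n % width M P) (Nat.card M.State) with h | h
  · obtain ⟨k, hk⟩ := exists_stateNum h
    refine ⟨Q (n / width M P) k, Or.inl ⟨_, _, hi, rfl⟩, ?_⟩
    rw [index, hk, e]
  · obtain ⟨r, hr'⟩ : ∃ r, n % width M P = Nat.card M.State + r := ⟨_, (Nat.add_sub_of_le h).symm⟩
    rw [hr'] at e hr
    have hr2 : r < (2 * P + 2) * (Nat.card M.Sym + 1) := by
      rw [width] at hr
      omega
    have hj : r / (Nat.card M.Sym + 1) < 2 * P + 2 :=
      Nat.div_lt_of_lt_mul (by rwa [mul_comm])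
    have hc : r % (Nat.card M.Sym + 1) < Nat.card M.Sym + 1 := Nat.mod_lt _ (by omega)
    have e2 : r / (Nat.card M.Sym + 1) * (Nat.card M.Sym + 1) + r % (Nat.card M.Sym + 1) = r := by
      rw [mul_comm]
      exact Nat.div_add_mod _ _
    have hjc : ((r / (Nat.card M.Sym + 1) : ℕ) : ℤ) - P ∈ cells P := by
      generalize r / (Nat.card M.Sym + 1) = m at hj
      exact ⟨by omega, by omega⟩
    -- Last digit 0 means the head variable of the cell, and `c + 1` means the symbol with number
    -- `c`.
    rcases h0 : r % (Nat.card M.Sym + 1) with _ | c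
    · refine ⟨H (n / width M P) ((r / (Nat.card M.Sym + 1) : ℕ) - P),
        Or.inr (Or.inl ⟨_, _, hi, hjc, rfl⟩), ?_⟩
      rw [index, sub_add_cancel, Int.toNat_natCast]
      omega
    · obtain ⟨l, hl⟩ := exists_symNum (M := M) (by omega : c < Nat.card M.Sym)
      refine ⟨S (n / width M P) ((r / (Nat.card M.Sym + 1) : ℕ) - P) l,
        Or.inr (Or.inr ⟨_, _, _, hi, hjc, rfl⟩), ?_⟩
      rw [index, sub_add_cancel, Int.toNat_natCast, hl]
      omega

/-- The number of a variable of the tableau. -/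
noncomputable def varNum (P : ℕ) (v : TableauVar M) : Fin (numTableauVars M P) :=
  ⟨index M P v % numTableauVars M P,
    Nat.mod_lt _ (Nat.mul_pos (Nat.succ_pos P) (width_pos M P))⟩

/-- The reduction modulo the number of variables only makes `varNum` total; on tableau variables it
does nothing. -/
theorem varNum_val {P : ℕ} {v : TableauVar M} (hv : v ∈ M.tableauVars P) :
    (varNum M P v : ℕ) = index M P v := Nat.mod_eq_of_lt (mapsTo_index M P hv)

/-- The SAT instance for the tableau. -/
noncomputable def tableauInstance (P : ℕ) (x : List A) : SATInstance where
  numVars := numTableauVars M P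
  clauses := (tableauList M P x).map fun c => c.map (Literal.rename (varNum M P))

theorem var_mem_of_mem_tableauList {P : ℕ} {x : List A} {c : List (Literal (TableauVar M))}
    (hc : c ∈ tableauList M P x) {l : Literal (TableauVar M)} (hl : l ∈ c) :
    l.var ∈ M.tableauVars P := by
  refine var_mem_tableauVars M (x := x) (K := {l | l ∈ c}) ?_ hl
  rw [← toSets_tableauList]
  exact ⟨c, hc, rfl⟩

/-- The required numbering `g` is the inverse of `index` on `tableauVars`. Renaming by `varNum` and
then by `g` fixes every literal that occurs. -/
theorem isTableauInstance (P : ℕ) (x : List A) :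
    M.IsTableauInstance P x (tableauInstance M P x) := by
  have hs : ∀ n : Fin (numTableauVars M P), ∃ v ∈ M.tableauVars P, index M P v = n :=
    fun n => surjOn_index M P n.2
  choose g hg hgn using hs
  have hgv : ∀ v ∈ M.tableauVars P, g (varNum M P v) = v := fun v hv =>
    injOn_index M P (hg _) hv (by rw [hgn, varNum_val M hv])
  refine ⟨g, fun n n' h => Fin.ext ((hgn n).symm.trans ((congrArg (index M P) h).trans (hgn n'))), ?_, ?_⟩
  · ext v
    constructor
    · rintro ⟨n, rfl⟩
      exact hg n
    · exact fun hv => ⟨_, hgv v hv⟩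
  · have key : ∀ c ∈ tableauList M P x,
        Literal.rename g '' {l | l ∈ c.map (Literal.rename (varNum M P))} = {l | l ∈ c} := by
      intro c hc
      have hr : ∀ l ∈ c, Literal.rename g (Literal.rename (varNum M P) l) = l := by
        rintro ⟨v, b⟩ hl
        have := hgv v (var_mem_of_mem_tableauList M hc hl)
        simp [Literal.rename, this]
      ext l
      constructor
      · rintro ⟨l', hl', rfl⟩
        obtain ⟨l, hl, rfl⟩ := List.mem_map.1 hl'
        rw [hr l hl]
        exact hl
      · exact fun hl => ⟨_, List.mem_map_of_mem hl, hr l hl⟩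
    rw [← toSets_tableauList]
    ext K
    constructor
    · rintro ⟨_, ⟨c', hc', rfl⟩, rfl⟩
      obtain ⟨c, hc, rfl⟩ := List.mem_map.1 hc'
      exact ⟨c, hc, key c hc⟩
    · rintro ⟨c, hc, rfl⟩
      exact ⟨_, ⟨_, List.mem_map_of_mem hc, rfl⟩, key c hc⟩

theorem encode_tableauInstance (P : ℕ) (x : List A) :
    (tableauInstance M P x).encode =
      List.replicate (numTableauVars M P) .tick ++ encCnf M P (tableauList M P x) := by
  rw [SATInstance.encode]
  congr 1
  change ((tableauList M P x).map fun c => c.map (Literal.rename (varNum M P))).flatMap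
    (fun c => SATSymbol.clause :: c.flatMap (Literal.encode (m := numTableauVars M P))) = _
  rw [List.flatMap_map, encCnf]
  refine List.flatMap_congr fun c hc => ?_
  congr 1
  rw [List.flatMap_map]
  refine List.flatMap_congr fun l hl => ?_
  have := varNum_val M (var_mem_of_mem_tableauList M hc hl)
  obtain ⟨v, b⟩ := l
  cases b <;> simp [Literal.encode, Literal.rename, encLit, this]

/-- The map from inputs to tableaux is computable in polynomial time. -/
theorem polyTimeComputable_tableauInstance [Finite A] (p : Polynomial ℕ) :
    PolyTimeComputable id SATInstance.encode
      (fun x : List A => tableauInstance M (p.eval x.length) x) := by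
  have : Finite SATSymbol := by
    refine Finite.of_surjective (fun k : Fin 4 => match k with
      | 0 => SATSymbol.tick
      | 1 => .clause
      | 2 => .pos
      | 3 => .neg) ?_
    rintro (_ | _ | _ | _)
    exacts [⟨0, rfl⟩, ⟨1, rfl⟩, ⟨2, rfl⟩, ⟨3, rfl⟩]
  have hs : ∀ o, Gen.Inner (symTmpl M o).gen :=
    fun o => (inner_emit _).append (inner_litsGen _)
  refine polyTimeComputable_of_gen (Nat.card M.State) (Nat.card M.Sym) p
    (.append (.forBelow .u1 .P1 (.forBelow .u2 .W (.emit .tick))) (tableauTmpl M).gen)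
    (fun o => (symTmpl M o).gen) ?_ ?_ (fun o => (hs o).1) (fun o => (hs o).2) ?_
  · exact ⟨⟨by decide, by simp [Gen.Binds], by decide, by simp [Gen.Binds], trivial⟩,
      Tmpl.wf_gen (wf_tableauTmpl M)⟩
  · rintro v ((rfl | rfl | h) | h)
    · trivial
    · trivial
    · exact h.elim
    · rcases Tmpl.binds_gen h with h | rfl | rfl
      · exact Tmpl.isLoop_of_binds (wf_tableauTmpl M) h
      all_goals trivial
  · intro x
    generalize p.eval x.length = P
    rw [encode_tableauInstance, Gen.den, Tmpl.den_gen _ (wf_tableauTmpl M) _ rfl, tableauList]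
    have h1 : (Gen.forBelow .u1 .P1 (.forBelow .u2 .W (.emit .tick)) : Gen Var SATSymbol).den
        (statics (Nat.card M.State) (Nat.card M.Sym) x.length P) =
        List.replicate (numTableauVars M P) .tick := by
      have := Gen.flatMap_replicate (List.range (P + 1)) (width M P) SATSymbol.tick
      have h2 := Gen.flatMap_replicate (List.range (width M P)) 1 SATSymbol.tick
      rw [List.length_range, mul_one] at h2
      rw [List.length_range, ← h2] at this
      exact this
    have h2 : symOut (fun o => (symTmpl M o).gen)
        (statics (Nat.card M.State) (Nat.card M.Sym) x.length P) x (P + 1) =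
        encCnf M P (symClauses M P x) := by
      rw [symOut, symClauses, encCnf, List.flatMap_map]
      refine List.flatMap_congr fun d _ => ?_
      refine (Tmpl.den_gen (symTmpl M x[d]?) trivial _ rfl).trans ?_
      -- In round `d` the counter `j` is `P + 1 + d`; counted from `-P`, this is cell `d + 1`.
      have e : (P : ℤ) + 1 + d - P = d + 1 := by ring
      simp [symTmpl, Tmpl.den, encCnf, litDen, SVar.den, Pos.val, Idx.var, statics, posLit, e]
    rw [h1, h2, encCnf, encCnf, encCnf, List.flatMap_append, List.append_assoc]
    rfl

end CookLevin

/-! ### Satisfying assignments of the tableau and accepting computations -/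

namespace CookLevin

open TableauVar NDTM

variable {A : Type} {M : NDTM A}

/-- Some assignment satisfies all clauses. -/
def SetSatisfiable {V : Type} (C : Set (Set (Literal V))) : Prop :=
  ∃ t : V → Bool, ∀ K ∈ C, ∃ l ∈ K, t l.var = l.sign

theorem satisfiable_iff_setSatisfiable {P : ℕ} {x : List A} {I : SATInstance}
    (h : M.IsTableauInstance P x I) :
    I.Satisfiable ↔ SetSatisfiable (M.tableauClauses P x) := by
  obtain ⟨g, hg, -, hI⟩ := h
  rw [← hI]
  constructor
  · rintro ⟨t, ht⟩
    -- Injectivity of `g` makes the transported assignment well defined; variables outside the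
    -- tableau get an arbitrary value.
    refine ⟨Function.extend g t fun _ => false, ?_⟩
    rintro _ ⟨_, ⟨c, hc, rfl⟩, rfl⟩
    obtain ⟨l, hl, e⟩ := ht c hc
    exact ⟨_, ⟨l, hl, rfl⟩, by simpa [Literal.rename, hg.extend_apply] using e⟩
  · rintro ⟨t, ht⟩
    refine ⟨t ∘ g, fun c hc => ?_⟩
    obtain ⟨_, ⟨l, hl, rfl⟩, e⟩ := ht _ ⟨_, ⟨c, hc, rfl⟩, rfl⟩
    exact ⟨l, hl, e⟩

/-- The result of an action. -/
def act (c : M.Cfg) (t : M.State × M.Sym × Move) : M.Cfg :=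
  ⟨t.1, c.head + t.2.2.shift, Function.update c.tape c.head t.2.1⟩

/-- One step, where a machine that has halted remains in its configuration. -/
def Next (c c' : M.Cfg) : Prop := ∃ t ∈ M.actions c.state (c.tape c.head), c' = act c t

theorem act_stay (c : M.Cfg) : act c (c.state, c.tape c.head, .stay) = c := by
  simp [act, Move.shift]

theorem next_of_step {c c' : M.Cfg} (h : M.Step c c') : Next c c' := by
  obtain ⟨h1, t, ht, rfl⟩ := h
  exact ⟨t, Or.inr ⟨h1, ht⟩, rfl⟩

theorem next_self {c : M.Cfg} (h : M.Halting c.state) : Next c c :=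
  ⟨_, Or.inl ⟨h, rfl⟩, (act_stay c).symm⟩

/-- A halted machine stays put under `actions`, so a halting computation extends to an infinite
path. This lets a computation of any length up to `P` fill the whole table. -/
theorem exists_path {x : List A} {n : ℕ} {c : M.Cfg} (h : M.Reaches x n c)
    (hc : M.Halting c.state) :
    ∃ f : ℕ → M.Cfg, f 0 = M.init x ∧ (∀ i, Next (f i) (f (i + 1))) ∧ ∀ i, n ≤ i → f i = c := by
  have : ∃ f : ℕ → M.Cfg, f 0 = M.init x ∧ (∀ i < n, Next (f i) (f (i + 1))) ∧ f n = c := by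
    clear hc
    induction h with
    | init => exact ⟨fun _ => M.init x, rfl, fun _ h => absurd h (Nat.not_lt_zero _), rfl⟩
    | @step n c c' _ hs ih =>
      obtain ⟨f, h0, hf, hn⟩ := ih
      refine ⟨fun i => if i ≤ n then f i else c', by simpa using h0, fun i hi => ?_, by simp⟩
      rcases (Nat.lt_succ_iff.1 hi).lt_or_eq with h | rfl
      · simpa [h.le, Nat.succ_le_of_lt h] using hf i h
      · simpa [hn] using next_of_step hs
  obtain ⟨f, h0, hf, hn⟩ := this
  refine ⟨fun i => f (min i n), by simpa using h0, fun i => ?_, fun i hi => by simpa [hi] using hn⟩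
  rcases lt_or_ge i n with h | h
  · simpa [h.le, Nat.succ_le_of_lt h] using hf i h
  · simpa [h, h.trans (Nat.le_succ i), hn] using next_self hc

theorem head_bounds {x : List A} {f : ℕ → M.Cfg} (h0 : f 0 = M.init x)
    (hf : ∀ i, Next (f i) (f (i + 1))) (i : ℕ) : 1 - (i : ℤ) ≤ (f i).head ∧ (f i).head ≤ 1 + i := by
  induction i with
  | zero => simp [h0, NDTM.init]
  | succ i ih =>
    obtain ⟨t, -, e⟩ := hf i
    have : (f (i + 1)).head = (f i).head + t.2.2.shift := by rw [e, act]
    have h2 : -1 ≤ t.2.2.shift ∧ t.2.2.shift ≤ 1 := by cases t.2.2 <;> simp [Move.shift]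
    push_cast
    omega

open Classical in
/-- The assignment that describes a sequence of configurations. -/
noncomputable def pathAssignment (f : ℕ → M.Cfg) : TableauVar M → Bool
  | Q i k => decide ((f i).state = k)
  | H i j => decide ((f i).head = j)
  | S i j l => decide ((f i).tape j = l)

/-- The assignment states what is true along the path; `head_bounds` ensures that the head is always
on one of the cells. -/
theorem setSatisfiable_of_path {P : ℕ} {x : List A} {f : ℕ → M.Cfg} (h0 : f 0 = M.init x)
    (hf : ∀ i, Next (f i) (f (i + 1))) (hP : (f P).state = M.accept) :
    SetSatisfiable (M.tableauClauses P x) := by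
  have hb := head_bounds h0 hf
  have hcell : ∀ i ≤ P, (f i).head ∈ cells P := fun i hi => by
    have := hb i
    exact ⟨by omega, by omega⟩
  have hQ : ∀ i k, pathAssignment f (Q i k) = true ↔ (f i).state = k := by simp [pathAssignment]
  have hH : ∀ i j, pathAssignment f (H i j) = true ↔ (f i).head = j := by simp [pathAssignment]
  have hS : ∀ i j l, pathAssignment f (S i j l) = true ↔ (f i).tape j = l := by
    simp [pathAssignment]
  have pos : ∀ {v : TableauVar M} {K : Set (Literal (TableauVar M))}, posLit v ∈ K →
      pathAssignment f v = true → ∃ l ∈ K, pathAssignment f l.var = l.sign :=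
    fun h e => ⟨_, h, e⟩
  have neg : ∀ {v : TableauVar M} {K : Set (Literal (TableauVar M))}, negLit v ∈ K →
      ¬ pathAssignment f v = true → ∃ l ∈ K, pathAssignment f l.var = l.sign :=
    fun h e => ⟨_, h, by simpa [negLit] using e⟩
  refine ⟨pathAssignment f, ?_⟩
  rintro K (((((hK | hK) | hK) | hK) | hK) | hK)
  · rcases hK with ⟨i, hi, rfl⟩ | ⟨i, hi, k, k', hk, rfl⟩
    · exact pos ⟨_, rfl⟩ ((hQ i _).2 rfl)
    · by_cases h : (f i).state = k
      · exact neg (Or.inr rfl) (fun h' => hk (h.symm.trans ((hQ _ _).1 h')))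
      · exact neg (Or.inl rfl) (fun h' => h ((hQ _ _).1 h'))
  · rcases hK with ⟨i, hi, rfl⟩ | ⟨i, hi, j, hj, j', hj', hjj, rfl⟩
    · exact pos ⟨_, hcell i hi, rfl⟩ ((hH i _).2 rfl)
    · by_cases h : (f i).head = j
      · exact neg (Or.inr rfl) (fun h' => hjj.ne (h.symm.trans ((hH _ _).1 h')))
      · exact neg (Or.inl rfl) (fun h' => h ((hH _ _).1 h'))
  · rcases hK with ⟨i, hi, j, hj, rfl⟩ | ⟨i, hi, j, hj, k, k', hk, rfl⟩
    · exact pos ⟨_, rfl⟩ ((hS i j _).2 rfl)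
    · by_cases h : (f i).tape j = k
      · exact neg (Or.inr rfl) (fun h' => hk (h.symm.trans ((hS _ _ _).1 h')))
      · exact neg (Or.inl rfl) (fun h' => h ((hS _ _ _).1 h'))
  · rcases hK with (rfl | rfl) | ⟨j, hj, rfl⟩
    · exact pos rfl ((hQ _ _).2 (by rw [h0]; rfl))
    · exact pos rfl ((hH _ _).2 (by rw [h0]; rfl))
    · exact pos rfl ((hS _ _ _).2 (by rw [h0]; rfl))
  · obtain rfl := hK
    exact pos rfl ((hQ _ _).2 hP)
  · rcases hK with ⟨i, hi, j, hj, l, rfl⟩ | ⟨i, hi, j, hj, k, l, g, rfl⟩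
    · by_cases h1 : (f i).tape j = l
      · by_cases h2 : (f i).head = j
        · exact pos (Or.inr (Or.inl rfl)) ((hH _ _).2 h2)
        · refine pos (Or.inr (Or.inr rfl)) ((hS _ _ _).2 ?_)
          obtain ⟨t, -, e⟩ := hf i
          rw [e, act, ← h1]
          exact Function.update_of_ne (Ne.symm h2) _ _
      · exact neg (Or.inl rfl) (fun h' => h1 ((hS _ _ _).1 h'))
    · by_cases h1 : (f i).head = j
      swap
      · exact neg (Or.inl (Or.inl rfl)) (fun h' => h1 ((hH _ _).1 h'))
      by_cases h2 : (f i).state = k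
      swap
      · exact neg (Or.inl (Or.inr (Or.inl rfl))) (fun h' => h2 ((hQ _ _).1 h'))
      by_cases h3 : (f i).tape j = l
      swap
      · exact neg (Or.inl (Or.inr (Or.inr rfl))) (fun h' => h3 ((hS _ _ _).1 h'))
      subst h1 h2 h3
      obtain ⟨t, ht, e⟩ := hf i
      refine pos (v := M.outcome i (f i).head t (g t)) (Or.inr ⟨t, ht, ?_, rfl⟩) ?_
      · cases g t
        · refine Or.inr (Or.inl ⟨i + 1, _, hi, ?_, rfl⟩)
          have := hcell (i + 1) hi
          rw [e] at this
          exact this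
        · exact Or.inl ⟨i + 1, _, hi, rfl⟩
        · exact Or.inr (Or.inr ⟨i + 1, _, _, hi, hj, rfl⟩)
      · cases g t
        · exact (hH _ _).2 (by rw [e]; rfl)
        · exact (hQ _ _).2 (by rw [e]; rfl)
        · exact (hS _ _ _).2 (by rw [e]; exact Function.update_self _ _ _)

/-- Row by row, a reachable configuration is built whose description is true under `t`. The number
of steps may be smaller than the row index, because a halted machine repeats its row. Uniqueness of
the state then identifies the final state with the accepting one. -/
theorem accepts_of_setSatisfiable {P : ℕ} {x : List A}
    (h : SetSatisfiable (M.tableauClauses P x)) : M.Accepts x := by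
  obtain ⟨t, ht⟩ := h
  have h1 : ∀ i ≤ P, ∀ k k', t (Q i k) = true → t (Q i k') = true → k = k' := by
    intro i hi k k' e e'
    by_contra hk
    obtain ⟨l, hl, h⟩ := ht {negLit (Q i k), negLit (Q i k')}
      (Or.inl (Or.inl (Or.inl (Or.inl (Or.inl (Or.inr ⟨i, hi, k, k', hk, rfl⟩))))))
    rcases hl with rfl | rfl <;> simp_all [negLit]
  have h2' : ∀ i ≤ P, ∀ j ∈ cells P, ∀ j' ∈ cells P, t (H i j) = true → t (H i j') = true →
      ¬ j < j' := by
    intro i hi j hj j' hj' e e' hk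
    obtain ⟨l, hl, h⟩ := ht {negLit (H i j), negLit (H i j')}
      (Or.inl (Or.inl (Or.inl (Or.inl (Or.inr (Or.inr ⟨i, hi, j, hj, j', hj', hk, rfl⟩))))))
    rcases hl with rfl | rfl <;> simp_all [negLit]
  have h2 : ∀ i ≤ P, ∀ j ∈ cells P, ∀ j' ∈ cells P, t (H i j) = true → t (H i j') = true →
      j = j' := fun i hi j hj j' hj' e e' =>
    le_antisymm (not_lt.1 (h2' i hi j' hj' j hj e' e)) (not_lt.1 (h2' i hi j hj j' hj' e e'))
  have key : ∀ i ≤ P, ∃ n c, M.Reaches x n c ∧ t (Q i c.state) = true ∧ c.head ∈ cells P ∧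
      t (H i c.head) = true ∧ ∀ j ∈ cells P, t (S i j (c.tape j)) = true := by
    intro i
    induction i with
    | zero =>
      intro _
      have hG : ∀ K ∈ M.G₄ P x, ∃ l ∈ K, t l.var = l.sign :=
        fun K hK => ht K (Or.inl (Or.inl (Or.inr hK)))
      refine ⟨0, M.init x, .init, ?_, ⟨?_, ?_⟩, ?_, fun j hj => ?_⟩
      · obtain ⟨l, rfl, h⟩ := hG _ (Or.inl (Or.inl rfl))
        exact h
      · change -(P : ℤ) ≤ 1
        omega
      · change 1 ≤ (P : ℤ) + 1
        omega
      · obtain ⟨l, rfl, h⟩ := hG _ (Or.inl (Or.inr rfl))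
        exact h
      · obtain ⟨l, rfl, h⟩ := hG _ (Or.inr ⟨j, hj, rfl⟩)
        exact h
    | succ i ih =>
      intro hi
      obtain ⟨n, c, hc, hq, hcell, hh, hs⟩ := ih (by omega)
      have hG : ∀ K ∈ M.G₆ P, ∃ l ∈ K, t l.var = l.sign := fun K hK => ht K (Or.inr hK)
      obtain ⟨τ, hτ, hout⟩ : ∃ τ ∈ M.actions c.state (c.tape c.head), ∀ s,
          M.outcome i c.head τ s ∈ M.tableauVars P ∧ t (M.outcome i c.head τ s) = true := by
        by_contra! hcon
        have : ∀ τ, ∃ s, τ ∈ M.actions c.state (c.tape c.head) →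
            M.outcome i c.head τ s ∈ M.tableauVars P → t (M.outcome i c.head τ s) ≠ true := by
          intro τ
          by_cases hτ : τ ∈ M.actions c.state (c.tape c.head)
          · obtain ⟨s, hs⟩ := hcon τ hτ
            exact ⟨s, fun _ => hs⟩
          · exact ⟨.head, fun h => absurd h hτ⟩
        -- Here `g` picks a failing aspect of each action, an omitted literal counting as failing;
        -- the clause of `G₆` for this `g` is then false.
        choose g hg using this
        obtain ⟨l, hl, h⟩ := hG _ (Or.inr ⟨i, hi, c.head, hcell, c.state, c.tape c.head, g, rfl⟩)
        have hs' := hs _ hcell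
        rcases hl with (rfl | rfl | rfl) | ⟨τ, hτ, hv, rfl⟩
        · simp_all [negLit]
        · simp_all [negLit]
        · simp_all [negLit]
        · exact hg τ hτ hv h
      have hreach : ∃ n, M.Reaches x n (act c τ) := by
        rcases hτ with ⟨_, rfl⟩ | ⟨hn, hτ⟩
        · exact ⟨n, by rwa [act_stay]⟩
        · exact ⟨n + 1, .step hc ⟨hn, τ, hτ, rfl⟩⟩
      obtain ⟨n', hn'⟩ := hreach
      refine ⟨n', act c τ, hn', (hout .state).2, ?_, (hout .head).2, fun j hj => ?_⟩
      · rcases (hout .head).1 with ⟨i, k, _, h⟩ | ⟨i, j, _, hj, h⟩ | ⟨i, j, l, _, _, h⟩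
        · cases h
        · cases h
          exact hj
        · cases h
      · by_cases h : j = c.head
        · subst h
          have := (hout .symbol).2
          rw [show (act c τ).tape c.head = τ.2.1 from Function.update_self _ _ _]
          exact this
        · rw [show (act c τ).tape j = c.tape j from Function.update_of_ne h _ _]
          obtain ⟨l, hl, e⟩ := hG _ (Or.inl ⟨i, hi, j, hj, c.tape j, rfl⟩)
          have hs' := hs j hj
          rcases hl with rfl | rfl | rfl
          · simp_all [negLit]
          -- Uniqueness of the head position rules out that an unscanned cell is declared scanned.
          · exact absurd (h2 i (by omega) j hj _ hcell e hh) h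
          · exact e
  obtain ⟨n, c, hc, hq, -⟩ := key P le_rfl
  obtain ⟨l, rfl, h⟩ := ht {posLit (Q P M.accept)} (Or.inl (Or.inr rfl))
  exact ⟨n, c, hc, h1 P le_rfl _ _ hq h⟩

theorem mem_iff_setSatisfiable {L : Language A} {T : ℕ → ℕ} (h : M.DecidesInTime L T)
    (x : List A) : x ∈ L ↔ SetSatisfiable (M.tableauClauses (T x.length) x) := by
  rw [h.2]
  constructor
  · rintro ⟨n, c, hc, ha⟩
    obtain ⟨f, h0, hf, hn⟩ := exists_path hc (Or.inl ha)
    exact setSatisfiable_of_path h0 hf (by rw [hn _ (h.1 x n c hc), ha])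
  · exact accepts_of_setSatisfiable

theorem mem_iff_satisfiable_tableauInstance {L : Language A} {p : Polynomial ℕ}
    (h : M.DecidesInTime L fun n => p.eval n) (x : List A) :
    x ∈ L ↔ (tableauInstance M (p.eval x.length) x).Satisfiable := by
  rw [satisfiable_iff_setSatisfiable (isTableauInstance M _ x), mem_iff_setSatisfiable h x]

end CookLevin

/-! ### A nondeterministic machine for SAT -/

namespace SATMachine

/-- The nonblank symbols on the tape: signs, ticks, the symbol that introduces a clause, a symbol
`del` for deleted cells, and a symbol `ok` that marks a true literal. -/
inductive Letter : Type
  | tick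
  | clause
  | sgn (s : Bool)
  | del
  | ok
  deriving DecidableEq, Fintype

/-- The states: `start` looks for the next variable, whose value `v` is guessed; `sweepU v` and
`sweepC v` pass through the list of variables and the clauses, where the number of each literal is
decreased (`carry`) or the literal is guessed to be the variable in question (`endLit`); `rewind`
returns to the first cell; `check` tests whether all clauses contain true literals. -/
inductive State : Type
  | start
  | sweepU (v : Bool)
  | sweepC (v : Bool)
  | carry (s v : Bool)
  | endLit (v : Bool)
  | rewind
  | check (b : Bool)
  | accept
  | reject
  deriving DecidableEq, Fintype

open Letter State

/-- The mark for a literal of sign `s` whose variable has the value `v`. -/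
def mark (s v : Bool) : Letter := if s = v then ok else del

/-- The transitions. -/
def delta : State → Option Letter → List (State × Option Letter × Move)
  | start, none => [(accept, none, .stay)]
  | start, some del => [(start, some del, .right)]
  | start, some tick => [(sweepU true, some del, .right), (sweepU false, some del, .right)]
  | start, some clause => [(check false, some clause, .right)]
  | sweepU _, none => [(rewind, none, .left)]
  | sweepU v, some tick => [(sweepU v, some tick, .right)]
  | sweepU v, some clause => [(sweepC v, some clause, .right)]
  | sweepC _, none => [(rewind, none, .left)]
  | sweepC v, some (sgn s) =>
    [(carry s v, some del, .right), (endLit v, some (mark s v), .right)]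
  | sweepC v, some a => [(sweepC v, some a, .right)]
  | carry s v, some tick => [(sweepC v, some (sgn s), .right)]
  | endLit _, some tick => []
  | endLit v, a => [(sweepC v, a, .stay)]
  | rewind, none => [(start, none, .right)]
  | rewind, some a => [(rewind, some a, .left)]
  | check b, some del => [(check b, some del, .right)]
  | check _, some ok => [(check true, some ok, .right)]
  | check true, some clause => [(check false, some clause, .right)]
  | check true, none => [(accept, none, .stay)]
  | _, _ => []

/-- The input symbols. -/
def letter : SATSymbol → Letter
  | .tick => tick
  | .clause => clause
  | .pos => sgn true
  | .neg => sgn false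

theorem letter_injective : Function.Injective letter := by
  rintro (_ | _ | _ | _) (_ | _ | _ | _) h <;> simp_all [letter]

/-- The machine. -/
def satNDTM : NDTM SATSymbol where
  State := State
  Sym := Option Letter
  finite_state := inferInstance
  finite_sym := inferInstance
  input a := some (letter a)
  input_injective := (Option.some_injective _).comp letter_injective
  blank := none
  input_ne_blank _ := Option.some_ne_none _
  start := start
  accept := accept
  reject := reject
  accept_ne_reject := by decide
  δ q a := {t | t ∈ delta q a}

/-! ### Configurations given by words -/

/-- The tape with the word `w` in the cells `1, 2, …`. -/
def tapeOf (w : List Letter) (j : ℤ) : Option Letter := if 1 ≤ j then w[(j - 1).toNat]? else none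

/-- A configuration. -/
def mkCfg (q : State) (h : ℤ) (T : ℤ → Option Letter) : satNDTM.Cfg := ⟨q, h, T⟩

/-- The configuration with `L.reverse` to the left of the head. -/
def cfg (q : State) (L R : List Letter) : satNDTM.Cfg :=
  mkCfg q (L.length + 1) (tapeOf (L.reverse ++ R))

/-- The configuration with the head to the left of the word. -/
def cfg0 (q : State) (R : List Letter) : satNDTM.Cfg := mkCfg q 0 (tapeOf R)

theorem tapeOf_head (L R : List Letter) :
    tapeOf (L.reverse ++ R) ((L.length : ℤ) + 1) = R.head? := by
  have : ((L.length : ℤ) + 1 - 1).toNat = L.length := by omega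
  rw [tapeOf, if_pos (by omega), this, List.getElem?_append_right (by simp)]
  cases R <;> simp

theorem tapeOf_write (L R : List Letter) (a b : Letter) :
    Function.update (tapeOf (L.reverse ++ a :: R)) ((L.length : ℤ) + 1) (some b) =
      tapeOf ((b :: L).reverse ++ R) := by
  funext j
  rw [List.reverse_cons, List.append_assoc, List.singleton_append, Function.update_apply]
  split_ifs with h
  · subst h
    exact (tapeOf_head L (b :: R)).symm
  · unfold tapeOf
    split_ifs with h1
    · have : (j - 1).toNat ≠ L.length := by omega
      rcases lt_or_gt_of_ne this with h2 | h2
      · rw [List.getElem?_append_left (by simpa using h2),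
          List.getElem?_append_left (by simpa using h2)]
      · obtain ⟨d, hd⟩ : ∃ d, (j - 1).toNat = L.length + (d + 1) :=
          ⟨(j - 1).toNat - L.length - 1, by omega⟩
        rw [List.getElem?_append_right (by simp; omega),
          List.getElem?_append_right (by simp; omega)]
        simp [hd]
    · rfl

/-- The result of an action. -/
def result (h : ℤ) (T : ℤ → Option Letter) (t : State × Option Letter × Move) : satNDTM.Cfg :=
  mkCfg t.1 (h + t.2.2.shift) (Function.update T h t.2.1)

theorem step_mkCfg_iff {q : State} {h : ℤ} {T : ℤ → Option Letter} {c : satNDTM.Cfg} :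
    satNDTM.Step (mkCfg q h T) c ↔
      (q ≠ accept ∧ q ≠ reject) ∧ ∃ t ∈ delta q (T h), c = result h T t := by
  rw [NDTM.Step, NDTM.Halting, not_or]
  rfl

/-- The result of an action in the configuration `cfg q L R`. -/
def resultAt (L R : List Letter) (t : State × Option Letter × Move) : satNDTM.Cfg :=
  result (L.length + 1) (tapeOf (L.reverse ++ R)) t

theorem step_cfg_iff {q : State} {L R : List Letter} {c : satNDTM.Cfg} :
    satNDTM.Step (cfg q L R) c ↔
      (q ≠ accept ∧ q ≠ reject) ∧ ∃ t ∈ delta q R.head?, c = resultAt L R t := by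
  rw [cfg, step_mkCfg_iff, tapeOf_head]
  rfl

theorem resultAt_right (q : State) (L R : List Letter) (a b : Letter) :
    resultAt L (a :: R) (q, some b, .right) = cfg q (b :: L) R := by
  simp [resultAt, result, cfg, tapeOf_write, Move.shift]

theorem resultAt_same (q : State) (L R : List Letter) (m : Move) :
    resultAt L R (q, R.head?, m) =
      mkCfg q ((L.length : ℤ) + 1 + m.shift) (tapeOf (L.reverse ++ R)) := by
  simp only [resultAt, result]
  rw [← tapeOf_head L R, Function.update_eq_self]

theorem resultAt_stay (q : State) (L R : List Letter) :
    resultAt L R (q, R.head?, .stay) = cfg q L R := by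
  simp [resultAt_same, cfg, Move.shift]

theorem step_cfg0_iff {q : State} {R : List Letter} {c : satNDTM.Cfg} :
    satNDTM.Step (cfg0 q R) c ↔
      (q ≠ accept ∧ q ≠ reject) ∧ ∃ t ∈ delta q none, c = result 0 (tapeOf R) t := by
  rw [cfg0, step_mkCfg_iff]
  rfl

theorem result_zero (q : State) (R : List Letter) :
    result 0 (tapeOf R) (q, none, .right) = cfg q [] R := by
  have : Function.update (tapeOf R) 0 none = tapeOf R := by
    rw [Function.update_eq_self_iff]
    rfl
  simp [result, cfg, Move.shift, this]

/-- Configurations that occur in computations; the numbers `i` and `k` count deleted cells and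
ticks at the beginning of the tape. -/
inductive WCfg : Type
  | start (i : ℕ) (R : List Letter)
  | sweepU (v : Bool) (i k : ℕ) (R : List Letter)
  | sweepC (v : Bool) (i k : ℕ) (B R : List Letter)
  | carry (s v : Bool) (i k : ℕ) (B R : List Letter)
  | endLit (v : Bool) (i k : ℕ) (B R : List Letter)
  | rewind (L R : List Letter)
  | rewind0 (R : List Letter)
  | check (b : Bool) (L R : List Letter)
  | accept (L R : List Letter)

/-- The word to the left of the clauses, in reverse order. -/
def preU (i k : ℕ) : List Letter := List.replicate k tick ++ List.replicate i del

namespace WCfg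

/-- The word to the left of the head, in reverse order. -/
def left : WCfg → List Letter
  | start i _ => List.replicate i del
  | sweepU _ i k _ => preU i k
  | sweepC _ i k B _ => B ++ Letter.clause :: preU i k
  | carry _ _ i k B _ => B ++ Letter.clause :: preU i k
  | endLit _ i k B _ => B ++ Letter.clause :: preU i k
  | rewind L _ => L
  | rewind0 _ => []
  | check _ L _ => L
  | accept L _ => L

/-- The configuration of the machine. -/
def toCfg : WCfg → satNDTM.Cfg
  | start i R => cfg .start (start i R).left R
  | sweepU v i k R => cfg (.sweepU v) (sweepU v i k R).left R
  | sweepC v i k B R => cfg (.sweepC v) (sweepC v i k B R).left R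
  | carry s v i k B R => cfg (.carry s v) (carry s v i k B R).left R
  | endLit v i k B R => cfg (.endLit v) (endLit v i k B R).left R
  | rewind L R => cfg .rewind L R
  | rewind0 R => cfg0 .rewind R
  | check b L R => cfg (.check b) L R
  | accept L R => cfg .accept L R

/-- Moving left and rewinding. -/
def moveLeft : List Letter → List Letter → WCfg
  | [], R => rewind0 R
  | a :: L, R => rewind L (a :: R)

/-- The possible next configurations. -/
def succ : WCfg → List WCfg
  | start i [] => [accept (List.replicate i del) []]
  | start i (del :: R) => [start (i + 1) R]
  | start i (tick :: R) => [sweepU true (i + 1) 0 R, sweepU false (i + 1) 0 R]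
  | start i (clause :: R) => [check false (clause :: List.replicate i del) R]
  | sweepU _ i k [] => [moveLeft (preU i k) []]
  | sweepU v i k (tick :: R) => [sweepU v i (k + 1) R]
  | sweepU v i k (clause :: R) => [sweepC v i k [] R]
  | sweepC _ i k B [] => [moveLeft (B ++ clause :: preU i k) []]
  | sweepC v i k B (sgn s :: R) => [carry s v i k (del :: B) R, endLit v i k (mark s v :: B) R]
  | sweepC v i k B (a :: R) => [sweepC v i k (a :: B) R]
  | carry s v i k B (tick :: R) => [sweepC v i k (sgn s :: B) R]
  | endLit _ _ _ _ (tick :: _) => []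
  | endLit v i k B R => [sweepC v i k B R]
  | rewind0 R => [start 0 R]
  | rewind L (a :: R) => [moveLeft L (a :: R)]
  | check b L (del :: R) => [check b (del :: L) R]
  | check _ L (ok :: R) => [check true (ok :: L) R]
  | check true L (clause :: R) => [check false (clause :: L) R]
  | check true L [] => [accept L []]
  | _ => []

theorem resultAt_left (L R : List Letter) :
    resultAt L R (.rewind, R.head?, .left) = (moveLeft L R).toCfg := by
  cases L <;> simp [resultAt_same, moveLeft, toCfg, cfg, cfg0, Move.shift]

/-- Configurations other than `rewind L []`. -/
def Proper : WCfg → Prop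
  | rewind _ R => R ≠ []
  | _ => True

theorem proper_moveLeft (L R : List Letter) : (moveLeft L R).Proper := by
  cases L <;> simp [moveLeft, Proper]

theorem proper_of_mem_succ {l l' : WCfg} (hl : l.Proper) (h : l' ∈ l.succ) : l'.Proper := by
  unfold succ at h
  split at h <;> simp only [List.mem_cons, List.not_mem_nil, or_false] at h
  all_goals
    first
      | exact h.elim
      | (subst h; first | exact proper_moveLeft _ _ | trivial)
      | (rcases h with rfl | rfl <;> trivial)

/-- Reduces the machine to the word rewriting `succ`. The excluded configuration `rewind L []` scans
the blank on the right, which the machine would mistake for the left end. -/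
theorem step_toCfg_iff {l : WCfg} (hl : l.Proper) {c : satNDTM.Cfg} :
    satNDTM.Step l.toCfg c ↔ ∃ l' ∈ l.succ, c = l'.toCfg := by
  have hstay := fun q L => resultAt_stay q L []
  have hstay' := fun q L a R => resultAt_stay q L (a :: R)
  have hleft := fun L => resultAt_left L []
  have hleft' := fun L a R => resultAt_left L (a :: R)
  simp only [List.head?_nil, List.head?_cons] at hstay hstay' hleft hleft'
  cases l with
  | start i R =>
    rw [toCfg, step_cfg_iff]
    rcases R with _ | ⟨_ | _ | _ | _ | _, R⟩ <;>
    simp [delta, succ, resultAt_right, hstay, toCfg, left, preU, List.replicate_succ]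
  | sweepU v i k R =>
    rw [toCfg, step_cfg_iff]
    rcases R with _ | ⟨_ | _ | _ | _ | _, R⟩ <;>
    simp [delta, succ, resultAt_right, hleft, toCfg, left, preU, List.replicate_succ]
  | sweepC v i k B R =>
    rw [toCfg, step_cfg_iff]
    rcases R with _ | ⟨_ | _ | _ | _ | _, R⟩ <;>
    simp [delta, succ, resultAt_right, hleft, toCfg, left]
  | carry s v i k B R =>
    rw [toCfg, step_cfg_iff]
    rcases R with _ | ⟨_ | _ | _ | _ | _, R⟩ <;>
    simp [delta, succ, resultAt_right, toCfg, left]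
  | endLit v i k B R =>
    rw [toCfg, step_cfg_iff]
    rcases R with _ | ⟨_ | _ | _ | _ | _, R⟩ <;>
    simp [delta, succ, hstay, hstay', toCfg, left]
  | rewind L R =>
    rw [toCfg, step_cfg_iff]
    rcases R with _ | ⟨_, R⟩
    · exact absurd rfl hl
    · simp [delta, succ, hleft']
  | rewind0 R =>
    rw [toCfg, step_cfg0_iff]
    simp [delta, succ, result_zero, toCfg, left]
  | check b L R =>
    rw [toCfg, step_cfg_iff]
    rcases R with _ | ⟨_ | _ | _ | _ | _, R⟩ <;> cases b <;>
    simp [delta, succ, resultAt_right, hstay, toCfg]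
  | accept L R =>
    rw [toCfg, step_cfg_iff]
    simp [succ]

end WCfg

end SATMachine

namespace SATMachine

open Letter

/-! ### Running time -/

namespace WCfg

/-- The word to the right of the head. -/
def right : WCfg → List Letter
  | start _ R => R
  | sweepU _ _ _ R => R
  | sweepC _ _ _ _ R => R
  | carry _ _ _ _ _ R => R
  | endLit _ _ _ _ R => R
  | rewind _ R => R
  | rewind0 R => R
  | check _ _ R => R
  | accept _ R => R

/-- The length of the word on the tape. -/
def size (l : WCfg) : ℕ := l.left.length + l.right.length

/-- The number of ticks on the tape. -/
def ticks (l : WCfg) : ℕ := l.left.count tick + l.right.count tick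

/-- A bound for the number of steps before the next variable is treated, if the length of the word
is `N`. -/
def phase (N : ℕ) : WCfg → ℕ
  | start _ R => 2 * R.length + 2
  | sweepU _ _ _ R => 2 * R.length + (3 * N + 9)
  | sweepC _ _ _ _ R => 2 * R.length + (3 * N + 8)
  | carry _ _ _ _ _ R => 2 * R.length + (3 * N + 9)
  | endLit _ _ _ _ R => 2 * R.length + (3 * N + 9)
  | rewind L _ => L.length + (2 * N + 5)
  | rewind0 _ => 2 * N + 4
  | check _ _ R => R.length + 1
  | accept _ _ => 0

/-- A bound for the number of steps. -/
def rank (N : ℕ) (l : WCfg) : ℕ := l.ticks * (5 * N + 10) + l.phase N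

theorem rank_lt {N : ℕ} {l l' : WCfg} (h : l.phase N < l'.phase N) (ht : l.ticks ≤ l'.ticks) :
    l.rank N < l'.rank N := by
  have := Nat.mul_le_mul_right (5 * N + 10) ht
  unfold rank
  omega

theorem size_moveLeft (L R : List Letter) :
    (moveLeft L R).size = L.length + R.length ∧
    (moveLeft L R).ticks = L.count tick + R.count tick ∧
    ∀ N, (moveLeft L R).phase N ≤ L.length + (2 * N + 4) := by
  cases L with
  | nil => simp [moveLeft, size, ticks, left, right, phase]
  | cons a L =>
    refine ⟨?_, ?_, fun N => ?_⟩ <;>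
      simp only [moveLeft, size, ticks, left, right, phase, List.count_cons, List.length_cons] <;>
      omega

theorem size_succ {l l' : WCfg} (h : l' ∈ l.succ) : l'.size = l.size := by
  have h1 := fun L R => (size_moveLeft L R).1
  unfold succ at h
  split at h <;> simp only [List.mem_cons, List.not_mem_nil, or_false] at h
  all_goals
    first
      | exact h.elim
      | (subst h; simp [h1]; simp [size, left, right, preU])
      | (subst h; simp [size, left, right, preU]; omega)
      | (rcases h with rfl | rfl <;> simp [size, left, right, preU] <;> omega)

/-- Within a phase the bound `phase` drops and no tick is created; sweeps count two steps per cell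
because `endLit` spends a stationary step. A new phase raises `phase`, but it erases a tick, which
is worth `5 * N + 10`. -/
theorem rank_succ {l l' : WCfg} (h : l' ∈ l.succ) : l'.rank l.size < l.rank l.size := by
  have h2 := fun L R => (size_moveLeft L R).2.1
  have h3 := fun L R => (size_moveLeft L R).2.2
  unfold succ at h
  split at h <;> simp only [List.mem_cons, List.not_mem_nil, or_false] at h
  all_goals
    first
      | exact h.elim
      | (subst h
         apply rank_lt <;>
          simp [ticks, size, left, right, preU, phase, List.count_cons, List.count_replicate] <;>
          omega)
      | (subst h
         apply rank_lt
         · refine (h3 _ _ _).trans_lt ?_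
           simp [size, left, right, preU, phase] <;> omega
         · rw [h2]
           simp [ticks, left, right, preU, List.count_cons, List.count_replicate] <;> omega)
      | (rcases h with rfl | rfl <;> apply rank_lt <;>
          simp [ticks, size, left, right, preU, phase, mark, List.count_cons,
            List.count_replicate] <;> (try split_ifs) <;> (try simp) <;> omega)
      | (rcases h with rfl | rfl <;>
          simp [rank, ticks, size, left, right, preU, phase, List.count_cons,
            List.count_replicate, Nat.add_mul] <;> omega)

end WCfg

/-! ### The meaning of configurations -/

/-- The number of ticks at the beginning of a word. -/
def leadTicks : List Letter → ℕ
  | tick :: w => leadTicks w + 1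
  | _ => 0

/-- Truth of the clauses given by a word, where the variable with number `n` has the value `f n`,
if it exists, `T` is a word that follows, and `K` is the condition on the latter. The first flag
says that a true literal has been found in the current clause, the second that a tick may follow. -/
def chkG (f : ℕ → Option Bool) (T : List Letter) (K : Bool → Bool → Prop) :
    List Letter → Bool → Bool → Prop
  | [], b, l => K b l
  | del :: w, b, _ => chkG f T K w b false
  | ok :: w, _, _ => chkG f T K w true false
  | clause :: w, b, _ => b = true ∧ chkG f T K w false false
  | tick :: w, b, l => l = true ∧ chkG f T K w b true
  | sgn s :: w, b, _ => ∃ v, f (leadTicks (w ++ T)) = some v ∧ chkG f T K w (b || v == s) true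

/-- Truth of the clauses given by a word. -/
def chk (f : ℕ → Option Bool) : List Letter → Bool → Bool → Prop :=
  chkG f [] fun b _ => b = true

/-- With the rest of the word passed as `T` and its condition as `K`, the boundary between treated
and untreated cells moves by one letter, as the head does. -/
theorem chkG_snoc {f : ℕ → Option Bool} {T : List Letter} {K : Bool → Bool → Prop} {a : Letter}
    (B : List Letter) (b l : Bool) :
    chkG f T K (B ++ [a]) b l ↔ chkG f (a :: T) (chkG f T K [a]) B b l := by
  induction B generalizing b l with
  | nil => rfl
  | cons c B ih => cases c <;> simp [chkG, ih]

theorem chkG_congr {f : ℕ → Option Bool} {T T' : List Letter} {K K' : Bool → Bool → Prop}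
    (hT : ∀ w, leadTicks (w ++ T) = leadTicks (w ++ T')) (hK : ∀ b l, K b l ↔ K' b l)
    (B : List Letter) (b l : Bool) : chkG f T K B b l ↔ chkG f T' K' B b l := by
  induction B generalizing b l with
  | nil => exact hK b l
  | cons c B ih => cases c <;> simp [chkG, ih, hT]

theorem leadTicks_append_of_ne {a a' : Letter} (ha : a ≠ tick) (ha' : a' ≠ tick)
    (T T' w : List Letter) : leadTicks (w ++ a :: T) = leadTicks (w ++ a' :: T') := by
  induction w with
  | nil => cases a <;> cases a' <;> simp_all [leadTicks]
  | cons c w ih => cases c <;> simp [leadTicks, ih]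

/-- The values of the first `m` variables. -/
def val (m : ℕ) (t : ℕ → Bool) (n : ℕ) : Option Bool := if n < m then some (t n) else none

/-- Some values of `m` variables make the clauses true. -/
def Sat (m : ℕ) (w : List Letter) : Prop := ∃ t, chk (val m t) w true false

/-- Satisfiability if `k` variables have been seen. -/
def goodU : ℕ → List Letter → Prop
  | _, [] => True
  | k, tick :: R => goodU (k + 1) R
  | k, clause :: R => Sat k (clause :: R)
  | _, _ => False

/-- Satisfiability, where deleted cells at the beginning are ignored. -/
def goodS : List Letter → Prop
  | del :: R => goodS R
  | R => goodU 0 R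

/-- Satisfiability with a given value of the first variable, where `k` more variables have been
seen. -/
def goodUv (v : Bool) : ℕ → List Letter → Prop
  | _, [] => True
  | k, tick :: R => goodUv v (k + 1) R
  | k, clause :: R => ∃ t, t 0 = v ∧ chk (val (k + 1) t) (clause :: R) true false
  | _, _ => False

/-- Satisfiability with a given value of the first variable, where the numbers of the literals in
`B` have been decreased. -/
def goodC (v : Bool) (k : ℕ) (B R : List Letter) : Prop :=
  ∃ t : ℕ → Bool, t 0 = v ∧
    chkG (val k fun n => t (n + 1)) R (chk (val (k + 1) t) R) B.reverse false false

/-- The condition for acceptance. -/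
def Good : WCfg → Prop
  | .start _ R => goodS R
  | .sweepU v _ k R => goodUv v k R
  | .sweepC v _ k B R => goodC v k B R
  | .carry s v _ k B R => ∃ R', R = tick :: R' ∧ goodC v k (sgn s :: B) R'
  | .endLit v _ k B R => (∀ R', R ≠ tick :: R') ∧ goodC v k B R
  | .rewind L R => goodS (L.reverse ++ R)
  | .rewind0 R => goodS R
  | .check b _ R => chk (fun _ => none) R b false
  | .accept _ _ => True

/-- This is the guess of the machine: the existential quantifier over assignments is split according
to the value of variable 0. -/
theorem goodU_succ_iff (k : ℕ) (R : List Letter) : goodU (k + 1) R ↔ ∃ v, goodUv v k R := by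
  induction R generalizing k with
  | nil => simp [goodU, goodUv]
  | cons a R ih =>
    cases a
    · exact ih (k + 1)
    · simp only [goodU, goodUv, Sat]
      constructor
      · rintro ⟨t, h⟩
        exact ⟨t 0, t, rfl, h⟩
      · rintro ⟨v, t, -, h⟩
        exact ⟨t, h⟩
    all_goals simp [goodU, goodUv]

theorem goodU_ticks (k n : ℕ) (R : List Letter) :
    goodU k (List.replicate n tick ++ R) ↔ goodU (k + n) R := by
  induction n generalizing k with
  | zero => rfl
  | succ n ih =>
    rw [List.replicate_succ, List.cons_append]
    exact (ih (k + 1)).trans (by rw [add_assoc, add_comm 1])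

theorem goodS_replicate (i : ℕ) (R : List Letter) :
    goodS (List.replicate i del ++ R) ↔ goodS R := by
  induction i with
  | zero => rfl
  | succ i ih => exact ih

theorem goodS_preU (i k : ℕ) (B : List Letter) :
    goodS ((preU i k).reverse ++ B) ↔ goodU k B ∨ k = 0 ∧ goodS B := by
  have : (preU i k).reverse ++ B = List.replicate i del ++ (List.replicate k tick ++ B) := by
    simp [preU]
  rw [this, goodS_replicate]
  cases k with
  | zero =>
    rcases B with _ | ⟨_ | _ | _ | _ | _, B⟩ <;> simp [goodS, goodU]
  | succ k =>
    have := goodU_ticks 0 (k + 1) B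
    rw [zero_add] at this
    rw [← this, List.replicate_succ]
    simp [goodS]

theorem good_moveLeft (L R : List Letter) : Good (WCfg.moveLeft L R) ↔ goodS (L.reverse ++ R) := by
  cases L <;> simp [WCfg.moveLeft, Good]

theorem goodC_nil (v : Bool) (k : ℕ) (B : List Letter) :
    goodC v k B [] ↔ ∃ t : ℕ → Bool, t 0 = v ∧
      chk (val k fun n => t (n + 1)) B.reverse false false := Iff.rfl

/-- After a complete sweep only the shifted assignment matters, so the guessed value may be
forgotten or put back in front. -/
theorem exists_goodC_nil (v : Bool) (k : ℕ) (B : List Letter) :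
    goodC v k B [] ↔ Sat k (clause :: B.reverse) := by
  rw [goodC_nil]
  constructor
  · rintro ⟨t, -, h⟩
    exact ⟨fun n => t (n + 1), rfl, h⟩
  · rintro ⟨t, h⟩
    refine ⟨fun n => match n with | 0 => v | n + 1 => t n, rfl, ?_⟩
    exact h.2

/-- Moving the boundary in `goodC`. -/
theorem goodC_cons {v : Bool} {k : ℕ} {a a' : Letter} {B R : List Letter}
    (hT : ∀ w, leadTicks (w ++ a :: R) = leadTicks (w ++ a' :: R))
    (h : ∀ t : ℕ → Bool, t 0 = v → ∀ b l, chk (val (k + 1) t) (a :: R) b l ↔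
      chkG (val k fun n => t (n + 1)) R (chk (val (k + 1) t) R) [a'] b l) :
    goodC v k B (a :: R) ↔ goodC v k (a' :: B) R := by
  unfold goodC
  refine exists_congr fun t => and_congr_right fun ht => ?_
  rw [List.reverse_cons, chkG_snoc]
  exact chkG_congr hT (h t ht) _ _ _

theorem chk_flag {f : ℕ → Option Bool} {R : List Letter} (hR : ∀ R', R ≠ tick :: R') (b l l' : Bool) :
    chk f R b l ↔ chk f R b l' := by
  rcases R with _ | ⟨_ | _ | _ | _ | _, R⟩
  · rfl
  · exact absurd rfl (hR R)
  all_goals rfl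

theorem leadTicks_eq_zero {R : List Letter} (hR : ∀ R', R ≠ tick :: R') : leadTicks R = 0 := by
  rcases R with _ | ⟨_ | _ | _ | _ | _, R⟩
  · rfl
  · exact absurd rfl (hR R)
  all_goals rfl

/-- A positive number is lowered by moving the sign onto the first tick. Under the shift of the
assignment, `n + 1 < k + 1` becomes `n < k`. -/
theorem goodC_sgn_tick (v s : Bool) (k : ℕ) (B R : List Letter) :
    goodC v k B (sgn s :: tick :: R) ↔ goodC v k (sgn s :: del :: B) R := by
  unfold goodC
  refine exists_congr fun t => and_congr_right fun _ => ?_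
  rw [List.reverse_cons, chkG_snoc, List.reverse_cons, chkG_snoc]
  refine chkG_congr (leadTicks_append_of_ne (by simp) (by simp) _ _) (fun b l => ?_) _ _ _
  simp [chk, chkG, leadTicks, val]

/-- Without a following tick the literal belongs to variable 0, whose value is `v`; its truth is
known and recorded by the mark. -/
theorem goodC_sgn_of_ne (v s : Bool) (k : ℕ) (B R : List Letter) (hR : ∀ R', R ≠ tick :: R') :
    goodC v k B (sgn s :: R) ↔ goodC v k (mark s v :: B) R := by
  have hm : mark s v ≠ tick := by
    unfold mark
    split_ifs <;> simp
  refine goodC_cons (leadTicks_append_of_ne (by simp) hm _ _) fun t ht b l => ?_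
  have h1 : chk (val (k + 1) t) (sgn s :: R) b l ↔ chk (val (k + 1) t) R (b || v == s) false := by
    rw [chk_flag hR _ false true]
    simp [chk, chkG, leadTicks_eq_zero hR, val, ht]
  rw [h1]
  unfold mark
  split_ifs with h
  · subst h
    simp [chkG]
  · have : (v == s) = false := by simpa using Ne.symm h
    simp [chkG, this]

/-- Goodness propagates both ways along single steps. The branching at a sign is no real choice:
`carry` requires a tick to follow and `endLit` forbids one. -/
theorem good_iff (l : WCfg) (hl : l.Proper) :
    Good l ↔ (∃ L R, l = .accept L R) ∨ ∃ l' ∈ l.succ, Good l' := by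
  cases l with
  | start i R =>
    rcases R with _ | ⟨_ | _ | _ | _ | _, R⟩
    · simp [Good, WCfg.succ, goodS, goodU]
    · simp [Good, WCfg.succ, goodS, goodU, goodU_succ_iff, or_comm]
    · simp [Good, WCfg.succ, goodS, goodU, Sat, chk, chkG, show ∀ t, val 0 t = fun _ => none from
        fun _ => rfl]
    all_goals simp [Good, WCfg.succ, goodS, goodU]
  | sweepU v i k R =>
    rcases R with _ | ⟨_ | _ | _ | _ | _, R⟩
    · have h : goodS ((preU i k).reverse ++ []) := (goodS_preU i k []).2 (Or.inl trivial)
      simp only [WCfg.succ, List.mem_singleton, exists_eq_left, good_moveLeft, h]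
      simp [Good, goodUv]
    · simp [Good, WCfg.succ, goodUv]
    · simp [Good, WCfg.succ, goodUv, goodC, chk, chkG]
    all_goals simp [Good, WCfg.succ, goodUv]
  | sweepC v i k B R =>
    rcases R with _ | ⟨_ | _ | s | _ | _, R⟩
    · have h : goodS ((preU i k).reverse ++ clause :: B.reverse) ↔ Sat k (clause :: B.reverse) := by
        rw [goodS_preU]
        refine or_iff_left_of_imp ?_
        rintro ⟨rfl, h⟩
        exact h
      simp only [WCfg.succ, List.mem_singleton, exists_eq_left, good_moveLeft]
      simp [Good, exists_goodC_nil, h]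
    · simpa [Good, WCfg.succ] using goodC_cons (v := v) (fun _ => rfl) fun t ht b l => Iff.rfl
    · simpa [Good, WCfg.succ] using goodC_cons (v := v) (fun _ => rfl) fun t ht b l => Iff.rfl
    · by_cases hR : ∃ R', R = tick :: R'
      · obtain ⟨R, rfl⟩ := hR
        simp [Good, WCfg.succ, goodC_sgn_tick]
      · have hR := not_exists.1 hR
        simp [Good, WCfg.succ, goodC_sgn_of_ne _ _ _ _ _ hR, hR]
    · simpa [Good, WCfg.succ] using goodC_cons (v := v) (fun _ => rfl) fun t ht b l => Iff.rfl
    · simpa [Good, WCfg.succ] using goodC_cons (v := v) (fun _ => rfl) fun t ht b l => Iff.rfl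
  | carry s v i k B R =>
    rcases R with _ | ⟨_ | _ | _ | _ | _, R⟩ <;> simp [Good, WCfg.succ]
  | endLit v i k B R =>
    rcases R with _ | ⟨_ | _ | _ | _ | _, R⟩ <;> simp [Good, WCfg.succ]
  | rewind L R =>
    rcases R with _ | ⟨a, R⟩
    · exact absurd rfl hl
    · simp only [WCfg.succ, List.mem_singleton, exists_eq_left, good_moveLeft]
      simp [Good]
  | rewind0 R => simp [Good, WCfg.succ]
  | check b L R =>
    rcases R with _ | ⟨_ | _ | _ | _ | _, R⟩ <;> cases b <;>
      simp [Good, WCfg.succ, chk, chkG]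
  | accept L R => simp [Good]

end SATMachine

namespace SATMachine

open Letter

/-! ### Acceptance and running time -/

theorem toCfg_start (x : List SATSymbol) :
    (WCfg.start 0 (x.map letter)).toCfg = satNDTM.init x := by
  have h : tapeOf (x.map letter) = satNDTM.initTape x := by
    funext j
    unfold tapeOf NDTM.initTape
    split_ifs with h
    · rw [List.getD_eq_getElem?_getD, List.getElem?_map, List.getElem?_map]
      cases x[(j - 1).toNat]? <;> rfl
    · rfl
  simp [WCfg.toCfg, WCfg.left, cfg, mkCfg, NDTM.init, h]
  rfl

theorem eq_accept_of_state {l : WCfg} (h : l.toCfg.state = State.accept) :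
    ∃ L R, l = .accept L R := by
  cases l with
  | accept L R => exact ⟨L, R, rfl⟩
  | start => exact State.noConfusion h
  | sweepU => exact State.noConfusion h
  | sweepC => exact State.noConfusion h
  | carry => exact State.noConfusion h
  | endLit => exact State.noConfusion h
  | rewind => exact State.noConfusion h
  | rewind0 => exact State.noConfusion h
  | check => exact State.noConfusion h

/-- The invariant carries both conclusions: goodness is pulled back to the input, and elapsed time
plus remaining rank never exceeds the initial rank. -/
theorem exists_of_reaches {x : List SATSymbol} {n : ℕ} {c : satNDTM.Cfg}
    (h : satNDTM.Reaches x n c) :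
    ∃ l : WCfg, c = l.toCfg ∧ l.Proper ∧ l.size = x.length ∧ (Good l → goodS (x.map letter)) ∧
      n + l.rank x.length ≤ (WCfg.start 0 (x.map letter)).rank x.length := by
  induction h with
  | init =>
    exact ⟨_, (toCfg_start x).symm, trivial, by simp [WCfg.size, WCfg.left, WCfg.right], id,
      by rw [zero_add]⟩
  | step _ hs ih =>
    obtain ⟨l, rfl, hl, hsize, hgood, hrank⟩ := ih
    obtain ⟨l', h', rfl⟩ := (WCfg.step_toCfg_iff hl).1 hs
    refine ⟨l', rfl, WCfg.proper_of_mem_succ hl h', (WCfg.size_succ h').trans hsize,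
      fun h => hgood ((good_iff l hl).2 (Or.inr ⟨l', h', h⟩)), ?_⟩
    have := WCfg.rank_succ h'
    rw [hsize] at this
    omega

/-- Always passing to a `Good` successor must end in acceptance, since the rank decreases. -/
theorem accepts_of_good {x : List SATSymbol} {n : ℕ} (l : WCfg) (hl : l.Proper) (h : Good l)
    (hr : satNDTM.Reaches x n l.toCfg) : satNDTM.Accepts x := by
  rcases (good_iff l hl).1 h with ⟨L, R, rfl⟩ | ⟨l', h', hg⟩
  · exact ⟨n, _, hr, rfl⟩
  · have := WCfg.rank_succ h'
    rw [← WCfg.size_succ h'] at this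
    exact accepts_of_good l' (WCfg.proper_of_mem_succ hl h') hg
      (hr.step ((WCfg.step_toCfg_iff hl).2 ⟨l', h', rfl⟩))
termination_by l.rank l.size
decreasing_by
  have h1 := WCfg.rank_succ h'
  rwa [← WCfg.size_succ h'] at h1 ⊢

theorem accepts_iff (x : List SATSymbol) : satNDTM.Accepts x ↔ goodS (x.map letter) := by
  constructor
  · rintro ⟨n, c, hr, hc⟩
    obtain ⟨l, rfl, -, -, hgood, -⟩ := exists_of_reaches hr
    obtain ⟨L, R, rfl⟩ := eq_accept_of_state hc
    exact hgood trivial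
  · intro h
    refine accepts_of_good (n := 0) (.start 0 (x.map letter)) trivial h ?_
    rw [toCfg_start]
    exact .init

/-- The running time. -/
noncomputable def time : Polynomial ℕ := .X * (5 * .X + 10) + (2 * .X + 2)

theorem le_time {x : List SATSymbol} {n : ℕ} {c : satNDTM.Cfg} (h : satNDTM.Reaches x n c) :
    n ≤ time.eval x.length := by
  obtain ⟨l, -, -, -, -, hrank⟩ := exists_of_reaches h
  have h1 : (WCfg.start 0 (x.map letter)).ticks ≤ x.length := by
    simpa [WCfg.ticks, WCfg.left, WCfg.right] using
      List.count_le_length (a := tick) (l := x.map letter)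
  have h2 := Nat.mul_le_mul_right (5 * x.length + 10) h1
  have h3 : time.eval x.length = x.length * (5 * x.length + 10) + (2 * x.length + 2) := by
    simp [time]
  have h4 : (WCfg.start 0 (x.map letter)).phase x.length = 2 * x.length + 2 := by
    simp [WCfg.phase]
  have h5 : (WCfg.start 0 (x.map letter)).rank x.length =
      (WCfg.start 0 (x.map letter)).ticks * (5 * x.length + 10) + (2 * x.length + 2) := by
    rw [← h4]
    rfl
  omega

/-! ### Encoded instances -/

/-- The code of a list of clauses. -/
def encodeClauses {m : ℕ} (cs : List (List (Literal (Fin m)))) : List SATSymbol :=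
  cs.flatMap fun c => SATSymbol.clause :: c.flatMap Literal.encode

theorem encodeClauses_cons {m : ℕ} (c : List (Literal (Fin m)))
    (cs : List (List (Literal (Fin m)))) :
    encodeClauses (c :: cs) =
      SATSymbol.clause :: (c.flatMap Literal.encode ++ encodeClauses cs) := by
  simp [encodeClauses]

theorem encodeClauses_ne_tick {m : ℕ} (cs : List (List (Literal (Fin m)))) (R : List Letter) :
    (encodeClauses cs).map letter ≠ tick :: R := by
  cases cs <;> simp [encodeClauses, letter]

theorem map_encode {m : ℕ} (a : Literal (Fin m)) :
    a.encode.map letter = sgn a.sign :: List.replicate a.var tick := by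
  obtain ⟨v, b⟩ := a
  cases b <;> simp [Literal.encode, letter]

theorem leadTicks_replicate (n : ℕ) (R : List Letter) :
    leadTicks (List.replicate n tick ++ R) = n + leadTicks R := by
  induction n with
  | zero => simp
  | succ n ih =>
    rw [List.replicate_succ, List.cons_append, leadTicks, ih]
    omega

theorem chk_replicate (f : ℕ → Option Bool) (n : ℕ) (R : List Letter) (b : Bool) :
    chk f (List.replicate n tick ++ R) b true ↔ chk f R b true := by
  induction n with
  | zero => rfl
  | succ n ih =>
    rw [List.replicate_succ, List.cons_append, ← ih]
    simp [chk, chkG]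

theorem literals_ne_tick {m : ℕ} (c : List (Literal (Fin m))) {R : List Letter}
    (hR : ∀ R', R ≠ tick :: R') (R' : List Letter) :
    (c.flatMap Literal.encode).map letter ++ R ≠ tick :: R' := by
  cases c with
  | nil => exact hR R'
  | cons a c => simp [map_encode]

theorem chk_literals {m : ℕ} (t : ℕ → Bool) (c : List (Literal (Fin m))) {R : List Letter}
    (hR : ∀ R', R ≠ tick :: R') (b l : Bool) :
    chk (val m t) ((c.flatMap Literal.encode).map letter ++ R) b l ↔
      chk (val m t) R (b || c.any fun a => t a.var == a.sign) false := by
  induction c generalizing b l with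
  | nil => simpa using chk_flag hR b l false
  | cons a c ih =>
    have h1 := literals_ne_tick c hR
    have h2 : ((a :: c).flatMap Literal.encode).map letter ++ R =
        sgn a.sign :: (List.replicate a.var tick ++
          ((c.flatMap Literal.encode).map letter ++ R)) := by
      simp [map_encode]
    rw [h2, List.any_cons, ← Bool.or_assoc, ← ih _ true, ← chk_replicate _ a.var]
    simp [chk, chkG, leadTicks_replicate, leadTicks_eq_zero h1, val]

theorem chk_encodeClauses {m : ℕ} (t : ℕ → Bool) (cs : List (List (Literal (Fin m))))
    (b : Bool) :
    chk (val m t) ((encodeClauses cs).map letter) b false ↔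
      b = true ∧ ∀ c ∈ cs, ∃ a ∈ c, t a.var = a.sign := by
  induction cs generalizing b with
  | nil => simp [encodeClauses, chk, chkG]
  | cons c cs ih =>
    have h := chk_literals t c (encodeClauses_ne_tick cs) false false
    rw [ih] at h
    rw [encodeClauses_cons, List.map_cons, List.map_append]
    refine (and_congr_right fun _ => h).trans ?_
    simp

/-- `chk` also checks syntax. The leading ticks belong to a literal whose sign stands before `w`;
the second flag says whether they are permitted. -/
theorem exists_of_chk {m : ℕ} {t : ℕ → Bool} {w : List SATSymbol} {b l : Bool}
    (h : chk (val m t) (w.map letter) b l) :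
    ∃ (n : ℕ) (c : List (Literal (Fin m))) (cs : List (List (Literal (Fin m)))),
      w = List.replicate n SATSymbol.tick ++ (c.flatMap Literal.encode ++ encodeClauses cs) ∧
        (l = false → n = 0) := by
  have hsgn : ∀ (w : List SATSymbol) (v s : Bool), (∀ {b l}, chk (val m t) (w.map letter) b l →
      ∃ (n : ℕ) (c : List (Literal (Fin m))) (cs : List (List (Literal (Fin m)))),
      w = List.replicate n SATSymbol.tick ++ (c.flatMap Literal.encode ++ encodeClauses cs) ∧
        (l = false → n = 0)) → ∀ b l, chk (val m t) (sgn s :: w.map letter) b l →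
      ∃ (c : List (Literal (Fin m))) (cs : List (List (Literal (Fin m)))),
      (if s then SATSymbol.pos else SATSymbol.neg) :: w =
        c.flatMap Literal.encode ++ encodeClauses cs := by
    intro w v s ih b l h
    obtain ⟨v, hv, h⟩ := h
    obtain ⟨n, c, cs, rfl, -⟩ := ih h
    have h1 := literals_ne_tick c (encodeClauses_ne_tick cs)
    simp only [List.append_nil, List.map_append, List.map_replicate, letter, leadTicks_replicate,
      leadTicks_eq_zero h1, val] at hv
    -- `val` is `none` beyond the listed variables, so a literal with too large a number cannot
    -- pass.
    have hn : n < m := by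
      by_contra hn
      simp [hn] at hv
    exact ⟨⟨⟨n, hn⟩, s⟩ :: c, cs, by simp [Literal.encode]⟩
  induction w generalizing b l with
  | nil => exact ⟨0, [], [], rfl, fun _ => rfl⟩
  | cons a w ih =>
    cases a with
    | tick =>
      obtain ⟨rfl, h⟩ := h
      obtain ⟨n, c, cs, rfl, -⟩ := ih h
      exact ⟨n + 1, c, cs, by simp [List.replicate_succ], by simp⟩
    | clause =>
      obtain ⟨n, c, cs, rfl, hn⟩ := ih h.2
      obtain rfl := hn rfl
      exact ⟨0, [], c :: cs, by simp [encodeClauses_cons], fun _ => rfl⟩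
    | pos =>
      obtain ⟨c, cs, h⟩ := hsgn w true true ih b l h
      exact ⟨0, c, cs, h, fun _ => rfl⟩
    | neg =>
      obtain ⟨c, cs, h⟩ := hsgn w true false ih b l h
      exact ⟨0, c, cs, h, fun _ => rfl⟩

theorem goodU_encodeClauses {m : ℕ} (cs : List (List (Literal (Fin m)))) :
    goodU m ((encodeClauses cs).map letter) ↔
      ∃ t : Fin m → Bool, ∀ c ∈ cs, ∃ a ∈ c, t a.var = a.sign := by
  have h : goodU m ((encodeClauses cs).map letter) ↔ Sat m ((encodeClauses cs).map letter) := by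
    cases cs with
    | nil => simp [encodeClauses, goodU, Sat, chk, chkG]
    | cons c cs =>
      rw [encodeClauses_cons]
      rfl
  rw [h, Sat]
  simp only [chk_encodeClauses, true_and]
  constructor
  · rintro ⟨t, ht⟩
    exact ⟨fun n => t n, ht⟩
  · rintro ⟨t, ht⟩
    exact ⟨fun n => if h : n < m then t ⟨n, h⟩ else true, by simpa using ht⟩

theorem exists_of_goodU {k : ℕ} {w : List SATSymbol} (h : goodU k (w.map letter)) :
    ∃ (m n : ℕ) (cs : List (List (Literal (Fin m)))),
      m = k + n ∧ w = List.replicate n SATSymbol.tick ++ encodeClauses cs := by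
  induction w generalizing k with
  | nil => exact ⟨k, 0, [], rfl, rfl⟩
  | cons a w ih =>
    cases a with
    | tick =>
      obtain ⟨m, n, cs, hm, rfl⟩ := ih h
      exact ⟨m, n + 1, cs, by omega, by simp [List.replicate_succ]⟩
    | clause =>
      obtain ⟨t, -, ht⟩ := h
      obtain ⟨n, c, cs, rfl, hn⟩ := exists_of_chk ht
      obtain rfl := hn rfl
      exact ⟨k, 0, c :: cs, rfl, by simp [encodeClauses_cons]⟩
    | pos => exact h.elim
    | neg => exact h.elim

theorem goodS_map_letter (w : List SATSymbol) : goodS (w.map letter) ↔ goodU 0 (w.map letter) := by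
  rcases w with _ | ⟨_ | _ | _ | _, w⟩ <;> rfl

theorem goodS_encode (I : SATInstance) : goodS (I.encode.map letter) ↔ I.Satisfiable := by
  have : I.encode.map letter =
      List.replicate I.numVars tick ++ (encodeClauses I.clauses).map letter := by
    simp [SATInstance.encode, encodeClauses, letter]
  rw [goodS_map_letter, this, goodU_ticks, zero_add, goodU_encodeClauses]
  rfl

theorem goodS_iff_mem (w : List SATSymbol) : goodS (w.map letter) ↔ w ∈ SAT := by
  constructor
  · intro h
    obtain ⟨m, n, cs, hm, rfl⟩ := exists_of_goodU ((goodS_map_letter w).1 h)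
    rw [zero_add] at hm
    subst hm
    exact ⟨⟨m, cs⟩, (goodS_encode ⟨m, cs⟩).1 h, rfl⟩
  · rintro ⟨I, hI, rfl⟩
    exact (goodS_encode I).2 hI

/-- No injectivity of `encode` is required: `goodS` reads satisfiability off the word alone. -/
theorem encode_mem_SAT_iff (I : SATInstance) : I.encode ∈ SAT ↔ I.Satisfiable := by
  rw [← goodS_iff_mem, goodS_encode]

theorem inNP_SAT : InNP SAT :=
  ⟨satNDTM, time, fun _ _ _ h => le_time h, fun x => (goodS_iff_mem x).symm.trans
    (accepts_iff x).symm⟩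

end SATMachine


/-! ### NP-completeness and the refined statement -/

theorem PolyTimeComputable.comp_encoding {α β A B : Type} {ea : α → List A} {eb : β → List B}
    {f : α → β} (h : PolyTimeComputable ea eb f) :
    PolyTimeComputable ea id fun x => eb (f x) :=
  h.map fun c => ⟨c.toTM2ComputableAux, c.time, c.outputsFun⟩

open CookLevin in
theorem SATMachine.npComplete_SAT : NPComplete SAT := by
  refine ⟨inNP_SAT, fun A _ L ⟨M, p, h⟩ =>
    ⟨_, (polyTimeComputable_tableauInstance M p).comp_encoding, fun x => ?_⟩⟩
  rw [encode_mem_SAT_iff]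
  exact mem_iff_satisfiable_tableauInstance h x

theorem mainTheorem1 :
    NPComplete SAT ∧
    ∀ (A : Type) [Fintype A] (L : Language A) (M : NDTM A) (p : Polynomial ℕ),
      M.DecidesInTime L (fun n => p.eval n) →
      ∃ f : List A → SATInstance,
        PolyTimeComputable id SATInstance.encode f ∧
        (∀ x, M.IsTableauInstance (p.eval x.length) x (f x)) ∧
        ∀ x, x ∈ L ↔ (f x).Satisfiable := by
  refine ⟨SATMachine.npComplete_SAT, fun A _ L M p h => ⟨_,
    CookLevin.polyTimeComputable_tableauInstance M p, fun x => ?_, fun x => ?_⟩⟩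
  · exact CookLevin.isTableauInstance M _ x
  · exact CookLevin.mem_iff_satisfiable_tableauInstance h x
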